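/- An approval election consists of a finite set $C$ of $m$ candidates and $n$ voters $v_1,\dots,v_n$, each with an approval ballot $A_i\subseteq C$ (possibly empty). The score of a candidate is the number of ballots that contain it, and the score of a committee $S\subseteq C$ is the sum of the scores of its members; for a committee size $k\in\{1,\dots,m\}$ the winning committees are all size-$k$ subsets of $C$ of highest score. For a linear order $\rhd$ of $C$ (the societal axis), the election is a candidate-interval (CI) election with respect to $\rhd$ if every ballot is an interval of $\rhd$ (the empty set included). In the problem AV-\$AddApprovals-CI-Bribery the input consists of an election together with an axis $\rhd$ with respect to which it is CI, a committee size $k\in\{1,\dots,m\}$, a preferred candidate $p\in C$, a budget $B\in\mathbb{N}$ (nonnegative integer), and, for every voter $v_i$ and every candidate $c$, a price $\pi_i(c)\in\mathbb{N}\cup\{+\infty\}$ of adding $c$ to the ballot of $v_i$ (prices of approvals already present are never charged). All numbers are written in binary; the candidates (in the order of the axis) and the ballots and prices (voter by voter, one entry per candidate) are listed explicitly. The question is whether there are ballots $A_i'\supseteq A_i$ such that 1. the election with ballots $A_1',\dots,A_n'$ is CI with respect to the same axis $\rhd$, 2. $\sum_{i=1}^n\sum_{c\in A_i'\setminus A_i}\pi_i(c)\le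 B$, and 3. $p$ belongs to at least one winning committee of size $k$ of the election with ballots $A_1',\dots,A_n'$. Theorem. AV-\$AddApprovals-CI-Bribery is in $\mathrm{P}$: some deterministic Turing machine decides, in time polynomial in the length of the input word, whether that word encodes a yes-instance of this problem. -/

import Mathlib

namespace AVBribery

open Finset

/-- A language over a finite alphabet `Γ` is in `P` if some Turing machine decides membership of
every word `w` in a number of steps that is polynomial in the length of `w`. -/
def InP {Γ : Type} [Fintype Γ] (L : Set (List Γ)) : Prop :=
  Nonempty (Turing.TM2ComputableInPolyTime (id : List Γ → List Γ) Computability.encodeBool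
    (fun w => @decide (w ∈ L) (Classical.propDecidable _)))

section Elections

variable {C V : Type} [DecidableEq C] [Fintype V]

/-- The approval score of a candidate: the number of voters who approve it. An approval election
with candidates `C` and voters `V` is given by the ballots `E : V → Finset C`. -/
def score (E : V → Finset C) (c : C) : ℕ := #{v : V | c ∈ E v}

/-- The approval score of a committee. -/
def committeeScore (E : V → Finset C) (S : Finset C) : ℕ := ∑ c ∈ S, score E c

/-- `S` is one of the (tied) winning committees of size `k` under multiwinner approval voting. -/
def IsWinningCommittee (E : V → Finset C) (k : ℕ) (S : Finset C) : Prop :=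
  #S = k ∧ ∀ T : Finset C, #T = k → committeeScore E T ≤ committeeScore E S

/-- The election is a candidate-interval election for the societal axis
`axis 0, axis 1, …, axis (m - 1)`: every ballot is a (possibly empty) interval of the axis. -/
def IsCI {m : ℕ} (axis : Fin m ≃ C) (E : V → Finset C) : Prop :=
  ∀ v : V, {i : Fin m | axis i ∈ E v}.OrdConnected

/-- The cost of the approvals that are in `E'` but not in `E`. -/
def addCost (price : V → C → ℕ∞) (E E' : V → Finset C) : ℕ∞ :=
  ∑ v : V, ∑ c ∈ E' v \ E v, price v c

end Elections

/-- An input of the bribery problem. The price of adding an approval is a nonnegative integer or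
`⊤` (the approval cannot be added); prices of approvals already present are never charged. -/
structure Instance where
  /-- number of candidates -/
  m : ℕ
  /-- number of voters -/
  n : ℕ
  /-- `axis i` is the candidate at position `i` of the societal axis -/
  axis : Equiv.Perm (Fin m)
  /-- the approval ballots -/
  ballot : Fin n → Finset (Fin m)
  /-- the price of adding a given candidate to a given voter's ballot -/
  price : Fin n → Fin m → ℕ∞
  /-- the preferred candidate -/
  p : Fin m
  /-- the committee size -/
  k : ℕ
  /-- the budget -/
  budget : ℕ
  one_le_k : 1 ≤ k
  k_le_m : k ≤ m
  isCI : IsCI axis ballot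

/-- It is possible to add approvals at total cost at most the budget so that the resulting election
is candidate-interval for the same axis and the preferred candidate belongs to at least one winning
committee. -/
def Instance.IsYes (I : Instance) : Prop :=
  ∃ E' : Fin I.n → Finset (Fin I.m),
    (∀ v, I.ballot v ⊆ E' v) ∧
    IsCI I.axis E' ∧
    addCost I.price I.ballot E' ≤ (I.budget : ℕ∞) ∧
    ∃ S : Finset (Fin I.m), IsWinningCommittee E' I.k S ∧ I.p ∈ S

open Computability (Γ')

/-- A natural number in binary, followed by a comma. -/
def encodeNumber (x : ℕ) : List Γ' :=
  (Computability.encodeNat x).map Γ'.bit ++ [Γ'.comma]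

/-- A price: a number in binary followed by a comma, or a blank for an infinite price. -/
def encodePrice : ℕ∞ → List Γ'
  | none => [Γ'.blank]
  | some x => encodeNumber x

/-- The row of a voter: in brackets, for each candidate in turn, one bit that tells whether the
voter approves the candidate, followed by the price of adding the candidate to the ballot. -/
def Instance.encodeVoter (I : Instance) (v : Fin I.n) : List Γ' :=
  [Γ'.bra] ++
    (List.finRange I.m).flatMap
      (fun c => Γ'.bit (decide (c ∈ I.ballot v)) :: encodePrice (I.price v c)) ++
    [Γ'.ket]

/-- The encoding of an input as a word: the preferred candidate, the committee size and the budget,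
all in binary; then, in brackets, the candidates in the order of the axis; then the voters' rows. -/
def Instance.encode (I : Instance) : List Γ' :=
  encodeNumber I.p ++ encodeNumber I.k ++ encodeNumber I.budget ++
    ([Γ'.bra] ++ (List.finRange I.m).flatMap (fun i => encodeNumber (I.axis i)) ++ [Γ'.ket]) ++
    (List.finRange I.n).flatMap I.encodeVoter

/-- The problem of priced bribery by adding approvals in candidate-interval elections, as a language: the encodings of all yes-instances. -/
def addApprovalsCIBribery : Set (List Γ') :=
  {w | ∃ I : Instance, I.encode = w ∧ I.IsYes}

end AVBribery

/-! ### A structured stack language and its compilation to `FinTM2` -/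

/-! Let `T` be the set of voters to whom a successful bribery adds the preferred candidate `p`.
Replace the new ballot of each voter in `T` by the smallest interval containing the old ballot and
`p`, and restore all other ballots. The score of `p` is unchanged, no other score and no cost goes
up, and all ballots are still intervals (`mem_of_adds`, `isCI_bribed`, `yes_rawOf`). By an exchange
argument `p` lies in a winning committee iff fewer than `k` candidates have a strictly larger score
(`exists_isWinningCommittee_iff`). So only the set `T` has to be chosen.

A ballot without `p` is empty or lies on one side of `p`, and its extension fills the gap up to `p`.
Hence, moving towards `p` from either end of the axis, the set of voters whose extension covers the
current position only grows (`cover_left_mono`, `cover_right_mono`). If each voter is decided on at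
the first position its extension covers, the points gained by a position are exactly the voters
bribed so far on that side (`sweep_spec`). Once `t`, the size of `T`, is guessed, the final score of
`p` is known and every candidate can be compared with `p` as the sweep passes it. The dynamic
program therefore needs only three small counters: bribed voters on the left, bribed voters on the
right, and candidates that beat `p`. For each triple it keeps the largest remaining budget; binary
prices and budgets occur only as stored values, never as indices. Completeness and soundness are
`exists_mem_table` and `exists_of_mem_table`; `yes_iff` combines them.

For the time bound, a structured language on stacks is compiled to Turing machines (`leads_compile`,
`machine_outputs`). Data are binary trees in prefix code. `Poly` collects the functions that have a
program with polynomial bounds on both running time and output size; it is closed under composition,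
pairing, case distinction and folds whose intermediate results stay polynomially small. The decision
procedure is an ordinary function built from these operations. Its parser is total, and a word is
recognised as an encoding by writing the parsed data out again and comparing. -/

namespace StackProg

open Computability (Γ')
open Turing

/-- The names of the stacks of a stack program. -/
inductive Ix
  | inp | main | aux | aux' | cnt
  deriving DecidableEq

instance : Fintype Ix := ⟨{.inp, .main, .aux, .aux', .cnt}, fun x => by cases x <;> decide⟩

/-- The content of the register: the last popped symbol. -/
abbrev Reg := Option Γ'

/-- The state of a stack program: a register and five stacks. -/
structure St where
  reg : Reg
  inp : List Γ'
  main : List Γ'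
  aux : List Γ'
  aux' : List Γ'
  cnt : List Γ'

/-- The content of a stack. -/
def St.get (s : St) : Ix → List Γ'
  | .inp => s.inp
  | .main => s.main
  | .aux => s.aux
  | .aux' => s.aux'
  | .cnt => s.cnt

/-- Replace the content of a stack. -/
def St.set (s : St) (i : Ix) (l : List Γ') : St :=
  match i with
  | .inp => { s with inp := l }
  | .main => { s with main := l }
  | .aux => { s with aux := l }
  | .aux' => { s with aux' := l }
  | .cnt => { s with cnt := l }

/-- Push a symbol that may depend on the register. -/
def St.push (s : St) (i : Ix) (f : Reg → Γ') : St := s.set i (f s.reg :: s.get i)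

/-- Pop a symbol into the register. -/
def St.pop (s : St) (i : Ix) : St := { s.set i (s.get i).tail with reg := (s.get i).head? }

@[simp] theorem St.get_push (s : St) (i j : Ix) (f : Reg → Γ') :
    (s.push i f).get j = Function.update s.get i (f s.reg :: s.get i) j := by
  cases i <;> cases j <;> rfl

@[simp] theorem St.get_pop (s : St) (i j : Ix) :
    (s.pop i).get j = Function.update s.get i (s.get i).tail j := by
  cases i <;> cases j <;> rfl

@[simp] theorem St.reg_push (s : St) (i : Ix) (f : Reg → Γ') : (s.push i f).reg = s.reg := by
  cases i <;> rfl

@[simp] theorem St.reg_pop (s : St) (i : Ix) : (s.pop i).reg = (s.get i).head? := rfl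

/-- Structured stack programs. -/
inductive Cmd
  | skip
  | push (i : Ix) (f : Reg → Γ')
  | pop (i : Ix)
  | seq (c d : Cmd)
  | ite (P : Reg → Bool) (c d : Cmd)
  | while (P : Reg → Bool) (c : Cmd)

/-- `Exec c s s' t`: started in `s`, the program `c` ends in `s'` after at most `t` steps. -/
inductive Exec : Cmd → St → St → ℕ → Prop
  | skip (s) : Exec .skip s s 0
  | push (s i f) : Exec (.push i f) s (s.push i f) 1
  | pop (s i) : Exec (.pop i) s (s.pop i) 1
  | seq {c d s s₁ s₂ t₁ t₂} : Exec c s s₁ t₁ → Exec d s₁ s₂ t₂ → Exec (.seq c d) s s₂ (t₁ + t₂)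
  | ite_true {P : Reg → Bool} {c d s s' t} :
      P s.reg = true → Exec c s s' t → Exec (.ite P c d) s s' (t + 2)
  | ite_false {P : Reg → Bool} {c d s s' t} :
      P s.reg = false → Exec d s s' t → Exec (.ite P c d) s s' (t + 2)
  | while_true {P : Reg → Bool} {c s s₁ s₂ t₁ t₂} : P s.reg = true → Exec c s s₁ t₁ →
      Exec (.while P c) s₁ s₂ t₂ → Exec (.while P c) s s₂ (t₁ + t₂ + 2)
  | while_false {P : Reg → Bool} {c s} : P s.reg = false → Exec (.while P c) s s 1
  | weaken {c s s' t t'} : Exec c s s' t → t ≤ t' → Exec c s s' t'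

/-- Instructions of the flat code. -/
inductive Op
  | push (i : Ix) (f : Reg → Γ')
  | pop (i : Ix)
  | jump (P : Reg → Bool) (l : ℕ)

/-- Translation of a structured program to flat code placed at a given address. -/
def compile : Cmd → ℕ → List Op
  | .skip, _ => []
  | .push i f, _ => [.push i f]
  | .pop i, _ => [.pop i]
  | .seq c d, b => compile c b ++ compile d (b + (compile c b).length)
  | .ite P c d, b =>
      let cc := compile c (b + 1)
      let e := b + 1 + cc.length + 1
      let cd := compile d e
      [.jump (fun r => !P r) e] ++ cc ++ [.jump (fun _ => true) (e + cd.length)] ++ cd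
  | .while P c, b =>
      let cc := compile c (b + 1)
      [.jump (fun r => !P r) (b + 1 + cc.length + 1)] ++ cc ++ [.jump (fun _ => true) b]

/-- One step of flat code. -/
def stepOp (code : List Op) : ℕ × St → ℕ × St := fun x =>
  match code[x.1]? with
  | none => x
  | some (.push i f) => (x.1 + 1, x.2.push i f)
  | some (.pop i) => (x.1 + 1, x.2.pop i)
  | some (.jump P l) => (bif P x.2.reg then l else x.1 + 1, x.2)

/-- `x` leads to `y` in at most `t` steps, all of them inside the code. -/
inductive Leads (code : List Op) : ℕ × St → ℕ × St → ℕ → Prop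
  | refl (x) : Leads code x x 0
  | step {x y t} : x.1 < code.length → Leads code (stepOp code x) y t → Leads code x y (t + 1)
  | weaken {x y t t'} : Leads code x y t → t ≤ t' → Leads code x y t'

theorem Leads.trans {code : List Op} {x y z : ℕ × St} {t t' : ℕ} (h : Leads code x y t)
    (h' : Leads code y z t') : Leads code x z (t + t') := by
  induction h with
  | refl => simpa using h'
  | step hx _ ih => exact ((ih h').step hx).weaken (by omega)
  | weaken _ hle ih => exact (ih h').weaken (by omega)

theorem Leads.single {code : List Op} {x y : ℕ × St} (hx : x.1 < code.length)
    (h : stepOp code x = y) : Leads code x y 1 :=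
  .step hx (h ▸ .refl _)

theorem stepOp_jump {pre post : List Op} {P : Reg → Bool} {l n : ℕ} (s : St)
    (hn : n = pre.length) :
    stepOp (pre ++ Op.jump P l :: post) (n, s) = (bif P s.reg then l else n + 1, s) := by
  subst hn
  simp [stepOp]

/-- Jump targets are absolute, so the induction quantifies over the code before and after the
program: for a subprogram, the rest of the construct is absorbed into this context. -/
theorem leads_compile {c : Cmd} {s s' : St} {t : ℕ} (h : Exec c s s' t) :
    ∀ (pre post : List Op), Leads (pre ++ compile c pre.length ++ post) (pre.length, s)
      (pre.length + (compile c pre.length).length, s') t := by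
  induction h with
  | skip s => intro pre post; exact .refl _
  | push s i f => intro pre post; exact .single (by simp [compile]) (by simp [stepOp, compile])
  | pop s i => intro pre post; exact .single (by simp [compile]) (by simp [stepOp, compile])
  | @seq c d s s₁ s₂ t₁ t₂ _ _ ih₁ ih₂ =>
    intro pre post
    have h₁ := ih₁ pre (compile d (pre.length + (compile c pre.length).length) ++ post)
    have h₂ := ih₂ (pre ++ compile c pre.length) post
    simp only [compile, List.length_append, List.append_assoc] at h₁ h₂ ⊢
    exact (h₁.trans (by simpa [add_assoc] using h₂))
  | @ite_true P c d s s' t hP _ ih =>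
    intro pre post
    simp only [compile]
    set e := pre.length + 1 + (compile c (pre.length + 1)).length + 1 with he
    set j₁ := Op.jump (fun r => !P r) e
    set j₂ := Op.jump (fun _ => true) (e + (compile d e).length)
    have h₁ := ih (pre ++ [j₁]) ([j₂] ++ compile d e ++ post)
    simp only [List.length_append, List.length_singleton, List.append_assoc] at h₁ ⊢
    -- The two extra steps are the failed jump at the test and the jump over the other branch.
    refine Leads.weaken (.step (by simp) ?_) (show t + 1 + 1 ≤ _ by omega)
    have : stepOp (pre ++ ([j₁] ++ (compile c (pre.length + 1) ++ ([j₂] ++ (compile d e ++ post)))))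
        (pre.length, s) = (pre.length + 1, s) := by
      simp [stepOp, j₁, hP]
    rw [this]
    refine h₁.trans (.single ?_ ?_)
    · simp; omega
    · have := stepOp_jump (pre := pre ++ j₁ :: compile c (pre.length + 1))
        (post := compile d e ++ post) (P := fun _ => true) (l := e + (compile d e).length)
        (n := pre.length + 1 + (compile c (pre.length + 1)).length) s' (by simp; omega)
      simp only [List.append_assoc, List.cons_append] at this
      refine this.trans ?_
      simp only [cond_true, he]
      congr 1
      omega
  | @ite_false P c d s s' t hP _ ih =>
    intro pre post
    simp only [compile]
    set e := pre.length + 1 + (compile c (pre.length + 1)).length + 1 with he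
    set j₁ := Op.jump (fun r => !P r) e
    set j₂ := Op.jump (fun _ => true) (e + (compile d e).length)
    have h₁ := ih (pre ++ [j₁] ++ compile c (pre.length + 1) ++ [j₂]) post
    have hl : (pre ++ [j₁] ++ compile c (pre.length + 1) ++ [j₂]).length = e := by
      simp [he]; omega
    rw [hl] at h₁
    simp only [List.append_assoc] at h₁ ⊢
    refine Leads.weaken (.step (by simp) ?_) (show t + 1 ≤ _ by omega)
    have : stepOp (pre ++ ([j₁] ++ (compile c (pre.length + 1) ++ ([j₂] ++ (compile d e ++ post)))))
        (pre.length, s) = (e, s) := by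
      simp [stepOp, j₁, hP]
    rw [this]
    convert h₁ using 2
    simp [he]; omega
  | @while_true P c s s₁ s₂ t₁ t₂ hP _ _ ih₁ ih₂ =>
    intro pre post
    -- The remaining rounds run the same code at the same address, which is where the closing jump
    -- leads.
    have h₂ := ih₂ pre post
    simp only [compile] at h₂ ⊢
    set e := pre.length + 1 + (compile c (pre.length + 1)).length + 1 with he
    set j₁ := Op.jump (fun r => !P r) e
    set j₂ := Op.jump (fun _ => true) pre.length
    have h₁ := ih₁ (pre ++ [j₁]) ([j₂] ++ post)
    simp only [List.length_append, List.length_singleton, List.append_assoc] at h₁ h₂ ⊢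
    refine Leads.weaken (.step (by simp) ?_) (show t₁ + (1 + t₂) + 1 ≤ _ by omega)
    have : stepOp (pre ++ ([j₁] ++ (compile c (pre.length + 1) ++ ([j₂] ++ post))))
        (pre.length, s) = (pre.length + 1, s) := by
      simp [stepOp, j₁, hP]
    rw [this]
    refine h₁.trans (Leads.trans (.single ?_ ?_) h₂)
    · simp; omega
    · have := stepOp_jump (pre := pre ++ j₁ :: compile c (pre.length + 1))
        (post := post) (P := fun _ => true) (l := pre.length)
        (n := pre.length + 1 + (compile c (pre.length + 1)).length) s₁ (by simp; omega)
      simp only [List.append_assoc, List.cons_append] at this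
      exact this
  | @while_false P c s hP =>
    intro pre post
    simp only [compile]
    refine .single (by simp) ?_
    simp [stepOp, hP]
    omega
  | weaken _ hle ih => intro pre post; exact (ih pre post).weaken hle

/-- The alphabets of the stacks of the machine: one output stack and the five program stacks. -/
abbrev Alph : Option Ix → Type
  | none => Bool
  | some _ => Γ'

/-- The test for the symbol that starts the code of a `true`. -/
def isNode (r : Reg) : Bool := decide (r = some (Γ'.bit true))

/-- The statement of the machine at a label. -/
def stmt (code : List Op) (l : Fin (code.length + 1)) :
    TM2.Stmt Alph (Fin (code.length + 1)) Reg :=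
  match code[l.1]? with
  -- The address just past the code: read the code of a truth value (one symbol or three) off the
  -- main stack, write the answer, and reset the register as a halting configuration demands.
  | none =>
    .pop (some .main) (fun _ o => o) <|
      .branch isNode
        (.pop (some .main) (fun v _ => v) <| .pop (some .main) (fun v _ => v) <|
          .push none (fun _ => true) <| .load (fun _ => none) .halt)
        (.push none (fun _ => false) <| .load (fun _ => none) .halt)
  | some (.push i f) => .push (some i) f (.goto fun _ => Fin.ofNat _ (l + 1))
  | some (.pop i) => .pop (some i) (fun _ o => o) (.goto fun _ => Fin.ofNat _ (l + 1))
  | some (.jump P l') => .goto fun r => bif P r then Fin.ofNat _ l' else Fin.ofNat _ (l + 1)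

/-- The Turing machine of a stack program. -/
def machine (c : Cmd) : FinTM2 where
  K := Option Ix
  k₀ := some .inp
  k₁ := none
  Γ := Alph
  Λ := Fin ((compile c 0).length + 1)
  main := 0
  σ := Reg
  initialState := none
  Γk₀Fin := inferInstanceAs (Fintype Γ')
  m := stmt (compile c 0)

/-- The stacks of the machine in a state of the program. -/
def stackOf (s : St) : ∀ k, List (Alph k)
  | none => []
  | some i => s.get i

theorem update_stackOf {s s' : St} {i : Ix} {l : List Γ'}
    (h : ∀ j, s'.get j = Function.update s.get i l j) :
    Function.update (stackOf s) (some i) l = stackOf s' := by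
  funext k
  cases k with
  | none => simp [stackOf]
  | some j =>
    simp only [stackOf, h]
    by_cases hj : j = i
    · subst hj; simp
    · rw [Function.update_of_ne hj, Function.update_of_ne (by simpa using hj)]
      rfl

/-- The configuration of the machine that belongs to an address and a state. -/
def cfg (code : List Op) (x : ℕ × St) : TM2.Cfg Alph (Fin (code.length + 1)) Reg :=
  ⟨some (Fin.ofNat _ x.1), x.2.reg, stackOf x.2⟩

/-- Labels are addresses modulo `code.length + 1`; an address inside the code is not changed by the
reduction. -/
theorem step_cfg (code : List Op) (x : ℕ × St) (hx : x.1 < code.length) :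
    TM2.step (stmt code) (cfg code x) = some (cfg code (stepOp code x)) := by
  obtain ⟨l, s⟩ := x
  have hl : (Fin.ofNat (code.length + 1) l).1 = l := by
    simp only [Fin.val_ofNat]; exact Nat.mod_eq_of_lt (by simp at hx; omega)
  have hx' : code[l]? = some code[l] := List.getElem?_eq_getElem hx
  simp only [cfg, TM2.step, stmt, stepOp, hl, hx']
  cases code[l] with
  | push i f => simp only [TM2.stepAux]; rw [update_stackOf (s' := s.push i f)] <;> simp [stackOf]
  | pop i => simp only [TM2.stepAux]; rw [update_stackOf (s' := s.pop i)] <;> simp [stackOf]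
  | jump P l' => simp only [TM2.stepAux]; cases P s.reg <;> simp

theorem iterate_of_leads {code : List Op} {x y : ℕ × St} {t : ℕ} (h : Leads code x y t) :
    ∃ n ≤ t, (flip bind (TM2.step (stmt code)))^[n] (some (cfg code x)) = some (cfg code y) := by
  induction h with
  | refl x => exact ⟨0, le_rfl, rfl⟩
  | @step x y t hx _ ih =>
    obtain ⟨n, hn, h⟩ := ih
    refine ⟨n + 1, by omega, ?_⟩
    rw [Function.iterate_succ_apply, ← h]
    congr 1
    exact step_cfg code x hx
  | weaken _ hle ih =>
    obtain ⟨n, hn, h⟩ := ih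
    exact ⟨n, by omega, h⟩

/-- The code of a truth value on the main stack. -/
def boolCode : Bool → List Γ'
  | false => [Γ'.bit false]
  | true => [Γ'.bit true, Γ'.bit false, Γ'.bit false]

/-- A halting configuration prescribes every stack, so the program must leave nothing but the truth
value. The additional step is the one at the final label. -/
theorem machine_outputs {c : Cmd} {w : List Γ'} {b : Bool} {r : Reg} {t : ℕ}
    (h : Exec c ⟨none, w, [], [], [], []⟩ ⟨r, [], boolCode b, [], [], []⟩ t) :
    Nonempty (TM2OutputsInTime (machine c) w (some (Computability.encodeBool b)) (t + 1)) := by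
  have h₁ := leads_compile h [] []
  simp only [List.nil_append, List.append_nil, List.length_nil, zero_add] at h₁
  obtain ⟨n, hn, h₂⟩ := iterate_of_leads h₁
  refine ⟨⟨⟨n + 1, ?_⟩, Nat.succ_le_succ hn⟩⟩
  have hinit : initList (machine c) w = cfg (compile c 0) (0, ⟨none, w, [], [], [], []⟩) := by
    simp only [initList, cfg, machine]
    congr 1
    funext k
    cases k with
    | none => rfl
    | some i => cases i <;> rfl
  have hfin : TM2.step (stmt (compile c 0))
      (cfg (compile c 0) ((compile c 0).length, ⟨r, [], boolCode b, [], [], []⟩)) =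
        some (haltList (machine c) (Computability.encodeBool b)) := by
    have hl : (Fin.ofNat ((compile c 0).length + 1) (compile c 0).length).1 =
        (compile c 0).length := by simp
    have hn : (compile c 0)[(compile c 0).length]? = none := by simp
    simp only [cfg, TM2.step, stmt, hl, hn]
    cases b
    all_goals
      simp [stackOf, St.get, boolCode, isNode, haltList, machine, Computability.encodeBool]
      congr 1
      congr 1
      funext k
      cases k with
      | none => rfl
      | some i => cases i <;> rfl
  rw [hinit, Function.iterate_succ_apply']
  exact (congrArg _ h₂).trans hfin

end StackProg

/-! ### Binary trees on the main stack -/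

namespace StackProg

open Computability (Γ')

/-- Binary trees, the universal data type. -/
inductive Tree
  | leaf
  | node (l r : Tree)

namespace Tree

/-- The prefix code of a tree. -/
def code : Tree → List Γ'
  | leaf => [Γ'.bit false]
  | node l r => Γ'.bit true :: (code l ++ code r)

/-- The length of the prefix code. -/
def size : Tree → ℕ
  | leaf => 1
  | node l r => size l + size r + 1

theorem length_code (x : Tree) : x.code.length = x.size := by
  induction x with
  | leaf => rfl
  | node l r hl hr => simp [code, size, hl, hr]

theorem one_le_size (x : Tree) : 1 ≤ x.size := by
  cases x <;> simp [size]

/-- The length of the right spine. -/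
def spine : Tree → ℕ
  | leaf => 0
  | node _ r => spine r + 1

/-- Codes consist of bits, so a comma on a stack can serve as a marker below a code. -/
theorem exists_bit_of_mem_code (x : Tree) : ∀ a ∈ x.code, ∃ b, a = Γ'.bit b := by
  induction x with
  | leaf => simp [code]
  | node l r hl hr =>
    intro a ha
    simp only [code, List.mem_cons, List.mem_append] at ha
    rcases ha with rfl | ha | ha
    exacts [⟨true, rfl⟩, hl a ha, hr a ha]

end Tree

/-! ### Reading, moving and duplicating trees -/

open Cmd

theorem Exec.seq' {c d : Cmd} {s s₁ s₂ : St} {t₁ t₂ t : ℕ} (h : Exec c s s₁ t₁)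
    (h' : Exec d s₁ s₂ t₂) (ht : t₁ + t₂ ≤ t) : Exec (.seq c d) s s₂ t :=
  (h.seq h').weaken ht

/-- Push a fixed symbol. -/
def pushC (i : Ix) (a : Γ') : Cmd := .push i fun _ => a

/-- Push the symbol in the register. -/
def pushR (i : Ix) : Cmd := .push i fun r => r.getD Γ'.blank

/-- Consume one symbol of a tree on the main stack, copy it to the selected stacks, and keep track
of the number of subtrees that are still to be read on the counter stack. -/
def walkBody (d d' : Bool) : Cmd :=
  .seq (.pop .main) <| .seq (bif d then pushR .aux else .skip) <|
    .seq (bif d' then pushR .aux' else .skip) <|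
    .seq (.ite isNode (.seq (pushC .cnt (Γ'.bit true)) (pushC .cnt (Γ'.bit true))) .skip)
      (.pop .cnt)

theorem exec_walkBody (d d' : Bool) (b : Bool) (r : Reg) (m a a' k : List Γ') :
    Exec (walkBody d d') ⟨r, [], Γ'.bit b :: m, a, a', k⟩
      ((⟨none, [], m, bif d then Γ'.bit b :: a else a, bif d' then Γ'.bit b :: a' else a',
        bif b then Γ'.bit true :: Γ'.bit true :: k else k⟩ : St).pop .cnt) 8 := by
  have h₂ : Exec (bif d then pushR .aux else .skip) ⟨some (Γ'.bit b), [], m, a, a', k⟩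
      ⟨some (Γ'.bit b), [], m, bif d then Γ'.bit b :: a else a, a', k⟩ 1 := by
    cases d
    · exact (Exec.skip _).weaken (by simp)
    · exact Exec.push _ _ _
  generalize (bif d then Γ'.bit b :: a else a) = A at h₂ ⊢
  have h₃ : Exec (bif d' then pushR .aux' else .skip) ⟨some (Γ'.bit b), [], m, A, a', k⟩
      ⟨some (Γ'.bit b), [], m, A, bif d' then Γ'.bit b :: a' else a', k⟩ 1 := by
    cases d'
    · exact (Exec.skip _).weaken (by simp)
    · exact Exec.push _ _ _
  generalize (bif d' then Γ'.bit b :: a' else a') = A' at h₃ ⊢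
  have h₄ : Exec (.ite isNode (.seq (pushC .cnt (Γ'.bit true)) (pushC .cnt (Γ'.bit true))) .skip)
      ⟨some (Γ'.bit b), [], m, A, A', k⟩ ⟨some (Γ'.bit b), [], m, A, A',
        bif b then Γ'.bit true :: Γ'.bit true :: k else k⟩ 4 := by
    cases b
    · exact (Exec.ite_false rfl (Exec.skip _)).weaken (by norm_num)
    · exact (Exec.ite_true rfl ((Exec.push _ _ _).seq (Exec.push _ _ _)))
  exact Exec.seq' (Exec.pop _ _) (Exec.seq' h₂ (Exec.seq' h₃ (Exec.seq' h₄ (Exec.pop _ _)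
    le_rfl) le_rfl) le_rfl) (by norm_num)

/-- The loop that reads trees as long as the counter stack has ticks. -/
def walkLoop (d d' : Bool) : Cmd := .while isNode (walkBody d d')

/-- The tick in the register stands for the tree about to be read, the ticks on the counter stack
for those still to come. A node trades its own tick for two, a leaf for none, so a whole tree uses
up exactly one. The continuation form fits the induction: what follows the left subtree is the
reading of the right one. -/
theorem exec_walkLoop (d d' : Bool) (x : Tree) : ∀ (m a a' k : List Γ') (s : St) (t : ℕ),
    Exec (walkLoop d d') ((⟨none, [], m, bif d then x.code.reverse ++ a else a,
      bif d' then x.code.reverse ++ a' else a', k⟩ : St).pop .cnt) s t →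
    Exec (walkLoop d d') ⟨some (Γ'.bit true), [], x.code ++ m, a, a', k⟩ s (t + 10 * x.size) := by
  induction x with
  | leaf =>
    intro m a a' k s t h
    refine (Exec.while_true rfl (exec_walkBody d d' false _ _ _ _ _) ?_).weaken
      (show 8 + t + 2 ≤ _ by simp [Tree.size]; omega)
    simpa [Tree.code, walkLoop] using h
  | node l r hl hr =>
    intro m a a' k s t h
    have h₂ := hr m (bif d then l.code.reverse ++ Γ'.bit true :: a else a)
      (bif d' then l.code.reverse ++ Γ'.bit true :: a' else a') k s t (by
        convert h using 2
        cases d <;> cases d' <;> simp [Tree.code])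
    have h₁ := hl (r.code ++ m) (bif d then Γ'.bit true :: a else a)
      (bif d' then Γ'.bit true :: a' else a') (Γ'.bit true :: k) s _ (by
        convert h₂ using 1
        cases d <;> cases d' <;> simp [St.pop, St.set, St.get])
    refine (Exec.while_true rfl (exec_walkBody d d' true _ _ _ _ _)
      (t₂ := t + 10 * r.size + 10 * l.size) ?_).weaken
      (show 8 + (t + 10 * r.size + 10 * l.size) + 2 ≤ _ by simp [Tree.size]; omega)
    simpa [Tree.code, St.pop, St.set, St.get, walkLoop] using h₁

/-- Read one tree from the main stack. -/
def walk (d d' : Bool) : Cmd :=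
  .seq (pushC .cnt Γ'.comma) <| .seq (pushC .cnt (Γ'.bit true)) <| .seq (.pop .cnt) (walkLoop d d')

theorem exec_walk (d d' : Bool) (x : Tree) (r : Reg) (m a a' k : List Γ') :
    Exec (walk d d') ⟨r, [], x.code ++ m, a, a', k⟩
      ⟨some Γ'.comma, [], m, bif d then x.code.reverse ++ a else a,
      bif d' then x.code.reverse ++ a' else a', k⟩ (14 * x.size) := by
  have := x.one_le_size
  -- The comma below the single tick ends the loop after one tree.
  refine Exec.seq' (Exec.push _ _ _) (Exec.seq' (Exec.push _ _ _) (Exec.seq' (Exec.pop _ _)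
    (exec_walkLoop d d' x m a a' (Γ'.comma :: k) _ 1 ?_) le_rfl) le_rfl) (by omega)
  exact Exec.while_false rfl

/-- Discard the top tree. -/
def drop : Cmd := walk false false

theorem exec_drop (x : Tree) (r : Reg) (m a a' k : List Γ') :
    Exec drop ⟨r, [], x.code ++ m, a, a', k⟩ ⟨some Γ'.comma, [], m, a, a', k⟩ (14 * x.size) :=
  exec_walk false false x r m a a' k

/-- Move the top tree to the first auxiliary stack. -/
def stash : Cmd := .seq (pushC .aux Γ'.comma) (walk true false)

theorem exec_stash (x : Tree) (r : Reg) (m a a' k : List Γ') :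
    Exec stash ⟨r, [], x.code ++ m, a, a', k⟩
      ⟨some Γ'.comma, [], m, x.code.reverse ++ Γ'.comma :: a, a', k⟩ (15 * x.size) := by
  have := x.one_le_size
  exact Exec.seq' (Exec.push _ _ _) (exec_walk true false x r m (Γ'.comma :: a) a' k) (by omega)

/-- The test for a symbol that belongs to a tree. -/
def isBit (r : Reg) : Bool :=
  match r with
  | some (Γ'.bit _) => true
  | _ => false

/-- Move the symbols above the topmost marker of a stack to the main stack. -/
def unstash (i : Ix) : Cmd :=
  .seq (.pop i) <| .while isBit (.seq (pushR .main) (.pop i))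

/-- Moving symbols from stack to stack reverses them, so the reversed code returns in the right
order; the comma marker stops the loop. -/
theorem exec_unstash_aux (x : Tree) (r : Reg) (m a a' k : List Γ') :
    Exec (unstash .aux) ⟨r, [], m, x.code.reverse ++ Γ'.comma :: a, a', k⟩
      ⟨some Γ'.comma, [], x.code ++ m, a, a', k⟩ (4 * x.size + 2) := by
  have key : ∀ (l : List Γ') (_ : ∀ a ∈ l, ∃ b, a = Γ'.bit b) (m : List Γ'),
      Exec (.while isBit (.seq (pushR .main) (.pop .aux)))
        ((⟨none, [], m, l ++ Γ'.comma :: a, a', k⟩ : St).pop .aux)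
        ⟨some Γ'.comma, [], l.reverse ++ m, a, a', k⟩ (4 * l.length + 1) := by
    intro l
    induction l with
    | nil => intro _ m; exact Exec.while_false rfl
    | cons b l ih =>
      intro hl m
      obtain ⟨b, rfl⟩ := hl b (by simp)
      refine (Exec.while_true rfl (Exec.seq (Exec.push _ _ _) (Exec.pop _ _)) (?_ :
        Exec _ _ _ (4 * l.length + 1))).weaken (by simp; omega)
      have h := ih (fun a ha => hl a (by simp [ha])) (Γ'.bit b :: m)
      rw [List.reverse_cons, List.append_assoc]
      exact h
  have h := key x.code.reverse (by simpa using x.exists_bit_of_mem_code) m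
  simp only [List.reverse_reverse, List.length_reverse, x.length_code] at h
  exact Exec.seq' (Exec.pop _ _) h (by omega)

theorem exec_unstash_aux' (x : Tree) (r : Reg) (m a a' k : List Γ') :
    Exec (unstash .aux') ⟨r, [], m, a, x.code.reverse ++ Γ'.comma :: a', k⟩
      ⟨some Γ'.comma, [], x.code ++ m, a, a', k⟩ (4 * x.size + 2) := by
  have key : ∀ (l : List Γ') (_ : ∀ a ∈ l, ∃ b, a = Γ'.bit b) (m : List Γ'),
      Exec (.while isBit (.seq (pushR .main) (.pop .aux')))
        ((⟨none, [], m, a, l ++ Γ'.comma :: a', k⟩ : St).pop .aux')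
        ⟨some Γ'.comma, [], l.reverse ++ m, a, a', k⟩ (4 * l.length + 1) := by
    intro l
    induction l with
    | nil => intro _ m; exact Exec.while_false rfl
    | cons b l ih =>
      intro hl m
      obtain ⟨b, rfl⟩ := hl b (by simp)
      refine (Exec.while_true rfl (Exec.seq (Exec.push _ _ _) (Exec.pop _ _)) (?_ :
        Exec _ _ _ (4 * l.length + 1))).weaken (by simp; omega)
      have h := ih (fun a ha => hl a (by simp [ha])) (Γ'.bit b :: m)
      rw [List.reverse_cons, List.append_assoc]
      exact h
  have h := key x.code.reverse (by simpa using x.exists_bit_of_mem_code) m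
  simp only [List.reverse_reverse, List.length_reverse, x.length_code] at h
  exact Exec.seq' (Exec.pop _ _) h (by omega)

/-- Duplicate the top tree. -/
def dup : Cmd :=
  .seq (pushC .aux Γ'.comma) <| .seq (pushC .aux' Γ'.comma) <| .seq (walk true true) <|
    .seq (unstash .aux) (unstash .aux')

theorem exec_dup (x : Tree) (r : Reg) (m a a' k : List Γ') :
    Exec dup ⟨r, [], x.code ++ m, a, a', k⟩
      ⟨some Γ'.comma, [], x.code ++ (x.code ++ m), a, a', k⟩ (28 * x.size) := by
  have := x.one_le_size
  exact Exec.seq' (Exec.push _ _ _) (Exec.seq' (Exec.push _ _ _) (Exec.seq' (exec_walk _ _ x _ _ _ _ _)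
    (Exec.seq' (exec_unstash_aux x _ _ _ _ _) (exec_unstash_aux' x _ _ _ _ _) le_rfl) le_rfl)
    le_rfl) (by omega)

/-- `c` replaces the tree `x` on top of the main stack by `y` in at most `t` steps. -/
def Computes (c : Cmd) (x y : Tree) (t : ℕ) : Prop :=
  ∀ (r : Reg) (m a a' k : List Γ'), ∃ r' : Reg,
    Exec c ⟨r, [], x.code ++ m, a, a', k⟩ ⟨r', [], y.code ++ m, a, a', k⟩ t

theorem Computes.weaken {c : Cmd} {x y : Tree} {t t' : ℕ} (h : Computes c x y t) (ht : t ≤ t') :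
    Computes c x y t' := fun r m a a' k =>
  let ⟨r', h'⟩ := h r m a a' k
  ⟨r', h'.weaken ht⟩

theorem computes_skip (x : Tree) : Computes .skip x x 0 := fun r _ _ _ _ => ⟨r, .skip _⟩

theorem Computes.seq {c d : Cmd} {x y z : Tree} {t t' : ℕ} (h : Computes c x y t)
    (h' : Computes d y z t') : Computes (.seq c d) x z (t + t') := fun r m a a' k =>
  let ⟨r₁, h₁⟩ := h r m a a' k
  let ⟨r₂, h₂⟩ := h' r₁ m a a' k
  ⟨r₂, h₁.seq h₂⟩

/-- Push a leaf in place of the top tree. -/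
def leafCmd : Cmd := .seq drop (pushC .main (Γ'.bit false))

theorem computes_leaf (x : Tree) : Computes leafCmd x .leaf (15 * x.size) := fun r m a a' k =>
  ⟨_, Exec.seq' (exec_drop x r m a a' k) (Exec.push _ _ _) (by have := x.one_le_size; omega)⟩

/-- Left subtree. -/
def leftCmd : Cmd := .seq (.pop .main) <| .seq stash <| .seq drop (unstash .aux)

theorem computes_left (x y : Tree) : Computes leftCmd (.node x y) x (22 * (x.size + y.size)) :=
  fun r m a a' k => ⟨some Γ'.comma, by
    have := x.one_le_size
    have h₁ := exec_stash x (some (Γ'.bit true)) (y.code ++ m) a a' k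
    have h₂ := Exec.seq' (Exec.pop ⟨r, [], (Tree.node x y).code ++ m, a, a', k⟩ .main)
      (s₂ := ⟨some Γ'.comma, [], x.code ++ m, a, a', k⟩) (t₂ := 20 * x.size + 20 * y.size) (by
        have e : (⟨r, [], (Tree.node x y).code ++ m, a, a', k⟩ : St).pop .main =
          ⟨some (Γ'.bit true), [], x.code ++ (y.code ++ m), a, a', k⟩ := by
          simp [Tree.code, St.pop, St.set, St.get]
        rw [e]
        exact Exec.seq' h₁ (Exec.seq' (exec_drop y _ _ _ _ _) (exec_unstash_aux x _ _ _ _ _) le_rfl)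
          (by have := y.one_le_size; omega)) le_rfl
    exact h₂.weaken (by omega)⟩

/-- Right subtree. -/
def rightCmd : Cmd := .seq (.pop .main) drop

theorem computes_right (x y : Tree) : Computes rightCmd (.node x y) y (15 * x.size) :=
  fun r m a a' k => ⟨some Γ'.comma, by
    have := x.one_le_size
    have e : (⟨r, [], (Tree.node x y).code ++ m, a, a', k⟩ : St).pop .main =
      ⟨some (Γ'.bit true), [], x.code ++ (y.code ++ m), a, a', k⟩ := by
      simp [Tree.code, St.pop, St.set, St.get]
    refine Exec.seq' (Exec.pop _ .main) ?_ (show 1 + 14 * x.size ≤ _ by omega)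
    rw [e]
    exact exec_drop x _ _ _ _ _⟩

/-- Pairing of two results. -/
def pairCmd (c d : Cmd) : Cmd :=
  .seq dup <| .seq c <| .seq stash <| .seq d <| .seq (unstash .aux) (pushC .main (Γ'.bit true))

/-- The first result waits on an auxiliary stack while the second is computed. It is safe there
because `Computes` restores whatever lies below on every stack. -/
theorem Computes.pair {c d : Cmd} {x y z : Tree} {t t' : ℕ} (h : Computes c x y t)
    (h' : Computes d x z t') :
    Computes (pairCmd c d) x (.node y z) (28 * x.size + t + t' + 22 * y.size) :=
  fun r m a a' k => by
    have := y.one_le_size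
    obtain ⟨r₁, h₁⟩ := h (some Γ'.comma) (x.code ++ m) a a' k
    obtain ⟨r₂, h₂⟩ := h' (some Γ'.comma) m (y.code.reverse ++ Γ'.comma :: a) a' k
    refine ⟨some Γ'.comma, ?_⟩
    have e : (⟨some Γ'.comma, [], (Tree.node y z).code ++ m, a, a', k⟩ : St) =
        (⟨some Γ'.comma, [], y.code ++ (z.code ++ m), a, a', k⟩ : St).push .main
          (fun _ => Γ'.bit true) := by
      simp [Tree.code, St.push, St.set, St.get]
    rw [e]
    exact Exec.seq' (exec_dup x _ _ _ _ _) (Exec.seq' h₁ (Exec.seq' (exec_stash y _ _ _ _ _)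
      (Exec.seq' h₂ (Exec.seq' (exec_unstash_aux y _ _ _ _ _) (Exec.push _ _ _) le_rfl) le_rfl)
      le_rfl) le_rfl) (by omega)

/-- Case distinction on a result: if it is a leaf, go on with `d`; if it is a node, keep it, paired
with the argument, and go on with `e`. -/
def caseCmd (c d e : Cmd) : Cmd :=
  .seq dup <| .seq c <| .seq (.pop .main) <|
    .ite isNode (.seq (pushC .main (Γ'.bit true)) (.seq (pushC .main (Γ'.bit true)) e)) d

/-- Popping the root symbol of the result both tests and, for a leaf, removes it, which leaves the
copy of the argument. -/
theorem Computes.case_leaf {c d : Cmd} (e : Cmd) {x z : Tree} {t t' : ℕ} (h : Computes c x .leaf t)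
    (h' : Computes d x z t') : Computes (caseCmd c d e) x z (28 * x.size + t + t' + 3) :=
  fun r m a a' k => by
    obtain ⟨r₁, h₁⟩ := h (some Γ'.comma) (x.code ++ m) a a' k
    obtain ⟨r₂, h₂⟩ := h' (some (Γ'.bit false)) m a a' k
    exact ⟨r₂, Exec.seq' (exec_dup x _ _ _ _ _) (Exec.seq' h₁ (Exec.seq' (Exec.pop _ _)
      (Exec.ite_false rfl h₂) le_rfl) le_rfl) (by omega)⟩

/-- The popped root symbol is pushed back, and a second node symbol in front of it pairs the result
with the argument below. -/
theorem Computes.case_node {c e : Cmd} (d : Cmd) {x y y' z : Tree} {t t' : ℕ}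
    (h : Computes c x (.node y y') t) (h' : Computes e (.node (.node y y') x) z t') :
    Computes (caseCmd c d e) x z (28 * x.size + t + t' + 5) :=
  fun r m a a' k => by
    obtain ⟨r₁, h₁⟩ := h (some Γ'.comma) (x.code ++ m) a a' k
    obtain ⟨r₂, h₂⟩ := h' (some (Γ'.bit true)) m a a' k
    refine ⟨r₂, Exec.seq' (exec_dup x _ _ _ _ _) (Exec.seq' h₁ (Exec.seq' (Exec.pop _ _)
      (Exec.ite_true rfl (Exec.seq' (Exec.push _ _ _) (Exec.seq' (Exec.push _ _ _)
        (?_ : Exec _ _ _ t') le_rfl) le_rfl)) le_rfl) le_rfl)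
        (show 28 * x.size + (t + (1 + (1 + (1 + t') + 2))) ≤ _ by omega)⟩
    simpa [Tree.code, St.push, St.set, St.get, St.pop] using h₂

/-- Turn the spine of the left component of the top tree into ticks on the counter stack. -/
def spineLoop : Cmd :=
  .while isNode (.seq (pushC .cnt (Γ'.bit true)) (.seq drop (.pop .main)))

/-- The root symbol is already in the register. Each round drops the left child and pops the root of
the right child, so the rounds count the right spine. -/
theorem exec_spineLoop (n : Tree) (m a a' k : List Γ') : ∃ r',
    Exec spineLoop ((⟨none, [], n.code ++ m, a, a', k⟩ : St).pop .main)
      ⟨r', [], m, a, a', List.replicate n.spine (Γ'.bit true) ++ k⟩ (18 * n.size) := by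
  induction n generalizing k with
  | leaf => exact ⟨some (Γ'.bit false), (Exec.while_false rfl).weaken (by simp [Tree.size])⟩
  | node l n _ ih =>
    obtain ⟨r', h⟩ := ih (Γ'.bit true :: k)
    refine ⟨r', (Exec.while_true rfl (Exec.seq (s₁ := ⟨some (Γ'.bit true), [],
      l.code ++ (n.code ++ m), a, a', Γ'.bit true :: k⟩) ?_ (Exec.seq (exec_drop l _ _ _ _ _)
      (Exec.pop _ _))) ?_).weaken (show 1 + (14 * l.size + 1) + 18 * n.size + 2 ≤ _ by
        have := l.one_le_size; simp only [Tree.size]; omega)⟩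
    · have e : (⟨none, [], (Tree.node l n).code ++ m, a, a', k⟩ : St).pop .main =
        ⟨some (Γ'.bit true), [], l.code ++ (n.code ++ m), a, a', k⟩ := by
        simp [Tree.code, St.pop, St.set, St.get]
      rw [e]
      exact Exec.push _ _ _
    · have e : List.replicate (Tree.node l n).spine (Γ'.bit true) ++ k =
          List.replicate n.spine (Γ'.bit true) ++ Γ'.bit true :: k := by
        simp only [Tree.spine, List.replicate_succ', List.append_assoc, List.singleton_append]
      rw [e]
      exact h

/-- Bounded iteration. -/
def iterCmd (c : Cmd) : Cmd :=
  .seq (.pop .main) <| .seq (pushC .cnt Γ'.comma) <| .seq (.pop .main) <| .seq spineLoop <|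
    .seq (.pop .cnt) <| .while isNode (.seq c (.pop .cnt))

/-- The ticks obtained from the spine of `n` form the loop counter, with a comma at its end. The
body may use the counter stack above them, since it restores what it finds. -/
theorem Computes.iter {c : Cmd} {n : Tree} {x : ℕ → Tree} {t : ℕ}
    (h : ∀ i < n.spine, Computes c (x i) (x (i + 1)) t) :
    Computes (iterCmd c) (.node n (x 0)) (x n.spine) (18 * n.size + n.spine * (t + 3) + 5) :=
  fun r m a a' k => by
    -- `j` ticks are left after `i` rounds.
    have key : ∀ j i, i + j = n.spine →
        Exec (.while isNode (.seq c (.pop .cnt)))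
          ((⟨none, [], (x i).code ++ m, a, a',
            List.replicate j (Γ'.bit true) ++ Γ'.comma :: k⟩ : St).pop .cnt)
          ⟨some Γ'.comma, [], (x n.spine).code ++ m, a, a', k⟩ (j * (t + 3) + 1) := by
      intro j
      induction j with
      | zero => intro i hi; obtain rfl : i = n.spine := by omega
                exact (Exec.while_false rfl).weaken (by omega)
      | succ j ih =>
        intro i hi
        obtain ⟨r', h'⟩ := h i (by omega) (some (Γ'.bit true)) m a a'
          (List.replicate j (Γ'.bit true) ++ Γ'.comma :: k)
        exact (Exec.while_true rfl (Exec.seq h' (Exec.pop _ _)) (ih (i + 1) (by omega))).weaken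
          (by rw [Nat.succ_mul]; omega)
    obtain ⟨r', h'⟩ := exec_spineLoop n ((x 0).code ++ m) a a' (Γ'.comma :: k)
    refine ⟨some Γ'.comma, Exec.seq' (Exec.pop _ _) (Exec.seq' (Exec.push _ _ _)
      (Exec.seq' (Exec.pop _ _) (Exec.seq' (s₁ := ⟨r', [], (x 0).code ++ m, a, a',
        List.replicate n.spine (Γ'.bit true) ++ Γ'.comma :: k⟩) ?_ (Exec.seq' (Exec.pop _ _)
        (key _ 0 (by omega)) le_rfl) le_rfl) le_rfl) le_rfl)
      (show 1 + (1 + (1 + (18 * n.size + _))) ≤ _ by omega)⟩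
    convert h' using 1
    simp [Tree.code, St.push, St.set, St.get, St.pop]

/-- A tree for a truth value. -/
def boolTree : Bool → Tree
  | false => .leaf
  | true => .node .leaf .leaf

theorem code_boolTree (b : Bool) : (boolTree b).code = boolCode b := by cases b <;> rfl

/-- Three bits that determine a symbol. -/
def symBits : Γ' → Bool × Bool × Bool
  | .bit b => (true, b, false)
  | .comma => (false, false, false)
  | .blank => (false, false, true)
  | .bra => (false, true, false)
  | .ket => (false, true, true)

/-- A tree for a symbol. -/
def symTree (a : Γ') : Tree :=
  .node (boolTree (symBits a).1) (.node (boolTree (symBits a).2.1) (boolTree (symBits a).2.2))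

/-- A tree for a word. -/
def wordTree : List Γ' → Tree
  | [] => .leaf
  | a :: w => .node (symTree a) (wordTree w)

/-- Push a word on the main stack. -/
def pushWord : List Γ' → Cmd
  | [] => .skip
  | a :: l => .seq (pushWord l) (pushC .main a)

theorem exec_pushWord (l : List Γ') (r : Reg) (m a a' k : List Γ') :
    Exec (pushWord l) ⟨r, [], m, a, a', k⟩ ⟨r, [], l ++ m, a, a', k⟩ l.length := by
  induction l with
  | nil => exact Exec.skip _
  | cons b l ih => exact ih.seq (Exec.push _ _ _)

/-- Put the symbol in the register in front of the encoded word on the main stack. -/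
def pushSym : List Γ' → Cmd
  | [] => .skip
  | a :: l => .ite (fun r => decide (r = some a)) (pushWord (Γ'.bit true :: (symTree a).code))
      (pushSym l)

theorem length_code_symTree (a : Γ') : (symTree a).code.length ≤ 9 := by
  rcases a with _ | (_ | _) | _ | _ | _ <;> simp [symTree, symBits, boolTree, Tree.code]

theorem exec_pushSym (b : Γ') (l : List Γ') (hb : b ∈ l) (m a a' k : List Γ') :
    Exec (pushSym l) ⟨some b, [], m, a, a', k⟩
      ⟨some b, [], Γ'.bit true :: ((symTree b).code ++ m), a, a', k⟩ (10 + 2 * l.length) := by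
  induction l with
  | nil => simp at hb
  | cons c l ih =>
    by_cases h : b = c
    · subst h
      refine (Exec.ite_true (by simp) (exec_pushWord _ _ _ _ _ _)).weaken ?_
      have := length_code_symTree b
      simp only [List.length_cons]
      omega
    · refine (Exec.ite_false (by simp [h]) (ih (by simpa [h] using hb))).weaken ?_
      simp only [List.length_cons]
      omega

/-- A list of all symbols. -/
def allSyms : List Γ' := [.blank, .bit false, .bit true, .bra, .ket, .comma]

/-- Move the input word to the main stack, encoded as a tree. -/
def readCmd : Cmd :=
  .seq (.pop .inp) <| .seq (.while Option.isSome (.seq (pushR .aux) (.pop .inp))) <|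
    .seq (pushC .main (Γ'.bit false)) <| .seq (.pop .aux) <|
    .while Option.isSome (.seq (pushSym allSyms) (.pop .aux))

/-- The prefix code of a list has to be pushed from its end, so the input is first reversed onto an
auxiliary stack. -/
theorem exec_readCmd (w : List Γ') :
    Exec readCmd ⟨none, w, [], [], [], []⟩ ⟨none, [], (wordTree w).code, [], [], []⟩
      (30 * w.length + 5) := by
  have h₁ : ∀ (w a : List Γ'), Exec (.while Option.isSome (.seq (pushR .aux) (.pop .inp)))
      ((⟨none, w, [], a, [], []⟩ : St).pop .inp) ⟨none, [], [], w.reverse ++ a, [], []⟩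
      (4 * w.length + 1) := by
    intro w
    induction w with
    | nil => intro a; exact Exec.while_false rfl
    | cons b w ih =>
      intro a
      refine (Exec.while_true rfl (Exec.seq (Exec.push _ _ _) (Exec.pop _ _)) (?_ :
        Exec _ _ _ (4 * w.length + 1))).weaken (by simp; omega)
      have h := ih (b :: a)
      rw [List.reverse_cons, List.append_assoc]
      exact h
  have h₂ : ∀ (v w : List Γ'), Exec (.while Option.isSome (.seq (pushSym allSyms) (.pop .aux)))
      ((⟨none, [], (wordTree w).code, v, [], []⟩ : St).pop .aux)
      ⟨none, [], (wordTree (v.reverse ++ w)).code, [], [], []⟩ (25 * v.length + 1) := by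
    intro v
    induction v with
    | nil => intro w; exact Exec.while_false rfl
    | cons b v ih =>
      intro w
      have hb : b ∈ allSyms := by rcases b with _ | (_ | _) | _ | _ | _ <;> simp [allSyms]
      refine (Exec.while_true rfl (Exec.seq (exec_pushSym b _ hb _ _ _ _) (Exec.pop _ _)) (?_ :
        Exec _ _ _ (25 * v.length + 1))).weaken (by simp [allSyms]; omega)
      have h := ih (b :: w)
      rw [List.reverse_cons, List.append_assoc]
      exact h
  have h₃ := h₁ w []
  have h₄ := h₂ w.reverse []
  simp only [List.append_nil, List.reverse_reverse, List.length_reverse] at h₃ h₄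
  exact Exec.seq' (Exec.pop _ _) (Exec.seq' h₃ (Exec.seq' (Exec.push _ _ _) (Exec.seq'
    (Exec.pop _ _) h₄ le_rfl) le_rfl) le_rfl) (by omega)

end StackProg

/-! ### Functions computable in polynomial time -/

namespace StackProg

open Computability (Γ')
open Polynomial (eval)

/-- Types whose elements are represented by trees. -/
class Enc (α : Type) where
  /-- the representation -/
  enc : α → Tree

open Enc

instance : Enc Bool := ⟨boolTree⟩

instance : Enc Γ' := ⟨symTree⟩

instance : Enc Unit := ⟨fun _ => .leaf⟩

/-- The unary representation of natural numbers. -/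
def natTree : ℕ → Tree
  | 0 => .leaf
  | n + 1 => .node .leaf (natTree n)

instance : Enc ℕ := ⟨natTree⟩

section

variable {α β γ δ σ : Type} [Enc α] [Enc β] [Enc γ] [Enc δ] [Enc σ]

instance : Enc (α × β) := ⟨fun x => .node (enc x.1) (enc x.2)⟩

/-- The representation of lists. -/
def listTree : List α → Tree
  | [] => .leaf
  | a :: l => .node (enc a) (listTree l)

instance : Enc (List α) := ⟨listTree⟩

/-- The size of the representation. -/
def sz (a : α) : ℕ := (enc a).size

theorem one_le_sz (a : α) : 1 ≤ sz a := Tree.one_le_size _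

@[simp] theorem sz_prod (x : α × β) : sz x = sz x.1 + sz x.2 + 1 := rfl

@[simp] theorem sz_nil : sz ([] : List α) = 1 := rfl

@[simp] theorem sz_cons (a : α) (l : List α) : sz (a :: l) = sz a + sz l + 1 := rfl

@[simp] theorem sz_nat (n : ℕ) : sz n = 2 * n + 1 := by
  induction n with
  | zero => rfl
  | succ n ih => change 1 + sz n + 1 = _; omega

theorem sz_bool_le (b : Bool) : sz b ≤ 3 := by cases b <;> simp [sz, enc, boolTree, Tree.size]

theorem sz_append (l l' : List α) : sz (l ++ l') + 1 = sz l + sz l' := by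
  induction l with
  | nil => simp; omega
  | cons a l ih => simp only [List.cons_append, sz_cons]; omega

theorem length_le_sz (l : List α) : l.length ≤ sz l := by
  induction l with
  | nil => simp
  | cons a l ih => simp only [List.length_cons, sz_cons]; omega

theorem sz_drop_le (l : List α) (i : ℕ) : sz (l.drop i) ≤ sz l := by
  have := sz_append (l.take i) (l.drop i)
  have h := one_le_sz (l.take i)
  rw [List.take_append_drop] at this
  omega

theorem sz_le_of_mem {l : List α} {a : α} (h : a ∈ l) : sz a ≤ sz l := by
  induction l with
  | nil => simp at h
  | cons b l ih =>
    rw [sz_cons]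
    rcases List.mem_cons.1 h with rfl | h
    · omega
    · have := ih h; omega

theorem sz_list_le {l : List α} {c : ℕ} (h : ∀ a ∈ l, sz a ≤ c) :
    sz l ≤ l.length * (c + 1) + 1 := by
  induction l with
  | nil => simp
  | cons a l ih =>
    have h₁ := h a (by simp)
    have h₂ := ih fun b hb => h b (by simp [hb])
    rw [sz_cons, List.length_cons, Nat.succ_mul]
    omega

theorem spine_enc (l : List α) : (enc l).spine = l.length := by
  induction l with
  | nil => rfl
  | cons a l ih => exact congrArg (· + 1) ih

theorem eval_mono (p : Polynomial ℕ) {m n : ℕ} (h : m ≤ n) : eval m p ≤ eval n p := by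
  rw [Polynomial.eval_eq_sum_range, Polynomial.eval_eq_sum_range]
  gcongr

/-- A function is computable in polynomial time on the representations. -/
@[fun_prop]
def Poly (f : α → β) : Prop :=
  ∃ (c : Cmd) (p : Polynomial ℕ), ∀ a, Computes c (enc a) (enc (f a)) (eval (sz a) p) ∧
    sz (f a) ≤ eval (sz a) p

theorem Poly.exists_sz_le {f : α → β} (hf : Poly f) : ∃ p : Polynomial ℕ, ∀ a,
    sz (f a) ≤ eval (sz a) p :=
  let ⟨_, p, h⟩ := hf
  ⟨p, fun a => (h a).2⟩

/-- Programs see only the trees, so types with equal representations can be exchanged for free: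
structures and tuples, nonempty lists and pairs, numbers and lists of units. -/
theorem Poly.of_enc_eq {f : α → β} {g : α → γ} (hf : Poly f) (h : ∀ a, enc (g a) = enc (f a)) :
    Poly g := by
  obtain ⟨c, p, hp⟩ := hf
  refine ⟨c, p, fun a => ?_⟩
  rw [show sz (g a) = sz (f a) from congrArg Tree.size (h a), h a]
  exact hp a

@[fun_prop]
theorem Poly.id : Poly (fun a : α => a) :=
  ⟨.skip, .X, fun a => ⟨(computes_skip _).weaken (by simp), by simp⟩⟩

-- This is why `Poly` also bounds the output size: the second program runs on an input of size at
-- most `eval (sz a) q`.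
@[fun_prop]
theorem Poly.comp {f : β → γ} {g : α → β} (hf : Poly f) (hg : Poly g) :
    Poly (fun a => f (g a)) := by
  obtain ⟨c, p, hp⟩ := hf
  obtain ⟨d, q, hq⟩ := hg
  refine ⟨.seq d c, q + p.comp q, fun a => ?_⟩
  obtain ⟨h₁, h₂⟩ := hq a
  obtain ⟨h₃, h₄⟩ := hp (g a)
  have h₅ := eval_mono p h₂
  simp only [Polynomial.eval_add, Polynomial.eval_comp]
  exact ⟨(h₁.seq h₃).weaken (by omega), by omega⟩

@[fun_prop]
theorem Poly.pair {f : α → β} {g : α → γ} (hf : Poly f) (hg : Poly g) :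
    Poly (fun a => (f a, g a)) := by
  obtain ⟨c, p, hp⟩ := hf
  obtain ⟨d, q, hq⟩ := hg
  refine ⟨pairCmd c d, 28 * .X + 23 * p + q + q + 1, fun a => ?_⟩
  obtain ⟨h₁, h₂⟩ := hp a
  obtain ⟨h₃, h₄⟩ := hq a
  simp only [Polynomial.eval_add, Polynomial.eval_mul, Polynomial.eval_ofNat, Polynomial.eval_X,
    Polynomial.eval_one, sz_prod]
  refine ⟨(h₁.pair h₃).weaken ?_, by omega⟩
  change 28 * sz a + _ + _ + 22 * sz (f a) ≤ _
  omega

@[fun_prop]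
theorem Poly.fst {f : α → β × γ} (hf : Poly f) : Poly (fun a => (f a).1) :=
  Poly.comp (f := Prod.fst) ⟨leftCmd, 22 * .X, fun a => by
    simp only [Polynomial.eval_mul, Polynomial.eval_ofNat, Polynomial.eval_X]
    refine ⟨(computes_left _ _).weaken ?_, ?_⟩
    · change _ ≤ 22 * (_ + _ + 1)
      omega
    · rw [sz_prod]; omega⟩ hf

@[fun_prop]
theorem Poly.snd {f : α → β × γ} (hf : Poly f) : Poly (fun a => (f a).2) :=
  Poly.comp (f := Prod.snd) ⟨rightCmd, 22 * .X, fun a => by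
    simp only [Polynomial.eval_mul, Polynomial.eval_ofNat, Polynomial.eval_X]
    refine ⟨(computes_right _ _).weaken ?_, ?_⟩
    · change _ ≤ 22 * (_ + _ + 1)
      omega
    · rw [sz_prod]; omega⟩ hf

theorem Poly.unit : Poly (fun _ : α => ()) :=
  ⟨leafCmd, 15 * .X, fun a => by
    have := one_le_sz a
    simp only [Polynomial.eval_mul, Polynomial.eval_ofNat, Polynomial.eval_X]
    exact ⟨computes_leaf _, by change 1 ≤ _; omega⟩⟩

/-- Every tree is a value of its own type; this is used for constants. -/
instance : Enc Tree := ⟨fun x => x⟩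

@[fun_prop]
theorem Poly.const (b : β) : Poly (fun _ : α => b) := by
  have h : ∀ x : Tree, Poly (fun _ : α => x) := by
    intro x
    induction x with
    | leaf => exact Poly.unit.of_enc_eq fun _ => rfl
    | node l r hl hr => exact (hl.pair hr).of_enc_eq fun _ => rfl
  exact (h (enc b)).of_enc_eq fun _ => rfl

@[fun_prop]
theorem Poly.listCons {f : α → β} {g : α → List β} (hf : Poly f) (hg : Poly g) :
    Poly (fun a => f a :: g a) :=
  (hf.pair hg).of_enc_eq fun _ => rfl

/-- Case distinction on the shape of a result. -/
theorem Poly.of_cases {f : α → β} {g : α → γ} {h : δ × α → γ} {k : α → γ} (hf : Poly f)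
    (hg : Poly g) (hh : Poly h) (H : ∀ a, enc (f a) = .leaf ∧ k a = g a ∨
      (∃ x y, enc (f a) = .node x y) ∧ ∃ d : δ, enc d = enc (f a) ∧ k a = h (d, a)) : Poly k := by
  obtain ⟨c, p, hp⟩ := hf
  obtain ⟨d, q, hq⟩ := hg
  obtain ⟨e, r, hr⟩ := hh
  refine ⟨caseCmd c d e, 28 * .X + p + q + r.comp (p + .X + 1) + 5, fun a => ?_⟩
  obtain ⟨h₁, h₂⟩ := hp a
  obtain ⟨h₃, h₄⟩ := hq a
  simp only [Polynomial.eval_add, Polynomial.eval_mul, Polynomial.eval_ofNat, Polynomial.eval_X,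
    Polynomial.eval_one, Polynomial.eval_comp]
  rcases H a with ⟨H₁, H₂⟩ | ⟨⟨x, y, H₁⟩, v, H₂, H₃⟩
  · rw [H₂]
    rw [H₁] at h₁
    refine ⟨(h₁.case_leaf e h₃).weaken ?_, by omega⟩
    change 28 * sz a + _ + _ + 3 ≤ _
    omega
  · obtain ⟨h₅, h₆⟩ := hr (v, a)
    have e₁ : enc (v, a) = .node (.node x y) (enc a) := by
      change Tree.node (enc v) (enc a) = _
      rw [H₂, H₁]
    have e₂ : sz (v, a) ≤ eval (sz a) p + sz a + 1 := by
      have : sz v = sz (f a) := congrArg Tree.size H₂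
      simp only [sz_prod]
      omega
    have e₃ := eval_mono r e₂
    rw [e₁] at h₅
    rw [H₁] at h₁
    rw [H₃]
    refine ⟨(h₁.case_node d h₅).weaken ?_, by omega⟩
    change 28 * sz a + _ + _ + 5 ≤ _
    omega

@[fun_prop]
theorem Poly.cond {c : α → Bool} {f g : α → β} (hc : Poly c) (hf : Poly f) (hg : Poly g) :
    Poly (fun a => bif c a then f a else g a) := by
  refine Poly.of_cases hc hg (h := fun x : Bool × α => f x.2) (by fun_prop) fun a => ?_
  cases c a
  · exact .inl ⟨rfl, rfl⟩
  · exact .inr ⟨⟨_, _, rfl⟩, true, rfl, rfl⟩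

theorem Poly.listCases {f : α → List β} {g : α → γ} {h : α → β → List β → γ} (hf : Poly f)
    (hg : Poly g) (hh : Poly fun x : α × β × List β => h x.1 x.2.1 x.2.2) :
    Poly (fun a => match f a with | [] => g a | b :: l => h a b l) := by
  refine Poly.of_cases hf hg (h := fun x : (β × List β) × α => h x.2 x.1.1 x.1.2)
    (hh.comp (g := fun x : (β × List β) × α => (x.2, x.1.1, x.1.2)) (by fun_prop)) fun a => ?_
  cases f a with
  | nil => exact .inl ⟨rfl, rfl⟩
  | cons b l => exact .inr ⟨⟨_, _, rfl⟩, (b, l), rfl, rfl⟩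

/-- Iterating a polynomial-time function can make sizes explode, hence the bound `hb` on all
intermediate values. With it each round costs at most `p.comp q`, and the number of rounds is
bounded by the size of the list. -/
theorem Poly.iterate {f : σ → σ} {l : α → List β} {s : α → σ} (hf : Poly f) (hl : Poly l)
    (hs : Poly s) (hb : ∃ q : Polynomial ℕ, ∀ a, ∀ i ≤ (l a).length,
      sz (f^[i] (s a)) ≤ eval (sz a) q) :
    Poly (fun a => f^[(l a).length] (s a)) := by
  obtain ⟨c, p, hp⟩ := hf
  obtain ⟨d, r, hr⟩ := hl.pair hs
  obtain ⟨q, hq⟩ := hb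
  refine ⟨.seq d (iterCmd c), r + (18 * r + r * (p.comp q + 3) + 5) + q, fun a => ?_⟩
  obtain ⟨h₁, h₂⟩ := hr a
  have h₃ : Computes (iterCmd c) (.node (enc (l a)) (enc (f^[0] (s a)))) _ _ :=
    Computes.iter (c := c) (n := enc (l a)) (x := fun i => enc (f^[i] (s a)))
      (t := eval (eval (sz a) q) p) fun i hi => by
        have := (hp (f^[i] (s a))).1.weaken (eval_mono p (hq a i (by rw [spine_enc] at hi; omega)))
        rwa [← Function.iterate_succ_apply' f] at this
  simp only [spine_enc] at h₃
  simp only [Polynomial.eval_add, Polynomial.eval_mul, Polynomial.eval_ofNat,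
    Polynomial.eval_comp]
  have h₄ := hq a _ le_rfl
  refine ⟨(h₁.seq h₃).weaken ?_, by omega⟩
  simp only [sz_prod] at h₂
  have h₅ := length_le_sz (l a)
  have h₆ : (l a).length * (eval (eval (sz a) q) p + 3) ≤
      eval (sz a) r * (eval (eval (sz a) q) p + 3) := Nat.mul_le_mul_right _ (by omega)
  change _ + (18 * sz (l a) + _ + 5) ≤ _
  omega

/-- Folding over a list, with a bound for all intermediate results. -/
theorem Poly.foldl {l : α → List β} {s : α → σ} {h : α → σ → β → σ} (hl : Poly l) (hs : Poly s)
    (hh : Poly fun x : α × σ × β => h x.1 x.2.1 x.2.2)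
    (hb : ∃ q : Polynomial ℕ, ∀ a i, sz (((l a).take i).foldl (h a) (s a)) ≤ eval (sz a) q) :
    Poly (fun a => (l a).foldl (h a) (s a)) := by
  -- One round of the fold as a self-map: it carries the parameter, the unread part of the list and
  -- the accumulator.
  let step : α × List β × σ → α × List β × σ := fun x =>
    match x.2.1 with
    | [] => x
    | b :: l => (x.1, l, h x.1 x.2.2 b)
  have hstep : Poly step := by
    refine Poly.listCases (f := fun x : α × List β × σ => x.2.1)
      (h := fun (x : α × List β × σ) b l => (x.1, l, h x.1 x.2.2 b)) (by fun_prop) (by fun_prop) ?_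
    have := hh.comp (g := fun x : (α × List β × σ) × β × List β => (x.1.1, x.1.2.2, x.2.1))
      (by fun_prop)
    fun_prop
  have key : ∀ (a : α) (i : ℕ) (l : List β) (s : σ), step^[i] (a, l, s) =
      (a, l.drop i, (l.take i).foldl (h a) s) := by
    intro a i
    induction i with
    | zero => intro l s; simp
    | succ i ih =>
      intro l s
      rw [Function.iterate_succ_apply]
      cases l with
      | nil => have := ih [] s; simpa [step] using this
      | cons b l => exact ih l (h a s b)
  have hit := Poly.iterate hstep hl (s := fun a => (a, l a, s a)) (by fun_prop) (by
    obtain ⟨q, hq⟩ := hb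
    obtain ⟨p, hp⟩ := hl.exists_sz_le
    refine ⟨.X + p + q + 2, fun a i _ => ?_⟩
    rw [key]
    have h₁ := hq a i
    have h₂ := hp a
    have h₃ := sz_drop_le (l a) i
    simp only [sz_prod, Polynomial.eval_add, Polynomial.eval_X, Polynomial.eval_ofNat]
    omega)
  simp only [key, List.take_length] at hit
  exact hit.snd.snd

end

end StackProg

/-! ### Polynomial-time operations on lists and unary numbers -/

namespace StackProg

open Computability (Γ')
open Polynomial (eval)
open Enc

variable {α β γ σ : Type} [Enc α] [Enc β] [Enc γ] [Enc σ]

/-- Folding over a list with a step whose growth does not depend on the accumulator. -/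
theorem Poly.foldl_of_growth {l : α → List β} {s : α → σ} {h : α → σ → β → σ} (hl : Poly l)
    (hs : Poly s) (hh : Poly fun x : α × σ × β => h x.1 x.2.1 x.2.2)
    (hb : ∃ q : Polynomial ℕ, ∀ a s b, sz (h a s b) ≤ sz s + eval (sz a + sz b) q) :
    Poly (fun a => (l a).foldl (h a) (s a)) := by
  refine Poly.foldl hl hs hh ?_
  obtain ⟨q, hq⟩ := hb
  obtain ⟨p, hp⟩ := hl.exists_sz_le
  obtain ⟨r, hr⟩ := hs.exists_sz_le
  -- The initial size, plus at most `p` elements, each of size at most `p` and adding the growth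
  -- `q`.
  refine ⟨r + p * q.comp (.X + p), fun a i => ?_⟩
  simp only [Polynomial.eval_add, Polynomial.eval_mul, Polynomial.eval_X, Polynomial.eval_comp]
  have key : ∀ (l' : List β) (s : σ), (∀ b ∈ l', b ∈ l a) → sz (l'.foldl (h a) s) ≤
      sz s + l'.length * eval (sz a + eval (sz a) p) q := by
    intro l'
    induction l' with
    | nil => intro s _; simp
    | cons b l' ih =>
      intro s hl'
      have h₁ := ih (h a s b) fun c hc => hl' c (by simp [hc])
      have h₂ := hq a s b
      have h₃ := (sz_le_of_mem (hl' b (by simp))).trans (hp a)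
      have h₄ := eval_mono q (Nat.add_le_add_left h₃ (sz a))
      rw [List.foldl_cons, List.length_cons, Nat.succ_mul]
      omega
  refine (key _ _ fun b hb => List.mem_of_mem_take hb).trans ?_
  have h₁ := hr a
  have h₂ : ((l a).take i).length ≤ eval (sz a) p := by
    have := length_le_sz (l a)
    have := hp a
    rw [List.length_take]
    omega
  exact Nat.add_le_add h₁ (Nat.mul_le_mul_right _ h₂)

@[fun_prop]
theorem Poly.reverse {f : α → List β} (hf : Poly f) : Poly (fun a => (f a).reverse) := by
  have := Poly.foldl_of_growth (h := fun (_ : α) (l : List β) b => b :: l) hf (Poly.const [])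
    (by fun_prop) ⟨.X + 1, fun a s b => by simp; omega⟩
  refine this.of_enc_eq fun a => ?_
  rw [List.foldl_flip_cons_eq_append']
  simp

theorem Poly.foldr_of_growth {l : α → List β} {s : α → σ} {h : α → β → σ → σ} (hl : Poly l)
    (hs : Poly s) (hh : Poly fun x : α × β × σ => h x.1 x.2.1 x.2.2)
    (hb : ∃ q : Polynomial ℕ, ∀ a b s, sz (h a b s) ≤ sz s + eval (sz a + sz b) q) :
    Poly (fun a => (l a).foldr (h a) (s a)) := by
  obtain ⟨q, hq⟩ := hb
  have := Poly.foldl_of_growth (h := fun (a : α) (s : σ) (b : β) => h a b s) hl.reverse hs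
    (hh.comp (g := fun x : α × σ × β => (x.1, x.2.2, x.2.1)) (by fun_prop))
    ⟨q, fun a s b => hq a b s⟩
  simpa only [List.foldl_reverse] using this

@[fun_prop]
theorem Poly.append {f g : α → List β} (hf : Poly f) (hg : Poly g) :
    Poly (fun a => f a ++ g a) := by
  have := Poly.foldr_of_growth (h := fun (_ : α) b (l : List β) => b :: l) hf hg
    (by fun_prop) ⟨.X + 1, fun a s b => by simp; omega⟩
  simpa using this

@[fun_prop]
theorem Poly.flatMap {f : α → List β} {g : α → β → List γ} (hf : Poly f)
    (hg : Poly fun x : α × β => g x.1 x.2) : Poly (fun a => (f a).flatMap (g a)) := by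
  obtain ⟨p, hp⟩ := hg.exists_sz_le
  have := Poly.foldr_of_growth (h := fun (a : α) b (l : List γ) => g a b ++ l) hf (Poly.const [])
    (Poly.append (hg.comp (g := fun x : α × β × List γ => (x.1, x.2.1)) (by fun_prop))
      (by fun_prop)) ⟨p.comp (.X + 1), fun a b s => by
        have h₁ := hp (a, b)
        have h₂ := sz_append (g a b) s
        simp only [sz_prod] at h₁
        simp only [Polynomial.eval_comp, Polynomial.eval_add, Polynomial.eval_X,
          Polynomial.eval_one]
        omega⟩
  refine this.of_enc_eq fun a => ?_
  congr 1
  induction f a with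
  | nil => rfl
  | cons b l ih => simp [ih]

@[fun_prop]
theorem Poly.map {f : α → List β} {g : α → β → γ} (hf : Poly f)
    (hg : Poly fun x : α × β => g x.1 x.2) : Poly (fun a => (f a).map (g a)) := by
  have := Poly.flatMap (g := fun a b => [g a b]) hf (by fun_prop)
  simpa only [List.map_eq_flatMap] using this

@[fun_prop]
theorem Poly.filter {f : α → List β} {g : α → β → Bool} (hf : Poly f)
    (hg : Poly fun x : α × β => g x.1 x.2) : Poly (fun a => (f a).filter (g a)) := by
  have := Poly.flatMap (g := fun a b => bif g a b then [b] else []) hf (by fun_prop)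
  refine this.of_enc_eq fun a => ?_
  congr 1
  induction f a with
  | nil => rfl
  | cons b l ih => cases h : g a b <;> simp [h, ih]

@[fun_prop]
theorem Poly.and {f g : α → Bool} (hf : Poly f) (hg : Poly g) : Poly (fun a => f a && g a) :=
  (Poly.cond hf hg (Poly.const false)).of_enc_eq fun a => by cases f a <;> rfl

@[fun_prop]
theorem Poly.or {f g : α → Bool} (hf : Poly f) (hg : Poly g) : Poly (fun a => f a || g a) :=
  (Poly.cond hf (Poly.const true) hg).of_enc_eq fun a => by cases f a <;> rfl

@[fun_prop]
theorem Poly.not {f : α → Bool} (hf : Poly f) : Poly (fun a => !f a) :=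
  (Poly.cond hf (Poly.const false) (Poly.const true)).of_enc_eq fun a => by cases f a <;> rfl

@[fun_prop]
theorem Poly.bxor {f g : α → Bool} (hf : Poly f) (hg : Poly g) : Poly (fun a => xor (f a) (g a)) :=
  (Poly.cond hf hg.not hg).of_enc_eq fun a => by cases f a <;> cases g a <;> rfl

@[fun_prop]
theorem Poly.all {f : α → List β} {g : α → β → Bool} (hf : Poly f)
    (hg : Poly fun x : α × β => g x.1 x.2) : Poly (fun a => (f a).all (g a)) := by
  have := Poly.foldr_of_growth (h := fun (a : α) b (s : Bool) => g a b && s) hf (Poly.const true)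
    (Poly.and (hg.comp (g := fun x : α × β × Bool => (x.1, x.2.1)) (by fun_prop))
      (by fun_prop)) ⟨3, fun a s b => by have := sz_bool_le (g a s && b); simp; omega⟩
  refine this.of_enc_eq fun a => ?_
  congr 1
  induction f a with
  | nil => rfl
  | cons b l ih => rw [List.all_cons, List.foldr_cons, ih]

@[fun_prop]
theorem Poly.any {f : α → List β} {g : α → β → Bool} (hf : Poly f)
    (hg : Poly fun x : α × β => g x.1 x.2) : Poly (fun a => (f a).any (g a)) := by
  have := Poly.foldr_of_growth (h := fun (a : α) b (s : Bool) => g a b || s) hf (Poly.const false)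
    (Poly.or (hg.comp (g := fun x : α × β × Bool => (x.1, x.2.1)) (by fun_prop))
      (by fun_prop)) ⟨3, fun a s b => by have := sz_bool_le (g a s || b); simp; omega⟩
  refine this.of_enc_eq fun a => ?_
  congr 1
  induction f a with
  | nil => rfl
  | cons b l ih => rw [List.any_cons, List.foldr_cons, ih]

@[fun_prop]
theorem Poly.isEmpty {f : α → List β} (hf : Poly f) : Poly (fun a => (f a).isEmpty) :=
  (Poly.listCases (h := fun _ _ _ => false) hf (Poly.const true) (by fun_prop)).of_enc_eq
    fun a => by cases f a <;> rfl

@[fun_prop]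
theorem Poly.headD {f : α → List β} {g : α → β} (hf : Poly f) (hg : Poly g) :
    Poly (fun a => (f a).headD (g a)) :=
  (Poly.listCases (h := fun _ b _ => b) hf hg (by fun_prop)).of_enc_eq
    fun a => by cases f a <;> rfl

@[fun_prop]
theorem Poly.tail {f : α → List β} (hf : Poly f) : Poly (fun a => (f a).tail) :=
  (Poly.listCases (h := fun _ _ l => l) hf (Poly.const []) (by fun_prop)).of_enc_eq
    fun a => by cases f a <;> rfl

/-- Unary numbers are lists of units, so folds over lists provide recursion on numbers. -/
theorem enc_replicate_unit (n : ℕ) : enc (List.replicate n ()) = enc n := by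
  induction n with
  | zero => rfl
  | succ n ih => exact congrArg (Tree.node .leaf) ih

@[fun_prop]
theorem Poly.replicateUnit {f : α → ℕ} (hf : Poly f) :
    Poly (fun a => List.replicate (f a) ()) :=
  hf.of_enc_eq fun _ => enc_replicate_unit _

@[fun_prop]
theorem Poly.succ {f : α → ℕ} (hf : Poly f) : Poly (fun a => f a + 1) :=
  (Poly.listCons (Poly.const ()) hf.replicateUnit).of_enc_eq fun a =>
    (enc_replicate_unit (f a + 1)).symm

@[fun_prop]
theorem Poly.pred {f : α → ℕ} (hf : Poly f) : Poly (fun a => f a - 1) :=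
  hf.replicateUnit.tail.of_enc_eq fun a => by rw [List.tail_replicate, enc_replicate_unit]

@[fun_prop]
theorem Poly.length {f : α → List β} (hf : Poly f) : Poly (fun a => (f a).length) := by
  have := Poly.foldr_of_growth (h := fun (_ : α) (_ : β) (n : ℕ) => n + 1) hf (Poly.const 0)
    (by fun_prop) ⟨2, fun a s b => by simp; omega⟩
  refine this.of_enc_eq fun a => ?_
  congr 1
  induction f a with
  | nil => rfl
  | cons b l ih => rw [List.length_cons, List.foldr_cons, ← ih]

@[fun_prop]
theorem Poly.add {f g : α → ℕ} (hf : Poly f) (hg : Poly g) : Poly (fun a => f a + g a) := by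
  have := Poly.foldr_of_growth (h := fun (_ : α) (_ : Unit) (n : ℕ) => n + 1) hg.replicateUnit hf
    (by fun_prop) ⟨2, fun a s b => by simp; omega⟩
  refine this.of_enc_eq fun a => ?_
  congr 1
  induction g a with
  | zero => rfl
  | succ n ih => rw [List.replicate_succ, List.foldr_cons, ← ih]; rfl

@[fun_prop]
theorem Poly.sub {f g : α → ℕ} (hf : Poly f) (hg : Poly g) : Poly (fun a => f a - g a) := by
  have := Poly.foldr_of_growth (h := fun (_ : α) (_ : Unit) (n : ℕ) => n - 1) hg.replicateUnit hf
    (by fun_prop) ⟨2, fun a s b => by simp; omega⟩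
  refine this.of_enc_eq fun a => ?_
  congr 1
  induction g a with
  | zero => rfl
  | succ n ih => rw [List.replicate_succ, List.foldr_cons, ← ih]; rfl

@[fun_prop]
theorem Poly.ble {f g : α → ℕ} (hf : Poly f) (hg : Poly g) : Poly (fun a => Nat.ble (f a) (g a)) :=
  (Poly.isEmpty (Poly.replicateUnit (hf.sub hg))).of_enc_eq fun a => by
    congr 1
    rw [Bool.eq_iff_iff, Nat.ble_eq, List.isEmpty_iff, List.replicate_eq_nil_iff]
    omega

@[fun_prop]
theorem Poly.beq {f g : α → ℕ} (hf : Poly f) (hg : Poly g) : Poly (fun a => Nat.beq (f a) (g a)) :=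
  ((hf.ble hg).and (hg.ble hf)).of_enc_eq fun a => by
    congr 1
    rw [Bool.eq_iff_iff, Nat.beq_eq, Bool.and_eq_true, Nat.ble_eq, Nat.ble_eq]
    omega

@[fun_prop]
theorem Poly.range {f : α → ℕ} (hf : Poly f) : Poly (fun a => List.range (f a)) := by
  have e : ∀ (n m : ℕ), (List.replicate n ()).foldl (fun l _ => l ++ [l.length]) (List.range m) =
      List.range (m + n) := by
    intro n
    induction n with
    | zero => intro m; rfl
    | succ n ih =>
      intro m
      rw [List.replicate_succ, List.foldl_cons, List.length_range, ← List.range_succ, ih]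
      congr 1
      omega
  obtain ⟨p, hp⟩ := hf.exists_sz_le
  -- The appended number grows with the accumulator, so `Poly.foldl_of_growth` does not apply; the
  -- bound comes from the explicit intermediate lists.
  have := Poly.foldl (h := fun (_ : α) (l : List ℕ) (_ : Unit) => l ++ [l.length])
    hf.replicateUnit (Poly.const (List.range 0)) (by fun_prop)
    ⟨p * (2 * p + 1 + 1) + 1, fun a i => by
      rw [List.take_replicate, e]
      have h₁ := hp a
      rw [sz_nat] at h₁
      have h₂ : ∀ j ∈ List.range (0 + min i (f a)), sz j ≤ 2 * eval (sz a) p + 1 := by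
        intro j hj
        rw [List.mem_range] at hj
        rw [sz_nat]
        omega
      refine (sz_list_le h₂).trans ?_
      simp only [Polynomial.eval_add, Polynomial.eval_mul, Polynomial.eval_ofNat,
        Polynomial.eval_one, List.length_range]
      gcongr
      omega⟩
  simpa only [e, Nat.zero_add] using this

@[fun_prop]
theorem Poly.drop {f : α → List β} {i : α → ℕ} (hf : Poly f) (hi : Poly i) :
    Poly (fun a => (f a).drop (i a)) := by
  have e : ∀ (n : ℕ) (l : List β), (List.replicate n ()).foldr (fun _ l => l.tail) l =
      l.drop n := by
    intro n
    induction n with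
    | zero => intro l; rfl
    | succ n ih => intro l; rw [List.replicate_succ, List.foldr_cons, ih, List.tail_drop]
  have := Poly.foldr_of_growth (h := fun (_ : α) (_ : Unit) (l : List β) => l.tail)
    hi.replicateUnit hf (by fun_prop) ⟨0, fun a b s => by
      cases s <;> simp
      omega⟩
  simpa only [e] using this

@[fun_prop]
theorem Poly.getD {f : α → List β} {i : α → ℕ} {g : α → β} (hf : Poly f) (hi : Poly i)
    (hg : Poly g) : Poly (fun a => (f a).getD (i a) (g a)) :=
  ((hf.drop hi).headD hg).of_enc_eq fun a => by
    congr 1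
    rw [List.headD_eq_head?_getD, List.head?_drop, List.getD_eq_getElem?_getD]

end StackProg

/-! ### The decision procedure -/

namespace StackProg

open Computability (Γ')
open Polynomial (eval)
open Enc

/-- Binary digits, the least significant one first. -/
abbrev Bits := List Bool

/-- An entry of a voter's row: whether the approval is present, whether its price is finite, and the
digits of the price. -/
abbrev Entry := Bool × Bool × Bits

/-- The numbers that make up an input word. -/
structure Raw where
  p : Bits
  k : Bits
  budget : Bits
  axis : List Bits
  rows : List (List Entry)

instance : Enc Raw := ⟨fun D => enc (D.p, D.k, D.budget, D.axis, D.rows)⟩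

/-! ### Raw inputs and their words -/

section Basic

variable {α β : Type} [Enc α] [Enc β]

theorem Poly.raw {f : α → Raw} (hf : Poly f) :
    Poly (fun a => ((f a).p, (f a).k, (f a).budget, (f a).axis, (f a).rows)) :=
  hf.of_enc_eq fun _ => rfl

@[fun_prop]
theorem Poly.rawP {f : α → Raw} (hf : Poly f) : Poly (fun a => (f a).p) := hf.raw.fst

@[fun_prop]
theorem Poly.rawK {f : α → Raw} (hf : Poly f) : Poly (fun a => (f a).k) := hf.raw.snd.fst

@[fun_prop]
theorem Poly.rawBudget {f : α → Raw} (hf : Poly f) : Poly (fun a => (f a).budget) :=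
  hf.raw.snd.snd.fst

@[fun_prop]
theorem Poly.rawAxis {f : α → Raw} (hf : Poly f) : Poly (fun a => (f a).axis) :=
  hf.raw.snd.snd.snd.fst

@[fun_prop]
theorem Poly.rawRows {f : α → Raw} (hf : Poly f) : Poly (fun a => (f a).rows) :=
  hf.raw.snd.snd.snd.snd

@[fun_prop]
theorem Poly.rawMk {p k b : α → Bits} {ax : α → List Bits} {r : α → List (List Entry)}
    (hp : Poly p) (hk : Poly k) (hb : Poly b) (hax : Poly ax) (hr : Poly r) :
    Poly (fun a => Raw.mk (p a) (k a) (b a) (ax a) (r a)) :=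
  (hp.pair (hk.pair (hb.pair (hax.pair hr)))).of_enc_eq fun _ => rfl

@[fun_prop]
theorem Poly.symBits {f : α → Γ'} (hf : Poly f) : Poly (fun a => symBits (f a)) :=
  hf.of_enc_eq fun _ => rfl

@[fun_prop]
theorem Poly.bit {f : α → Bool} (hf : Poly f) : Poly (fun a => Γ'.bit (f a)) :=
  Poly.of_enc_eq (f := fun a => (true, f a, false)) (by fun_prop) fun _ => rfl

/-- Equality of symbols. -/
def symBeq (a b : Γ') : Bool :=
  !(xor (symBits a).1 (symBits b).1) && (!(xor (symBits a).2.1 (symBits b).2.1) &&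
    !(xor (symBits a).2.2 (symBits b).2.2))

@[fun_prop]
theorem Poly.symBeq {f g : α → Γ'} (hf : Poly f) (hg : Poly g) :
    Poly (fun a => symBeq (f a) (g a)) := by
  unfold StackProg.symBeq; fun_prop

/-- Equality of words. -/
def wordBeq (v w : List Γ') : Bool :=
  Nat.beq v.length w.length &&
    (List.range v.length).all fun i => symBeq (v.getD i .blank) (w.getD i .blank)

@[fun_prop]
theorem Poly.wordBeq {f g : α → List Γ'} (hf : Poly f) (hg : Poly g) :
    Poly (fun a => wordBeq (f a) (g a)) := by
  unfold StackProg.wordBeq; fun_prop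

/-- The word of a number. -/
def numWord (l : Bits) : List Γ' := l.map Γ'.bit ++ [Γ'.comma]

@[fun_prop]
theorem Poly.numWord {f : α → Bits} (hf : Poly f) : Poly (fun a => numWord (f a)) := by
  unfold StackProg.numWord; fun_prop

/-- The word of an entry. -/
def entryWord (e : Entry) : List Γ' :=
  Γ'.bit e.1 :: bif e.2.1 then numWord e.2.2 else [Γ'.blank]

@[fun_prop]
theorem Poly.entryWord {f : α → Entry} (hf : Poly f) : Poly (fun a => entryWord (f a)) := by
  unfold StackProg.entryWord; fun_prop

/-- The word of a row. -/
def rowWord (r : List Entry) : List Γ' := [Γ'.bra] ++ r.flatMap entryWord ++ [Γ'.ket]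

@[fun_prop]
theorem Poly.rowWord {f : α → List Entry} (hf : Poly f) : Poly (fun a => rowWord (f a)) := by
  unfold StackProg.rowWord; fun_prop

/-- The word of an input. -/
def Raw.word (D : Raw) : List Γ' :=
  numWord D.p ++ numWord D.k ++ numWord D.budget ++
    ([Γ'.bra] ++ D.axis.flatMap numWord ++ [Γ'.ket]) ++ D.rows.flatMap rowWord

@[fun_prop]
theorem Poly.rawWord {f : α → Raw} (hf : Poly f) : Poly (fun a => (f a).word) := by
  unfold Raw.word; fun_prop

end Basic

/-! ### Parsing words into raw inputs -/

section Parsing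

variable {α : Type} [Enc α]

/-- A maximal block of bits, together with the symbol that ends it. -/
abbrev Token := Bits × Γ'

/-- Put one symbol in front of a list of tokens. -/
def tokenStep (a : Γ') (ts : List Token) : List Token :=
  bif (symBits a).1 then
    ((symBits a).2.1 :: (ts.headD ([], .blank)).1, (ts.headD ([], .blank)).2) :: ts.tail
  else ([], a) :: ts

/-- Split a word into tokens. -/
def tokens (w : List Γ') : List Token := w.foldr tokenStep []

@[fun_prop]
theorem Poly.tokens {f : α → List Γ'} (hf : Poly f) : Poly (fun a => tokens (f a)) := by
  refine Poly.foldr_of_growth (h := fun _ => tokenStep) hf (Poly.const []) ?_ ?_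
  · unfold tokenStep; fun_prop
  -- A step adds one bit or one token; the constant also pays for the dummy token created when bits
  -- have no terminator.
  · refine ⟨.X + 20, fun a b s => ?_⟩
    have h₁ := sz_bool_le (StackProg.symBits b).2.1
    have h₂ : sz Γ'.blank = 7 := rfl
    simp only [tokenStep, Polynomial.eval_add, Polynomial.eval_X, Polynomial.eval_ofNat]
    cases (StackProg.symBits b).1
    · simp; omega
    · cases s <;> simp <;> omega

/-- Put one token in front of a list of groups. -/
def groupStep (t : Token) (gs : List (List Token)) : List (List Token) :=
  bif symBeq t.2 .ket then [] :: gs else (t :: gs.headD []) :: gs.tail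

/-- Split a list of tokens into the groups that are closed by a bracket. -/
def groups (ts : List Token) : List (List Token) := ts.foldr groupStep []

@[fun_prop]
theorem Poly.groups {f : α → List Token} (hf : Poly f) : Poly (fun a => groups (f a)) := by
  refine Poly.foldr_of_growth (h := fun _ => groupStep) hf (Poly.const []) ?_ ?_
  · unfold groupStep; fun_prop
  · refine ⟨.X + 20, fun a b s => ?_⟩
    simp only [groupStep, Polynomial.eval_add, Polynomial.eval_X, Polynomial.eval_ofNat]
    cases StackProg.symBeq b.2 .ket
    · cases s <;> simp <;> omega
    · simp; omega

/-- Read an entry from a token. -/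
def tokenEntry (t : Token) : Entry := (t.1.headD false, symBeq t.2 .comma, t.1.tail)

@[fun_prop]
theorem Poly.tokenEntry {f : α → Token} (hf : Poly f) : Poly (fun a => tokenEntry (f a)) := by
  unfold StackProg.tokenEntry; fun_prop

/-- Read an input from the groups of tokens. -/
def rawOfGroups (gs : List (List Token)) : Raw :=
  Raw.mk ((gs.headD []).getD 0 ([], .blank)).1 ((gs.headD []).getD 1 ([], .blank)).1
    ((gs.headD []).getD 2 ([], .blank)).1 (((gs.headD []).drop 4).map fun t => t.1)
    (gs.tail.map fun g => g.tail.map fun t => tokenEntry t)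

@[fun_prop]
theorem Poly.rawOfGroups {f : α → List (List Token)} (hf : Poly f) :
    Poly (fun a => rawOfGroups (f a)) := by
  unfold StackProg.rawOfGroups; fun_prop

/-- Read an input from a word; the result is meaningful only if the word is an encoding. -/
def parse (w : List Γ') : Raw := rawOfGroups (groups (tokens w))

@[fun_prop]
theorem Poly.parse {f : α → List Γ'} (hf : Poly f) : Poly (fun a => parse (f a)) := by
  unfold StackProg.parse; fun_prop

end Parsing

/-! ### Binary numbers: capped values and subtraction -/

section Numbers

variable {α : Type} [Enc α]

/-- The value of a list of binary digits. -/
def val : Bits → ℕ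
  | [] => 0
  | b :: l => b.toNat + 2 * val l

/-- No leading zero. -/
def canonical (l : Bits) : Bool := l.foldl (fun _ b => b) true

@[fun_prop]
theorem Poly.canonical {f : α → Bits} (hf : Poly f) : Poly (fun a => canonical (f a)) :=
  Poly.foldl_of_growth (h := fun _ _ b => b) hf (Poly.const true) (by fun_prop)
    ⟨.X, fun a s b => by simp; omega⟩

/-- Append a binary digit to a number, up to a bound. -/
def capStep (c x : ℕ) (b : Bool) : ℕ :=
  bif Nat.ble c (x + x + bif b then 1 else 0) then c else x + x + bif b then 1 else 0

theorem capStep_eq (c x : ℕ) (b : Bool) : capStep c x b = min c (b.toNat + 2 * x) := by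
  have e : (x + x + bif b then 1 else 0) = b.toNat + 2 * x := by cases b <;> simp <;> omega
  rw [capStep, e]
  cases h : Nat.ble c (b.toNat + 2 * x)
  · have : ¬ c ≤ b.toNat + 2 * x := by rw [← Nat.ble_eq, h]; simp
    simp only [cond_false]; omega
  · have : c ≤ b.toNat + 2 * x := by rwa [← Nat.ble_eq]
    simp only [cond_true]; omega

/-- The value of a list of binary digits, in unary, cut off at a bound. -/
def capVal (c : ℕ) (l : Bits) : ℕ := l.reverse.foldl (capStep c) 0

-- Each digit doubles the value, so an uncapped unary value could be exponentially large. The cap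
-- keeps every intermediate value at most `c`.
@[fun_prop]
theorem Poly.capVal {c : α → ℕ} {f : α → Bits} (hc : Poly c) (hf : Poly f) :
    Poly (fun a => capVal (c a) (f a)) := by
  refine Poly.foldl (h := fun a x b => capStep (c a) x b) hf.reverse (Poly.const 0)
    (by unfold capStep; fun_prop) ?_
  obtain ⟨p, hp⟩ := hc.exists_sz_le
  refine ⟨p, fun a i => (le_trans ?_ (hp a))⟩
  rw [sz_nat, sz_nat]
  have key : ∀ (l : Bits) (x : ℕ), x ≤ c a → l.foldl (fun x b => capStep (c a) x b) x ≤ c a := by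
    intro l
    induction l with
    | nil => intro x hx; exact hx
    | cons b l ih => intro x hx; exact ih _ ((capStep_eq _ _ _).trans_le (by omega))
  have := key ((f a).reverse.take i) 0 (Nat.zero_le _)
  omega

/-- One step of the subtraction of binary numbers: borrow, remaining digits of the subtrahend,
digits of the difference in reverse order. -/
def subStep (s : Bool × Bits × Bits) (x : Bool) : Bool × Bits × Bits :=
  ((!x && (s.2.1.headD false || s.1)) || (s.2.1.headD false && s.1), s.2.1.tail,
    xor x (xor (s.2.1.headD false) s.1) :: s.2.2)

/-- The subtraction of binary numbers, with a flag for success. -/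
def subBits (a b : Bits) : Bool × Bits :=
  (!(a.foldl subStep (false, b, [])).1 &&
      (a.foldl subStep (false, b, [])).2.1.all (fun x => !x),
    (a.foldl subStep (false, b, [])).2.2.reverse)

@[fun_prop]
theorem Poly.subBits {f g : α → Bits} (hf : Poly f) (hg : Poly g) :
    Poly (fun a => subBits (f a) (g a)) := by
  have : Poly (fun a => (f a).foldl subStep (false, g a, [])) := by
    refine Poly.foldl_of_growth (h := fun _ => subStep) hf (by fun_prop) ?_ ?_
    · unfold subStep; fun_prop
    · refine ⟨20, fun a s b => ?_⟩
      obtain ⟨c, bs, out⟩ := s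
      have h₁ := sz_bool_le (subStep (c, bs, out) b).1
      have h₂ := sz_bool_le (xor b (xor (bs.headD false) c))
      have h₃ : sz bs.tail ≤ sz bs := by cases bs <;> simp; omega
      simp only [sz_prod, Polynomial.eval_ofNat]
      simp only [subStep, sz_cons] at h₁ ⊢
      omega
  unfold StackProg.subBits
  fun_prop

attribute [irreducible] subBits

end Numbers

/-! ### Validity of an input, events and states -/

namespace Raw

/-- The number of candidates. -/
def m (D : Raw) : ℕ := D.axis.length

/-- The number of voters. -/
def n (D : Raw) : ℕ := D.rows.length

/-- The candidate at a position of the axis. -/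
def ax (D : Raw) (i : ℕ) : ℕ := capVal (D.m + 1) (D.axis.getD i [])

/-- The entry of a voter for a position of the axis. -/
def entry (D : Raw) (v i : ℕ) : Entry := (D.rows.getD v []).getD (D.ax i) (false, false, [])

/-- The position of the preferred candidate. -/
def pos (D : Raw) : ℕ :=
  ((List.range D.m).filter fun i => Nat.beq (D.ax i) (capVal (D.m + 1) D.p)).headD 0

/-- The committee size. -/
def size (D : Raw) : ℕ := capVal (D.m + 1) D.k

/-- The word of the input is the encoding of an instance. -/
def valid (D : Raw) : Bool :=
  canonical D.p && (canonical D.k && (canonical D.budget && (D.axis.all (fun l => canonical l) &&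
  (D.rows.all (fun r => r.all fun e => bif e.2.1 then canonical e.2.2 else e.2.2.isEmpty) &&
  (Nat.ble (capVal (D.m + 1) D.p + 1) D.m && (Nat.ble 1 D.size && (Nat.ble D.size D.m &&
  ((List.range D.m).all (fun i => Nat.ble (D.ax i + 1) D.m) &&
  ((List.range D.m).all (fun i => (List.range D.m).all fun j =>
    Nat.beq i j || !(Nat.beq (D.ax i) (D.ax j))) &&
  (D.rows.all (fun r => Nat.beq r.length D.m) &&
  (List.range D.n).all (fun v => (List.range D.m).all fun i => (List.range D.m).all fun j =>
    (List.range D.m).all fun l =>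
      !(Nat.ble i j && (Nat.ble j l && ((D.entry v i).1 && (D.entry v l).1))) ||
        (D.entry v j).1)))))))))))

/-- The smallest interval that contains the ballot of the voter `v` and the preferred candidate
contains the candidate at position `i`, which is not on the ballot. -/
def cover (D : Raw) (v i : ℕ) : Bool :=
  !(D.entry v D.pos).1 && (!(D.entry v i).1 && (Nat.beq i D.pos ||
    ((Nat.ble (i + 1) D.pos && (List.range i).any fun j => (D.entry v j).1) ||
      (Nat.ble (D.pos + 1) i && (List.range D.m).any fun j =>
        Nat.ble (i + 1) j && (D.entry v j).1))))

/-- The score of the candidate at a position before the bribery. -/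
def score (D : Raw) (i : ℕ) : ℕ := ((List.range D.n).filter fun v => (D.entry v i).1).length

/-- Pay for the bribery of a voter. -/
@[irreducible]
def pay (D : Raw) (v : ℕ) (r : Bits) : Bool × Bits :=
  ((List.range D.m).filter fun i => D.cover v i).foldl (fun s i =>
    bif s.1 && (D.entry v i).2.1 then subBits s.2 (D.entry v i).2.2 else (false, s.2)) (true, r)

/-- An event is the test of a candidate or the choice whether to bribe a voter: a flag for tests,
a flag for the right hand side of the axis, and the position or the voter. -/
abbrev Event := Bool × Bool × ℕ

/-- The events of the sweep from the left end of the axis to the preferred candidate. -/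
def leftEvents (D : Raw) : List Event :=
  (List.range D.pos).flatMap fun i =>
    (((List.range D.n).filter fun v => D.cover v i && !(List.range i).any fun j => D.cover v j).map
      fun v => (false, false, v)) ++ [(true, false, i)]

/-- The events of the sweep from the right end of the axis to the preferred candidate. -/
def rightEvents (D : Raw) : List Event :=
  ((List.range D.m).filter fun i => Nat.ble (D.pos + 1) i).reverse.flatMap fun i =>
    (((List.range D.n).filter fun v => D.cover v i && !(List.range D.m).any fun j =>
      Nat.ble (i + 1) j && D.cover v j).map fun v => (false, true, v)) ++ [(true, true, i)]

/-- The choices for voters whose bribery adds no other candidate. -/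
def centerEvents (D : Raw) : List Event :=
  ((List.range D.n).filter fun v => D.cover v D.pos && !(List.range D.m).any fun j =>
    !(Nat.beq j D.pos) && D.cover v j).map fun v => (false, false, v)

/-- All events. -/
def events (D : Raw) : List Event := D.leftEvents ++ (D.rightEvents ++ D.centerEvents)

/-- The number of bribed voters on the left, their number on the right, and the number of candidates
that beat the preferred candidate, all of them up to some event. -/
abbrev Key := ℕ × ℕ × ℕ

/-- A key and the remaining budget. -/
abbrev State := Key × Bits

/-- The states after an event, if `t` voters are bribed altogether. -/
def expand (D : Raw) (t : ℕ) (e : Event) (s : State) : List State :=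
  bif e.1 then
    [((s.1.1, s.1.2.1,
      bif Nat.ble (D.score e.2.2 + (bif e.2.1 then s.1.2.1 else s.1.1)) (D.score D.pos + t) then
        s.1.2.2 else s.1.2.2 + 1), s.2)]
  else
    s :: bif (D.pay e.2.2 s.2).1 then
      [((bif e.2.1 then (s.1.1, s.1.2.1 + 1, s.1.2.2) else (s.1.1 + 1, s.1.2.1, s.1.2.2)),
        (D.pay e.2.2 s.2).2)]
    else []

end Raw

/-! ### Tables with at most one state per key -/

open Raw

/-- All keys with entries below a bound. -/
def keys (N : ℕ) : List Key :=
  (List.range N).flatMap fun x => (List.range N).flatMap fun y => (List.range N).map fun f =>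
    (x, y, f)

/-- Equality of keys. -/
def keyBeq (a b : Key) : Bool :=
  Nat.beq a.1 b.1 && (Nat.beq a.2.1 b.2.1 && Nat.beq a.2.2 b.2.2)

/-- The largest remaining budget for a key, as a list with at most one element. -/
def best (key : Key) (L : List State) : List Bits :=
  L.foldl (fun acc s => bif keyBeq s.1 key && (acc.isEmpty || (subBits s.2 (acc.headD [])).1) then
    [s.2] else acc) []

/-- Keep only the best state for each key. -/
def prune (K : List Key) (L : List State) : List State :=
  K.flatMap fun key => (best key L).map fun r => (key, r)

namespace Raw

/-- One step of the dynamic program. -/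
def dpStep (D : Raw) (t : ℕ) (T : List State) (e : Event) : List State :=
  prune (keys (D.events.length + 1)) (T.flatMap fun s => D.expand t e s)

/-- The table of the dynamic program. -/
def dp (D : Raw) (t : ℕ) : List State :=
  D.events.foldl (fun T e => D.dpStep t T e) [((0, 0, 0), D.budget)]

/-- The decision by dynamic programming. -/
def yes (D : Raw) : Bool :=
  (List.range (D.n + 1)).any fun t => (D.dp t).any fun s =>
    Nat.beq (s.1.1 + s.1.2.1) t && Nat.ble (s.1.2.2 + 1) D.size

end Raw

/-- The decision procedure on words. -/
def decideWord (w : List Γ') : Bool :=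
  wordBeq (parse w).word w && ((parse w).valid && (parse w).yes)

end StackProg

/-! ### The decision procedure takes polynomial time -/

namespace StackProg

open Computability (Γ')
open Polynomial (eval)
open Enc Raw

variable {α : Type} [Enc α] {f : α → Raw} {v i t : α → ℕ}

@[fun_prop]
theorem Poly.rawM (hf : Poly f) : Poly (fun a => (f a).m) := by unfold Raw.m; fun_prop

@[fun_prop]
theorem Poly.rawN (hf : Poly f) : Poly (fun a => (f a).n) := by unfold Raw.n; fun_prop

@[fun_prop]
theorem Poly.rawAx (hf : Poly f) (hi : Poly i) : Poly (fun a => (f a).ax (i a)) := by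
  unfold Raw.ax; fun_prop

@[fun_prop]
theorem Poly.rawEntry (hf : Poly f) (hv : Poly v) (hi : Poly i) :
    Poly (fun a => (f a).entry (v a) (i a)) := by
  unfold Raw.entry; fun_prop

@[fun_prop]
theorem Poly.rawPos (hf : Poly f) : Poly (fun a => (f a).pos) := by unfold Raw.pos; fun_prop

@[fun_prop]
theorem Poly.rawSize (hf : Poly f) : Poly (fun a => (f a).size) := by unfold Raw.size; fun_prop

@[fun_prop]
theorem Poly.rawValid (hf : Poly f) : Poly (fun a => (f a).valid) := by unfold Raw.valid; fun_prop

@[fun_prop]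
theorem Poly.rawCover (hf : Poly f) (hv : Poly v) (hi : Poly i) :
    Poly (fun a => (f a).cover (v a) (i a)) := by
  unfold Raw.cover; fun_prop

@[fun_prop]
theorem Poly.rawScore (hf : Poly f) (hi : Poly i) : Poly (fun a => (f a).score (i a)) := by
  unfold Raw.score; fun_prop

/-- Leading zeros are kept, so a remaining budget always has as many digits as the initial one,
however many payments are made. -/
theorem length_subBits (a b : Bits) : (subBits a b).2.length = a.length := by
  have key : ∀ (a : Bits) (s : Bool × Bits × Bits),
      (a.foldl subStep s).2.2.length = a.length + s.2.2.length := by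
    intro a
    induction a with
    | nil => intro s; simp
    | cons x a ih => intro s; rw [List.foldl_cons, ih]; simp [subStep]; omega
  simp [subBits, key]

theorem length_pay_foldl (D : Raw) (v : ℕ) (l : List ℕ) (s : Bool × Bits) :
    (l.foldl (fun s i => bif s.1 && (D.entry v i).2.1 then subBits s.2 (D.entry v i).2.2
      else (false, s.2)) s).2.length = s.2.length := by
  induction l generalizing s with
  | nil => rfl
  | cons i l ih =>
    rw [List.foldl_cons, ih]
    cases s.1 && (D.entry v i).2.1
    · rfl
    · exact length_subBits _ _

theorem sz_bits_le (l : Bits) : sz l ≤ 4 * l.length + 1 := by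
  have := sz_list_le (l := l) fun b _ => sz_bool_le b
  omega

@[fun_prop]
theorem Poly.rawPay {r : α → Bits} (hf : Poly f) (hv : Poly v) (hr : Poly r) :
    Poly (fun a => (f a).pay (v a) (r a)) := by
  unfold Raw.pay
  refine Poly.foldl (h := fun a s i => bif s.1 && ((f a).entry (v a) i).2.1 then
    StackProg.subBits s.2 ((f a).entry (v a) i).2.2 else (false, s.2))
    (l := fun a => (List.range (f a).m).filter fun i => (f a).cover (v a) i)
    (s := fun a => (true, r a)) (by fun_prop) (by fun_prop) (by fun_prop) ?_
  obtain ⟨p, hp⟩ := hr.exists_sz_le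
  -- Each digit takes at most four tree symbols; the constant covers the flag and the pair.
  refine ⟨4 * p + 10, fun a j => ?_⟩
  set s := List.foldl _ _ _ with hs
  have h₁ := length_pay_foldl (f a) (v a)
    (((List.range (f a).m).filter fun i => (f a).cover (v a) i).take j) (true, r a)
  rw [← hs] at h₁
  have h₂ := hp a
  have h₃ := length_le_sz (r a)
  have h₄ := sz_bits_le s.2
  have h₅ := sz_bool_le s.1
  rw [h₁] at h₄
  dsimp only at h₄
  rw [sz_prod]
  simp only [Polynomial.eval_add, Polynomial.eval_mul, Polynomial.eval_ofNat]
  omega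

@[fun_prop]
theorem Poly.rawLeftEvents (hf : Poly f) : Poly (fun a => (f a).leftEvents) := by
  unfold Raw.leftEvents; fun_prop

@[fun_prop]
theorem Poly.rawRightEvents (hf : Poly f) : Poly (fun a => (f a).rightEvents) := by
  unfold Raw.rightEvents; fun_prop

@[fun_prop]
theorem Poly.rawCenterEvents (hf : Poly f) : Poly (fun a => (f a).centerEvents) := by
  unfold Raw.centerEvents; fun_prop

@[fun_prop]
theorem Poly.rawEvents (hf : Poly f) : Poly (fun a => (f a).events) := by
  unfold Raw.events; fun_prop

@[fun_prop]
theorem Poly.rawExpand {e : α → Event} {s : α → State} (hf : Poly f) (ht : Poly t) (he : Poly e)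
    (hs : Poly s) : Poly (fun a => (f a).expand (t a) (e a) (s a)) := by
  unfold Raw.expand; fun_prop

@[fun_prop]
theorem Poly.keys (ht : Poly t) : Poly (fun a => keys (t a)) := by
  unfold StackProg.keys; fun_prop

@[fun_prop]
theorem Poly.keyBeq {g h : α → Key} (hg : Poly g) (hh : Poly h) :
    Poly (fun a => keyBeq (g a) (h a)) := by
  unfold StackProg.keyBeq; fun_prop

@[fun_prop]
theorem Poly.best {g : α → Key} {L : α → List State} (hg : Poly g) (hL : Poly L) :
    Poly (fun a => best (g a) (L a)) := by
  refine Poly.foldl_of_growth (h := fun a acc s => bif StackProg.keyBeq s.1 (g a) &&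
    (acc.isEmpty || (StackProg.subBits s.2 (acc.headD [])).1) then [s.2] else acc)
    hL (Poly.const []) (by fun_prop) ⟨.X + 2, fun a s b => ?_⟩
  simp only [Polynomial.eval_add, Polynomial.eval_X, Polynomial.eval_ofNat]
  cases StackProg.keyBeq b.1 (g a) && (s.isEmpty || (StackProg.subBits b.2 (s.headD [])).1)
  · simp
  · simp; omega

@[fun_prop]
theorem Poly.prune {K : α → List Key} {L : α → List State} (hK : Poly K) (hL : Poly L) :
    Poly (fun a => prune (K a) (L a)) := by
  unfold StackProg.prune; fun_prop

@[fun_prop]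
theorem Poly.rawDpStep {e : α → Event} {T : α → List State} (hf : Poly f) (ht : Poly t)
    (he : Poly e) (hT : Poly T) : Poly (fun a => (f a).dpStep (t a) (T a) (e a)) := by
  unfold Raw.dpStep; fun_prop

theorem length_pay (D : Raw) (v : ℕ) (r : Bits) : (D.pay v r).2.length = r.length := by
  unfold Raw.pay
  exact length_pay_foldl D v _ (true, r)

theorem keyBeq_iff {a b : Key} : keyBeq a b = true ↔ a = b := by
  obtain ⟨x, y, z⟩ := a
  obtain ⟨x', y', z'⟩ := b
  simp only [keyBeq, Bool.and_eq_true, Nat.beq_eq, Prod.mk.injEq]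

theorem mem_keys {N : ℕ} {a : Key} : a ∈ keys N ↔ a.1 < N ∧ a.2.1 < N ∧ a.2.2 < N := by
  obtain ⟨x, y, z⟩ := a
  simp [keys]

theorem length_keys (N : ℕ) : (keys N).length = N * (N * N) := by
  simp [keys, List.length_flatMap]

theorem best_append (key : Key) (L : List State) (s : State) :
    best key (L ++ [s]) = bif keyBeq s.1 key &&
      ((best key L).isEmpty || (subBits s.2 ((best key L).headD [])).1) then [s.2]
      else best key L := by
  rw [best, List.foldl_append]
  rfl

theorem length_best_le (key : Key) (L : List State) : (best key L).length ≤ 1 := by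
  induction L using List.reverseRecOn with
  | nil => simp [best]
  | append_singleton L s ih =>
    rw [best_append]
    cases keyBeq s.1 key && ((best key L).isEmpty || (subBits s.2 ((best key L).headD [])).1)
    · exact ih
    · simp

/-- Pruning only discards states; soundness of the table rests on this. -/
theorem mem_of_mem_best {key : Key} {L : List State} {r : Bits} (h : r ∈ best key L) :
    (key, r) ∈ L := by
  induction L using List.reverseRecOn with
  | nil => simp [best] at h
  | append_singleton L s ih =>
    rw [best_append] at h
    cases hk : keyBeq s.1 key
    · rw [hk, Bool.false_and, cond_false] at h
      exact List.mem_append_left _ (ih h)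
    · cases hs : (best key L).isEmpty || (subBits s.2 ((best key L).headD [])).1
      · rw [hs, Bool.and_false, cond_false] at h
        exact List.mem_append_left _ (ih h)
      · rw [hk, hs, Bool.and_true, cond_true, List.mem_singleton] at h
        rw [keyBeq_iff] at hk
        subst hk h
        simp

theorem mem_prune {K : List Key} {L : List State} {s : State} :
    s ∈ prune K L ↔ s.1 ∈ K ∧ s.2 ∈ best s.1 L := by
  obtain ⟨key, r⟩ := s
  simp only [prune, List.mem_flatMap, List.mem_map, Prod.mk.injEq]
  constructor
  · rintro ⟨_, h₁, _, h₂, rfl, rfl⟩; exact ⟨h₁, h₂⟩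
  · rintro ⟨h₁, h₂⟩; exact ⟨_, h₁, _, h₂, rfl, rfl⟩

theorem mem_of_mem_prune {K : List Key} {L : List State} {s : State} (h : s ∈ prune K L) :
    s ∈ L := mem_of_mem_best (mem_prune.1 h).2

theorem length_prune_le (K : List Key) (L : List State) : (prune K L).length ≤ K.length := by
  rw [prune, List.length_flatMap]
  have := List.sum_le_card_nsmul (K.map fun key => ((best key L).map fun r => (key, r)).length) 1
    (by
      intro x hx
      obtain ⟨key, _, rfl⟩ := List.mem_map.1 hx
      rw [List.length_map]
      exact length_best_le key L)
  simpa using this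

theorem length_of_mem_expand {D : Raw} {t : ℕ} {e : Event} {s s' : State}
    (h : s' ∈ D.expand t e s) : s'.2.length = s.2.length := by
  rw [Raw.expand] at h
  cases he : e.1
  · rw [he, cond_false, List.mem_cons] at h
    rcases h with rfl | h
    · rfl
    · cases hp : (D.pay e.2.2 s.2).1
      · rw [hp, cond_false] at h
        simp at h
      · rw [hp, cond_true, List.mem_singleton] at h
        rw [h]
        exact length_pay D _ _
  · rw [he, cond_true, List.mem_singleton] at h
    rw [h]

/-- Each choice could double the table, but pruning leaves one state per key, and payments do not
lengthen the budget. -/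
theorem dp_bound (D : Raw) (t : ℕ) (es : List Event) :
    let T := es.foldl (fun T e => D.dpStep t T e) [((0, 0, 0), D.budget)]
    T.length ≤ (D.events.length + 1) * ((D.events.length + 1) * (D.events.length + 1)) ∧
      ∀ s ∈ T, s.1 ∈ keys (D.events.length + 1) ∧ s.2.length = D.budget.length := by
  induction es using List.reverseRecOn with
  | nil =>
    refine ⟨?_, ?_⟩
    · simp only [List.foldl_nil, List.length_singleton]
      nlinarith [Nat.zero_le D.events.length]
    · simp only [List.foldl_nil, List.mem_singleton]
      rintro s rfl
      exact ⟨mem_keys.2 (by simp), rfl⟩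
  | append_singleton es e ih =>
    simp only [List.foldl_append, List.foldl_cons, List.foldl_nil] at ih ⊢
    refine ⟨(length_prune_le _ _).trans (length_keys _).le, fun s hs => ?_⟩
    refine ⟨(mem_prune.1 hs).1, ?_⟩
    obtain ⟨s', hs', h⟩ := List.mem_flatMap.1 (mem_of_mem_prune hs)
    rw [length_of_mem_expand h, (ih.2 s' hs').2]

@[fun_prop]
theorem Poly.rawDp (hf : Poly f) (ht : Poly t) : Poly (fun a => (f a).dp (t a)) := by
  refine Poly.foldl (h := fun a T e => (f a).dpStep (t a) T e) (l := fun a => (f a).events)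
    (s := fun a => [((0, 0, 0), (f a).budget)]) (by fun_prop) (by fun_prop) (by fun_prop) ?_
  obtain ⟨p, hp⟩ := (Poly.rawEvents hf).exists_sz_le
  obtain ⟨q, hq⟩ := (Poly.rawBudget hf).exists_sz_le
  -- The number of keys times the size of a state: three unary counters and the digits of the
  -- budget.
  refine ⟨(p + 1) * ((p + 1) * (p + 1)) * (6 * (p + 1) + 4 * q + 10) + 1, fun a i => ?_⟩
  obtain ⟨h₁, h₂⟩ := dp_bound (f a) (t a) ((f a).events.take i)
  have h₃ := (length_le_sz _).trans (hp a)
  have h₄ := (length_le_sz _).trans (hq a)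
  refine (sz_list_le (c := 6 * ((f a).events.length + 1) + 4 * (f a).budget.length + 9)
    fun s hs => ?_).trans ?_
  · obtain ⟨h₅, h₆⟩ := h₂ s hs
    rw [mem_keys] at h₅
    have := sz_bits_le s.2
    simp only [sz_prod, sz_nat]
    omega
  · simp only [Polynomial.eval_add, Polynomial.eval_mul, Polynomial.eval_ofNat,
      Polynomial.eval_one]
    exact Nat.add_le_add_right (Nat.mul_le_mul (h₁.trans (by gcongr)) (by omega)) 1

@[fun_prop]
theorem Poly.rawYes (hf : Poly f) : Poly (fun a => (f a).yes) := by
  unfold Raw.yes; fun_prop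

theorem poly_decideWord : Poly decideWord := by
  unfold decideWord; fun_prop

theorem enc_word (w : List Γ') : enc w = wordTree w := by
  induction w with
  | nil => rfl
  | cons a w ih => exact congrArg (Tree.node (symTree a)) ih

theorem sz_word_le (w : List Γ') : sz w ≤ 10 * w.length + 1 := by
  have := sz_list_le (l := w) (c := 9) fun a _ => by
    rcases a with _ | (_ | _) | _ | _ | _ <;> simp [sz, enc, symTree, symBits, boolTree, Tree.size]
  omega

/-- The definition of computability translates words along equivalences of alphabets; here both are
identities. -/
theorem nonempty_outputs_map {tm : Turing.FinTM2} {l : List (tm.Γ tm.k₀)}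
    {l' : List (tm.Γ tm.k₁)} {t : ℕ} (h : Nonempty (Turing.TM2OutputsInTime tm l (some l') t)) :
    Nonempty (Turing.TM2OutputsInTime tm (l.map (Equiv.refl (tm.Γ tm.k₀)).invFun)
      (some (l'.map (Equiv.refl (tm.Γ tm.k₁)).invFun)) t) := by
  have e₁ : l.map (Equiv.refl (tm.Γ tm.k₀)).invFun = l := List.map_id l
  have e₂ : l'.map (Equiv.refl (tm.Γ tm.k₁)).invFun = l' := List.map_id l'
  rwa [e₁, e₂]

/-- A language that is decided by a polynomial-time function is in `P`. -/
theorem inP_of_poly {L : Set (List Γ')} {g : List Γ' → Bool} (hg : Poly g)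
    (h : ∀ w, g w = true ↔ w ∈ L) : AVBribery.InP L := by
  obtain ⟨c, p, hp⟩ := hg
  -- Reading the word costs `30 * .X + 5`, the program then runs on a tree of size at most `10 * .X
  -- + 1`, and one last step writes the answer.
  have hex : ∀ w : List Γ', Nonempty (Turing.TM2OutputsInTime (machine (.seq readCmd c)) w
      (some (Computability.encodeBool (g w)))
      (eval w.length (30 * .X + 5 + p.comp (10 * .X + 1) + 1))) := by
    intro w
    obtain ⟨r, h₁⟩ := (hp w).1 none [] [] [] []
    rw [enc_word, List.append_nil, List.append_nil] at h₁
    rw [show enc (g w) = boolTree (g w) from rfl, code_boolTree] at h₁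
    have h₂ := eval_mono p (sz_word_le w)
    have h₃ := machine_outputs ((exec_readCmd w).seq h₁)
    obtain ⟨h₄⟩ := h₃
    refine ⟨⟨h₄.toEvalsTo, h₄.steps_le_m.trans ?_⟩⟩
    simp only [Polynomial.eval_add, Polynomial.eval_mul, Polynomial.eval_ofNat,
      Polynomial.eval_one, Polynomial.eval_X, Polynomial.eval_comp]
    omega
  refine ⟨⟨⟨machine (.seq readCmd c), Equiv.refl _, Equiv.refl _⟩,
    30 * .X + 5 + p.comp (10 * .X + 1) + 1, fun w => ?_⟩⟩
  have e : (@decide (w ∈ L) (Classical.propDecidable _)) = g w := by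
    rw [Bool.eq_iff_iff, h w]
    simp
  simp only [e]
  exact Classical.choice (nonempty_outputs_map (hex w))

end StackProg

/-! ### Correctness of parsing and of the arithmetic -/

namespace StackProg

open Computability (Γ')
open Raw

theorem symBits_injective : Function.Injective symBits := by
  intro a b
  rcases a with _ | (_ | _) | _ | _ | _ <;> rcases b with _ | (_ | _) | _ | _ | _ <;>
    simp [symBits]

theorem symBeq_iff {a b : Γ'} : symBeq a b = true ↔ a = b := by
  rw [← symBits_injective.eq_iff, symBeq, Prod.ext_iff, Prod.ext_iff]
  simp

theorem wordBeq_iff {v w : List Γ'} : wordBeq v w = true ↔ v = w := by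
  rw [wordBeq, Bool.and_eq_true, Nat.beq_eq, List.all_eq_true]
  constructor
  · rintro ⟨h₁, h₂⟩
    refine List.ext_getElem h₁ fun i hi hi' => ?_
    have := symBeq_iff.1 (h₂ i (List.mem_range.2 hi))
    rwa [List.getD_eq_getElem _ _ hi, List.getD_eq_getElem _ _ hi'] at this
  · rintro rfl
    exact ⟨rfl, fun i _ => symBeq_iff.2 rfl⟩

theorem tokens_append (l : Bits) {s : Γ'} (hs : (symBits s).1 = false) (w : List Γ') :
    tokens (l.map Γ'.bit ++ s :: w) = (l, s) :: tokens w := by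
  induction l with
  | nil =>
    rw [List.map_nil, List.nil_append, tokens, List.foldr_cons, tokenStep, hs]
    rfl
  | cons b l ih =>
    rw [List.map_cons, List.cons_append, tokens, List.foldr_cons]
    rw [tokens] at ih
    rw [ih]
    rfl

theorem tokens_sym {s : Γ'} (hs : (symBits s).1 = false) (w : List Γ') :
    tokens (s :: w) = ([], s) :: tokens w := tokens_append [] hs w

theorem tokens_numWord (l : Bits) (w : List Γ') :
    tokens (numWord l ++ w) = (l, .comma) :: tokens w := by
  rw [numWord, List.append_assoc]
  exact tokens_append l rfl w

theorem tokens_flatMap_numWord (L : List Bits) (w : List Γ') :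
    tokens (L.flatMap numWord ++ w) = L.map (fun l => (l, Γ'.comma)) ++ tokens w := by
  induction L with
  | nil => rfl
  | cons l L ih => rw [List.flatMap_cons, List.append_assoc, tokens_numWord, ih]; rfl

/-- The token of an entry. -/
def entryToken (e : Entry) : Token :=
  (e.1 :: bif e.2.1 then e.2.2 else [], bif e.2.1 then .comma else .blank)

theorem tokens_entryWord (e : Entry) (w : List Γ') :
    tokens (entryWord e ++ w) = entryToken e :: tokens w := by
  obtain ⟨a, f, l⟩ := e
  cases f
  · exact tokens_append [a] (s := .blank) rfl w
  · have := tokens_append (a :: l) (s := .comma) rfl w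
    simpa [entryWord, numWord, entryToken] using this

theorem tokens_flatMap_entryWord (L : List Entry) (w : List Γ') :
    tokens (L.flatMap entryWord ++ w) = L.map entryToken ++ tokens w := by
  induction L with
  | nil => rfl
  | cons l L ih => rw [List.flatMap_cons, List.append_assoc, tokens_entryWord, ih]; rfl

/-- The closing bracket ends a group, and its own token is discarded. -/
theorem groups_append {L : List Token} (hL : ∀ t ∈ L, t.2 ≠ .ket) (l : Bits) (ts : List Token) :
    groups (L ++ (l, .ket) :: ts) = L :: groups ts := by
  induction L with
  | nil => rfl
  | cons t L ih =>
    have ih := ih fun t ht => hL t (by simp [ht])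
    have ht : symBeq t.2 .ket = false := by
      rw [Bool.eq_false_iff, ne_eq, symBeq_iff]
      exact hL t (by simp)
    rw [groups] at ih ⊢
    rw [List.cons_append, List.foldr_cons, ih, groupStep, ht]
    rfl

theorem entryToken_snd_ne (e : Entry) : (entryToken e).2 ≠ .ket := by
  obtain ⟨a, f, l⟩ := e
  cases f <;> simp [entryToken]

theorem groups_rows (R : List (List Entry)) :
    groups (tokens (R.flatMap rowWord)) = R.map fun r => ([], Γ'.bra) :: r.map entryToken := by
  induction R with
  | nil => rfl
  | cons r R ih =>
    rw [List.flatMap_cons, rowWord, List.append_assoc, List.append_assoc, List.singleton_append,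
      tokens_sym rfl, tokens_flatMap_entryWord, List.singleton_append, tokens_sym rfl,
      ← List.cons_append, groups_append, ih]
    · rfl
    · intro t ht
      rcases List.mem_cons.1 ht with rfl | ht
      · simp
      · obtain ⟨e, _, rfl⟩ := List.mem_map.1 ht
        exact entryToken_snd_ne e

theorem tokenEntry_entryToken {e : Entry} (he : e.2.1 = false → e.2.2 = []) :
    tokenEntry (entryToken e) = e := by
  obtain ⟨a, f, l⟩ := e
  cases f
  · have : l = [] := he rfl
    subst this
    rfl
  · rfl

/-- The digits of infinite prices are empty. -/
def Raw.Normal (D : Raw) : Prop := ∀ r ∈ D.rows, ∀ e ∈ r, e.2.1 = false → e.2.2 = []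

/-- Every symbol other than a bit ends a token, and closing brackets end groups, so the word can be
read uniquely. An approval bit shares a token with the digits of its price. Normality is needed
because the word of an infinite price records no digits. -/
theorem parse_word {D : Raw} (hD : D.Normal) : parse D.word = D := by
  -- The axis comes after three numbers and an opening bracket, hence the `drop 4` of the parser;
  -- the bracket token of a row is removed by `tail`.
  have h₁ : groups (tokens D.word) = ([(D.p, Γ'.comma), (D.k, Γ'.comma), (D.budget, Γ'.comma),
      ([], Γ'.bra)] ++ D.axis.map fun l => (l, Γ'.comma)) ::
        D.rows.map fun r => ([], Γ'.bra) :: r.map entryToken := by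
    rw [Raw.word]
    simp only [List.append_assoc]
    rw [tokens_numWord, tokens_numWord, tokens_numWord, List.singleton_append, tokens_sym rfl,
      tokens_flatMap_numWord, List.singleton_append, tokens_sym rfl, ← groups_rows]
    rw [← groups_append (l := []) (ts := tokens (D.rows.flatMap rowWord))]
    · simp
    · intro t ht
      simp only [List.mem_append, List.mem_cons, List.not_mem_nil, or_false, List.mem_map] at ht
      rcases ht with (rfl | rfl | rfl | rfl) | ⟨l, _, rfl⟩ <;> simp
  rw [parse, h₁, rawOfGroups]
  obtain ⟨p, k, b, axis, rows⟩ := D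
  have h₂ : rows.map ((fun g => List.map (fun t => tokenEntry t) g.tail) ∘
      fun r => ([], Γ'.bra) :: r.map entryToken) = rows := by
    refine (List.map_congr_left fun r hr => ?_).trans (List.map_id rows)
    simp only [Function.comp, List.tail_cons, List.map_map, id]
    refine (List.map_congr_left fun e he => ?_).trans (List.map_id r)
    exact tokenEntry_entryToken (hD r hr e he)
  simp only [List.headD_cons, List.tail_cons, List.map_map, h₂]
  simp [Function.comp_def]

/-- The most significant digit is the last one, and `canonical` says that it is `true`; the other
digits choose between `bit0` and `bit1`. -/
theorem exists_encodePosNum {l : Bits} (hl : canonical l = true) (hne : l ≠ []) :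
    ∃ q : PosNum, Computability.encodePosNum q = l := by
  induction l with
  | nil => exact absurd rfl hne
  | cons b l ih =>
    cases l with
    | nil =>
      have : b = true := hl
      subst this
      exact ⟨.one, rfl⟩
    | cons c l =>
      obtain ⟨q, hq⟩ := ih hl (by simp)
      cases b
      · exact ⟨.bit0 q, by rw [Computability.encodePosNum, hq]⟩
      · exact ⟨.bit1 q, by rw [Computability.encodePosNum, hq]⟩

theorem exists_encodeNat {l : Bits} (hl : canonical l = true) :
    ∃ n, Computability.encodeNat n = l := by
  by_cases h : l = []
  · subst h; exact ⟨0, rfl⟩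
  · obtain ⟨q, hq⟩ := exists_encodePosNum hl h
    refine ⟨((Num.pos q : Num) : ℕ), ?_⟩
    rw [Computability.encodeNat, Num.of_to_nat]
    exact hq

theorem canonical_encodePosNum (q : PosNum) :
    canonical (Computability.encodePosNum q) = true := by
  induction q with
  | one => rfl
  | bit0 q ih | bit1 q ih =>
    rw [Computability.encodePosNum]
    have hne := Computability.encodePosNum_nonempty q
    cases h : Computability.encodePosNum q with
    | nil => exact absurd h hne
    | cons c l => rw [h] at ih; exact ih

theorem canonical_encodeNat (n : ℕ) : canonical (Computability.encodeNat n) = true := by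
  rw [Computability.encodeNat]
  cases (n : Num) with
  | zero => rfl
  | pos q => exact canonical_encodePosNum q

theorem val_encodePosNum (q : PosNum) : val (Computability.encodePosNum q) = q := by
  induction q with
  | one => rfl
  | bit0 q ih => rw [Computability.encodePosNum, val, ih, PosNum.cast_bit0]; simp; omega
  | bit1 q ih => rw [Computability.encodePosNum, val, ih, PosNum.cast_bit1]; simp; omega

theorem val_encodeNat (n : ℕ) : val (Computability.encodeNat n) = n := by
  have h : ∀ q : Num, val (Computability.encodeNum q) = q := by
    intro q
    cases q with
    | zero => rfl
    | pos q => exact val_encodePosNum q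
  rw [Computability.encodeNat, h, Num.to_of_nat]

theorem encodeNat_val {l : Bits} (hl : canonical l = true) :
    Computability.encodeNat (val l) = l := by
  obtain ⟨n, rfl⟩ := exists_encodeNat hl
  rw [val_encodeNat]

/-- Capping early is harmless: a value that has reached `c` stays at least `c` when it is doubled
and a digit is added. -/
theorem capVal_eq (c : ℕ) (l : Bits) : capVal c l = min c (val l) := by
  rw [capVal, List.foldl_reverse]
  induction l with
  | nil => simp [val]
  | cons b l ih =>
    rw [List.foldr_cons, ih, capStep_eq, val]
    omega

/-- School subtraction. The final borrow and the unread digits of `b` together measure the deficit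
in units of `2 ^ a.length`; the subtraction succeeds iff this deficit is zero. -/
theorem subBits_spec (a b : Bits) : ((subBits a b).1 = true ↔ val b ≤ val a) ∧
    ((subBits a b).1 = true → val (subBits a b).2 + val b = val a) := by
  -- The invariant for an arbitrary incoming borrow `c`, with `d` the digits produced.
  have key : ∀ (a bs out : Bits) (c : Bool), ∃ d : Bits, d.length = a.length ∧
      (a.foldl subStep (c, bs, out)).2.2 = d.reverse ++ out ∧
      val a + 2 ^ a.length * ((a.foldl subStep (c, bs, out)).1.toNat +
        val (a.foldl subStep (c, bs, out)).2.1) = val d + val bs + c.toNat := by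
    intro a
    induction a with
    | nil => intro bs out c; exact ⟨[], rfl, rfl, by simp [val]; omega⟩
    | cons x a ih =>
      intro bs out c
      obtain ⟨d, hd, h₁, h₂⟩ := ih bs.tail (xor x (xor (bs.headD false) c) :: out)
        ((!x && (bs.headD false || c)) || (bs.headD false && c))
      refine ⟨xor x (xor (bs.headD false) c) :: d, by simp [hd], ?_, ?_⟩
      · rw [List.foldl_cons, subStep, h₁]
        simp
      · rw [List.foldl_cons, subStep, val, val, List.length_cons, pow_succ']
        have h₃ : val bs = (bs.headD false).toNat + 2 * val bs.tail := by cases bs <;> rfl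
        generalize bs.headD false = y at *
        rw [mul_assoc]
        generalize 2 ^ a.length * _ = X at *
        rw [h₃]
        cases x <;> cases y <;> cases c <;>
          simp only [Bool.toNat_false, Bool.toNat_true, Bool.xor_false, Bool.xor_true,
            Bool.not_true, Bool.not_false, Bool.and_true, Bool.and_false, Bool.or_true,
            Bool.or_false, Bool.xor_self] at h₂ ⊢ <;> omega
  have hlt : ∀ d : Bits, val d < 2 ^ d.length := by
    intro d
    induction d with
    | nil => simp [val]
    | cons x d ih =>
      rw [val, List.length_cons, pow_succ']
      have := Bool.toNat_le x
      omega
  have hzero : ∀ l : Bits, l.all (fun x => !x) = true ↔ val l = 0 := by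
    intro l
    induction l with
    | nil => simp [val]
    | cons x l ih =>
      rw [List.all_cons, Bool.and_eq_true, ih, val]
      cases x <;> simp
  obtain ⟨d, hd, h₁, h₂⟩ := key a b [] false
  have h₃ := hlt d
  rw [hd] at h₃
  unfold subBits
  rw [h₁]
  simp only [Bool.and_eq_true, hzero, Bool.not_eq_true', List.append_nil, List.reverse_reverse]
  generalize (a.foldl subStep (false, b, [])).1 = c at *
  generalize val (a.foldl subStep (false, b, [])).2.1 = y at *
  simp only [Bool.toNat_false, add_zero] at h₂
  have h₄ : c = false ∧ y = 0 ↔ c.toNat + y = 0 := by cases c <;> simp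
  rw [h₄]
  generalize c.toNat + y = z at *
  constructor
  · constructor
    · rintro rfl
      omega
    · intro h
      by_contra hz
      -- A nonzero deficit is at least `2 ^ a.length`, which exceeds `val d`; this would force `val
      -- a < val b`.
      have : 2 ^ a.length * 1 ≤ 2 ^ a.length * z := Nat.mul_le_mul_left _ (by omega)
      omega
  · rintro rfl
    omega

/-! ### Paying for the bribery of a voter -/

namespace Raw

/-- The price of an added approval. -/
def price (D : Raw) (v i : ℕ) : ℕ∞ := if (D.entry v i).2.1 then val (D.entry v i).2.2 else ⊤

/-- The price of the bribery of a voter. -/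
def weight (D : Raw) (v : ℕ) : ℕ∞ :=
  (((List.range D.m).filter fun i => D.cover v i).map fun i => D.price v i).sum

/-- Prices are nonnegative, so the successive payments all succeed iff the total is affordable. An
infinite price fails at once and makes the total infinite. -/
theorem pay_spec (D : Raw) (v : ℕ) (r : Bits) :
    ((D.pay v r).1 = true ↔ D.weight v ≤ val r) ∧
      ((D.pay v r).1 = true → (val (D.pay v r).2 : ℕ∞) + D.weight v = val r) := by
  unfold pay
  rw [weight]
  generalize ((List.range D.m).filter fun i => D.cover v i) = l
  induction l using List.reverseRecOn with
  | nil => simp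
  | append_singleton l i ih =>
    simp only [List.foldl_append, List.foldl_cons, List.foldl_nil, List.map_append, List.sum_append,
      List.map_cons, List.map_nil, List.sum_cons, List.sum_nil, add_zero]
    generalize l.foldl _ (true, r) = s at *
    generalize (l.map fun i => D.price v i).sum = w at *
    rw [price]
    obtain ⟨ok, q⟩ := s
    dsimp only at ih ⊢
    cases hf : (D.entry v i).2.1
    · simp
    · cases ok
      -- After a failure the partial sum already exceeds `val r`, and adding a price cannot repair
      -- this.
      · have h₁ : ¬ w ≤ val r := by simpa using ih.1
        simp only [Bool.false_and, cond_false, Bool.false_eq_true, false_iff, false_implies,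
          and_true, if_true]
        exact fun h => h₁ (le_self_add.trans h)
      · have h₁ := ih.2 rfl
        have h₂ := subBits_spec q (D.entry v i).2.2
        have hw : w ≠ ⊤ := fun h => by rw [h] at h₁; simp at h₁
        lift w to ℕ using hw
        simp only [Bool.and_self, cond_true, if_true]
        norm_cast at h₁ ⊢
        rw [h₂.1]
        refine ⟨by omega, fun h => ?_⟩
        have := h₂.2 (h₂.1.2 h)
        omega

end Raw

end StackProg

/-! ### Correctness of the dynamic program -/

namespace StackProg

open Raw

/-- The voters that occur in a list of events. -/
def voters (es : List Event) : List ℕ := (es.filter fun e => !e.1).map fun e => e.2.2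

theorem voters_append (es es' : List Event) : voters (es ++ es') = voters es ++ voters es' := by
  simp [voters]

theorem voters_choices (side : Bool) (vs : List ℕ) :
    voters (vs.map fun v => (false, side, v)) = vs := by
  induction vs with
  | nil => rfl
  | cons v vs ih => exact congrArg (v :: ·) ih

theorem voters_test (side : Bool) (i : ℕ) : voters [(true, side, i)] = [] := rfl

/-- The stored budget is replaced only by one at least as large, so it never decreases during the
fold. -/
theorem mem_best_of_mem {key : Key} {L : List State} {r : Bits} (h : (key, r) ∈ L) :
    ∃ r' ∈ best key L, val r ≤ val r' := by
  induction L using List.reverseRecOn with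
  | nil => simp at h
  | append_singleton L s ih =>
    rw [best_append]
    rcases List.mem_append.1 h with h | h
    · obtain ⟨r', h₁, h₂⟩ := ih h
      have hl := length_best_le key L
      obtain ⟨q, hq⟩ : ∃ q, best key L = [q] := by
        match hb : best key L with
        | [] => rw [hb] at h₁; simp at h₁
        | [q] => exact ⟨q, rfl⟩
        | _ :: _ :: _ => rw [hb] at hl; simp at hl
      rw [hq, List.mem_singleton] at h₁
      subst h₁
      rw [hq]
      cases hc : keyBeq s.1 key && ([r'].isEmpty || (subBits s.2 ([r'].headD [])).1)
      · exact ⟨r', by simp, h₂⟩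
      · refine ⟨s.2, by simp, h₂.trans ?_⟩
        rw [Bool.and_eq_true] at hc
        exact (subBits_spec _ _).1.1 hc.2
    · rw [List.mem_singleton] at h
      subst h
      rw [keyBeq_iff.2 rfl, Bool.true_and]
      cases hc : (best key L).isEmpty || (subBits r ((best key L).headD [])).1
      · rw [Bool.or_eq_false_iff] at hc
        obtain ⟨q, l, hb⟩ : ∃ q l, best key L = q :: l := by
          cases hb : best key L with
          | nil => rw [hb] at hc; simp at hc
          | cons q l => exact ⟨q, l, rfl⟩
        rw [hb] at hc ⊢
        refine ⟨q, by simp, ?_⟩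
        have : ¬ val q ≤ val r := by
          rw [← (subBits_spec r q).1, show subBits r q = subBits r ((q :: l).headD []) from rfl,
            hc.2]
          simp
        omega
      · exact ⟨r, by simp, le_rfl⟩

namespace Raw

variable (D : Raw) (t : ℕ) (T : Finset ℕ)

/-- The effect of an event on the key if exactly the voters in `T` are bribed. -/
def stepKey (k : Key) (e : Event) : Key :=
  if e.1 then
    (k.1, k.2.1, if D.score e.2.2 + (if e.2.1 then k.2.1 else k.1) ≤ D.score D.pos + t then k.2.2
      else k.2.2 + 1)
  else if e.2.2 ∈ T then (if e.2.1 then (k.1, k.2.1 + 1, k.2.2) else (k.1 + 1, k.2.1, k.2.2))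
  else k

/-- The key after a list of events if exactly the voters in `T` are bribed. -/
def runKey (k : Key) (es : List Event) : Key := es.foldl (D.stepKey t T) k

/-- The price of the bribery of the voters in `T` that occur in a list of events. -/
def cost (es : List Event) : ℕ∞ := (((voters es).filter fun v => decide (v ∈ T)).map D.weight).sum

theorem cost_append (es es' : List Event) :
    D.cost T (es ++ es') = D.cost T es + D.cost T es' := by
  simp [cost, voters_append]

variable {D t T}

theorem expand_test (side : Bool) (i : ℕ) (s : State) :
    D.expand t (true, side, i) s = [(D.stepKey t T s.1 (true, side, i), s.2)] := by
  simp only [expand, stepKey, cond_true, if_true]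
  congr 4
  · cases h : Nat.ble (D.score i + bif side then s.1.2.1 else s.1.1) (D.score D.pos + t)
    · rw [if_neg, cond_false]
      rw [← Nat.ble_eq]
      cases side <;> simp_all
    · rw [if_pos, cond_true]
      rw [← Nat.ble_eq]
      cases side <;> simp_all

theorem runKey_le (k : Key) (es : List Event) (c : ℕ) (h : k.1 ≤ c ∧ k.2.1 ≤ c ∧ k.2.2 ≤ c) :
    (D.runKey t T k es).1 ≤ c + es.length ∧ (D.runKey t T k es).2.1 ≤ c + es.length ∧
      (D.runKey t T k es).2.2 ≤ c + es.length := by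
  induction es generalizing k c with
  | nil => exact h
  | cons e es ih =>
    have := ih (D.stepKey t T k e) (c + 1) (by unfold stepKey; split_ifs <;> (try dsimp only) <;> omega)
    rw [List.length_cons, ← Nat.succ_add_eq_add_succ]
    exact this

/-- The table after some events. -/
def table (D : Raw) (t : ℕ) (es : List Event) : List State :=
  es.foldl (fun T e => D.dpStep t T e) [((0, 0, 0), D.budget)]

theorem table_append (D : Raw) (t : ℕ) (es : List Event) (e : Event) :
    D.table t (es ++ [e]) =
      prune (keys (D.events.length + 1)) ((D.table t es).flatMap fun s => D.expand t e s) := by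
  rw [table, List.foldl_append]
  rfl

/-- Completeness, by exchange: later events depend only on the key and the remaining budget, and a
larger budget never hurts. The stored state may come from another set of voters with the same key,
hence an inequality for its budget. -/
theorem exists_mem_table (es : List Event) (hes : es.length ≤ D.events.length)
    (hc : D.cost T es ≤ val D.budget) : ∃ s ∈ D.table t es, s.1 = D.runKey t T (0, 0, 0) es ∧
      (val D.budget : ℕ∞) ≤ val s.2 + D.cost T es := by
  induction es using List.reverseRecOn with
  | nil => exact ⟨_, List.mem_singleton.2 rfl, rfl, le_self_add⟩
  | append_singleton es e ih =>
    rw [List.length_append, List.length_singleton] at hes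
    rw [cost_append] at hc
    obtain ⟨s, hs, hk, hb⟩ := ih (by omega) (le_self_add.trans hc)
    have hkey : D.runKey t T (0, 0, 0) (es ++ [e]) = D.stepKey t T s.1 e := by
      rw [hk, runKey, List.foldl_append]
      rfl
    have hstep : ∃ s' ∈ D.expand t e s, s'.1 = D.stepKey t T s.1 e ∧
        (val D.budget : ℕ∞) ≤ val s'.2 + D.cost T (es ++ [e]) := by
      rw [cost_append]
      obtain ⟨test, side, i⟩ := e
      cases test
      · have hcost : D.cost T [(false, side, i)] = if i ∈ T then D.weight i else 0 := by
          by_cases h : i ∈ T <;> simp [cost, voters, h]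
        rw [hcost] at hc ⊢
        by_cases h : i ∈ T
        · rw [if_pos h] at hc ⊢
          -- The budget covers the cost so far plus this voter, and `s` has at least the budget
          -- minus the cost so far.
          have hp : (D.pay i s.2).1 = true := by
            rw [(pay_spec D i s.2).1]
            have hw : D.weight i ≠ ⊤ := fun h => by rw [h] at hc; simp at hc
            have hx : D.cost T es ≠ ⊤ := fun h => by rw [h] at hc; simp at hc
            revert hc hb
            lift D.weight i to ℕ using hw with w
            lift D.cost T es to ℕ using hx with x
            norm_cast
            omega
          refine ⟨(D.stepKey t T s.1 (false, side, i), (D.pay i s.2).2), ?_, rfl, ?_⟩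
          · cases side <;> simp [expand, stepKey, hp, h]
          · have := (pay_spec D i s.2).2 hp
            dsimp only
            rw [add_left_comm, this, add_comm]
            exact hb
        · rw [if_neg h, add_zero]
          exact ⟨s, by simp [expand], by simp [stepKey, h], hb⟩
      · refine ⟨_, by rw [expand_test (T := T)]; exact List.mem_singleton.2 rfl, rfl, ?_⟩
        exact hb.trans (by gcongr; exact le_self_add)
    obtain ⟨s', hs', hk', hb'⟩ := hstep
    obtain ⟨r, hr, hle⟩ := mem_best_of_mem (key := s'.1) (r := s'.2)
      (List.mem_flatMap.2 ⟨s, hs, hs'⟩)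
    refine ⟨(s'.1, r), ?_, by rw [hkey]; exact hk', hb'.trans ?_⟩
    · rw [table_append, mem_prune]
      refine ⟨?_, hr⟩
      -- No counter rises by more than one per event, so the key is among those kept by the pruning.
      have := runKey_le (D := D) (t := t) (T := T) (0, 0, 0) (es ++ [e]) 0 (by simp)
      rw [hkey, ← hk', List.length_append, List.length_singleton] at this
      rw [mem_keys]
      dsimp only
      omega
    · gcongr

theorem runKey_congr {T' : Finset ℕ} (k : Key) (es : List Event)
    (h : ∀ v ∈ voters es, v ∈ T ↔ v ∈ T') : D.runKey t T k es = D.runKey t T' k es := by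
  induction es generalizing k with
  | nil => rfl
  | cons e es ih =>
    have e₁ : D.stepKey t T k e = D.stepKey t T' k e := by
      obtain ⟨test, side, i⟩ := e
      cases test
      · simp [stepKey, h i (by simp [voters])]
      · simp [stepKey]
    rw [runKey, List.foldl_cons, e₁]
    refine ih _ fun v hv => h v ?_
    rw [← List.singleton_append, voters_append]
    exact List.mem_append_right _ hv

theorem cost_congr {T' : Finset ℕ} (es : List Event) (h : ∀ v ∈ voters es, v ∈ T ↔ v ∈ T') :
    D.cost T es = D.cost T' es := by
  rw [cost, cost]
  congr 2
  exact List.filter_congr fun v hv => by simp [h v hv]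

/-- Soundness: tracing a state back gives the set of voters bribed on the way. As no voter occurs
twice, a later decision cannot contradict an earlier one. -/
theorem exists_of_mem_table (es : List Event) (hes : (voters es).Nodup) {s : State}
    (hs : s ∈ D.table t es) : ∃ T : Finset ℕ, (∀ v ∈ T, v ∈ voters es) ∧
      D.runKey t T (0, 0, 0) es = s.1 ∧ D.cost T es + val s.2 = val D.budget := by
  induction es using List.reverseRecOn generalizing s with
  | nil =>
    rw [table, List.foldl_nil, List.mem_singleton] at hs
    subst hs
    exact ⟨∅, by simp, rfl, by simp [cost, voters]⟩
  | append_singleton es e ih =>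
    rw [voters_append] at hes
    rw [table_append] at hs
    obtain ⟨s₀, hs₀, hs⟩ := List.mem_flatMap.1 (mem_of_mem_prune hs)
    obtain ⟨T, hT, hk, hc⟩ := ih hes.of_append_left hs₀
    have hrun : ∀ T' : Finset ℕ, D.runKey t T' (0, 0, 0) (es ++ [e]) =
        D.stepKey t T' (D.runKey t T' (0, 0, 0) es) e := fun T' => by
      rw [runKey, List.foldl_append]; rfl
    obtain ⟨test, side, i⟩ := e
    cases test
    · have hi : i ∉ voters es := fun h =>
        List.disjoint_of_nodup_append hes h (by simp [voters])
      have hi' : i ∉ T := fun h => hi (hT i h)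
      simp only [expand, cond_false, List.mem_cons] at hs
      rcases hs with rfl | hs
      · refine ⟨T, fun v hv => ?_, ?_, ?_⟩
        · rw [voters_append]
          exact List.mem_append_left _ (hT v hv)
        · rw [hrun, hk]
          simp [stepKey, hi']
        · rw [cost_append, ← hc]
          simp [cost, voters, hi']
      · cases hp : (D.pay i s₀.2).1
        · rw [hp, cond_false] at hs
          simp at hs
        · rw [hp, cond_true, List.mem_singleton] at hs
          subst hs
          -- The new voter is absent from the earlier events, so adding it changes neither their key
          -- nor their cost.
          have hcongr : ∀ v ∈ voters es, v ∈ insert i T ↔ v ∈ T := fun v hv => by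
            rw [Finset.mem_insert, or_iff_right]
            rintro rfl
            exact hi hv
          refine ⟨insert i T, fun v hv => ?_, ?_, ?_⟩
          · rw [voters_append]
            rcases Finset.mem_insert.1 hv with rfl | hv
            · exact List.mem_append_right _ (by simp [voters])
            · exact List.mem_append_left _ (hT v hv)
          · rw [hrun, runKey_congr _ _ hcongr, hk]
            cases side <;> simp [stepKey]
          · rw [cost_append, cost_congr _ hcongr, ← hc]
            have := (pay_spec D i s₀.2).2 hp
            dsimp only
            rw [← this]
            simp [cost, voters, add_assoc, add_comm (D.weight i)]
    · rw [expand_test (T := T), List.mem_singleton] at hs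
      subst hs
      refine ⟨T, fun v hv => ?_, ?_, ?_⟩
      · rw [voters_append]
        exact List.mem_append_left _ (hT v hv)
      · rw [hrun, hk]
      · rw [cost_append, ← hc]
        simp [cost, voters]

end Raw

end StackProg

/-! ### The meaning of the dynamic program -/

namespace StackProg

open Raw

namespace Raw

variable {D : Raw} {t : ℕ} {T : Finset ℕ}

/-- The events of a sweep over a list of positions. -/
def sweep (D : Raw) (side : Bool) (ps : List ℕ) (new : ℕ → ℕ → Bool) : List Event :=
  ps.flatMap fun i =>
    (((List.range D.n).filter fun v => new i v).map fun v => (false, side, v)) ++ [(true, side, i)]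

theorem sweep_append (side : Bool) (ps : List ℕ) (i : ℕ) (new : ℕ → ℕ → Bool) :
    D.sweep side (ps ++ [i]) new = D.sweep side ps new ++
      ((((List.range D.n).filter fun v => new i v).map fun v => (false, side, v)) ++
        [(true, side, i)]) := by
  simp [sweep]

theorem runKey_append (k : Key) (es es' : List Event) :
    D.runKey t T k (es ++ es') = D.runKey t T (D.runKey t T k es) es' := List.foldl_append

/-- Add to one of the first two components of a key. -/
def addSide (side : Bool) (k : Key) (c : ℕ) : Key :=
  if side then (k.1, k.2.1 + c, k.2.2) else (k.1 + c, k.2.1, k.2.2)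

theorem runKey_choices (side : Bool) (vs : List ℕ) (k : Key) :
    D.runKey t T k (vs.map fun v => (false, side, v)) =
      addSide side k (vs.filter fun v => decide (v ∈ T)).length := by
  induction vs generalizing k with
  | nil => cases side <;> rfl
  | cons v vs ih =>
    rw [List.map_cons, runKey, List.foldl_cons]
    refine (ih _).trans ?_
    by_cases h : v ∈ T <;> cases side <;> simp [stepKey, addSide, h] <;> omega

theorem runKey_sum (k : Key) (es : List Event) :
    (D.runKey t T k es).1 + (D.runKey t T k es).2.1 =
      k.1 + k.2.1 + ((voters es).filter fun v => decide (v ∈ T)).length := by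
  induction es generalizing k with
  | nil => rfl
  | cons e es ih =>
    rw [runKey, List.foldl_cons]
    refine (ih _).trans ?_
    obtain ⟨test, side, i⟩ := e
    cases test
    · have : voters ((false, side, i) :: es) = i :: voters es := rfl
      rw [this]
      by_cases h : i ∈ T <;> cases side <;> simp [stepKey, h] <;> omega
    · rfl

/-- The candidate at position `i` beats the preferred candidate if exactly the voters in `T` are
bribed. -/
def beats (D : Raw) (T : Finset ℕ) (i : ℕ) : Prop :=
  D.score D.pos + T.card < D.score i + (T.filter fun v => D.cover v i = true).card

instance : DecidablePred (D.beats T) := fun _ => inferInstanceAs (Decidable (_ < _))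

theorem length_filter_eq_card (l : List ℕ) (hl : l.Nodup) (p : ℕ → Bool) :
    (l.filter p).length = (l.toFinset.filter fun v => p v = true).card := by
  rw [← List.toFinset_filter, List.toFinset_card_of_nodup (hl.filter _)]

/-- In a sweep every voter whose bribery adds a position of the sweep occurs exactly once, and the
key counts the bribed voters among them and the positions that beat the preferred candidate. -/
def SweepSpec (D : Raw) (side : Bool) (ps : List ℕ) (new : ℕ → ℕ → Bool) : Prop :=
  (voters (D.sweep side ps new)).Nodup ∧
  (∀ v, v ∈ voters (D.sweep side ps new) ↔ v < D.n ∧ ∃ j ∈ ps, D.cover v j = true) ∧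
  ∀ T : Finset ℕ, (∀ v ∈ T, v < D.n) → ∀ k : Key, (if side then k.2.1 else k.1) = 0 →
    D.runKey T.card T k (D.sweep side ps new) =
      addSide side (k.1, k.2.1, k.2.2 + (ps.filter fun i => decide (D.beats T i)).length)
        (T.filter fun v => ∃ j ∈ ps, D.cover v j = true).card

/-- The relation `r` is the order in which positions are met, so one proof serves both directions.
Because covering persists along the sweep, each voter enters once, and at the test of a position the
counter equals the number of bribed voters covering it. -/
theorem sweep_spec {r : ℕ → ℕ → Prop} (hr : ∀ a b, r a b → ¬ r b a) (side : Bool)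
    (new : ℕ → ℕ → Bool) (ps : List ℕ) (hps : ps.Pairwise r)
    (hnew : ∀ i ∈ ps, ∀ v, new i v = true ↔ D.cover v i = true ∧
      ∀ j ∈ ps, r j i → D.cover v j = false)
    (hmono : ∀ i ∈ ps, ∀ j ∈ ps, r j i → ∀ v < D.n, D.cover v j = true → D.cover v i = true) :
    D.SweepSpec side ps new := by
  induction ps using List.reverseRecOn with
  | nil =>
    refine ⟨by simp [sweep, voters], by simp [sweep, voters], fun T _ k _ => ?_⟩
    cases side <;> simp [sweep, runKey, addSide]
  | append_singleton ps i ih =>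
    rw [List.pairwise_append] at hps
    obtain ⟨hps, -, hlast⟩ := hps
    have hlast : ∀ j ∈ ps, r j i := fun j hj => hlast j hj i (by simp)
    obtain ⟨h₁, h₂, h₃⟩ := ih hps
      (fun i' hi' v => by
        rw [hnew i' (by simp [hi']) v]
        refine and_congr_right fun _ => ⟨fun h j hj => h j (by simp [hj]), fun h j hj hji => ?_⟩
        rcases List.mem_append.1 hj with hj | hj
        · exact h j hj hji
        · rw [List.mem_singleton] at hj
          subst hj
          exact absurd hji (hr _ _ (hlast i' hi')))
      (fun i' hi' j hj => hmono i' (by simp [hi']) j (by simp [hj]))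
    have hnew' : ∀ v, new i v = true ↔ D.cover v i = true ∧ ∀ j ∈ ps, D.cover v j = false := by
      intro v
      rw [hnew i (by simp) v]
      refine and_congr_right fun _ => ⟨fun h j hj => h j (by simp [hj]) (hlast j hj),
        fun h j hj hji => ?_⟩
      rcases List.mem_append.1 hj with hj | hj
      · exact h j hj
      · rw [List.mem_singleton] at hj
        subst hj
        exact absurd hji (hr _ _ hji)
    have hmono' : ∀ j ∈ ps, ∀ v < D.n, D.cover v j = true → D.cover v i = true :=
      fun j hj => hmono i (by simp) j (by simp [hj]) (hlast j hj)
    have hv : voters (D.sweep side (ps ++ [i]) new) = voters (D.sweep side ps new) ++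
        (List.range D.n).filter fun v => new i v := by
      rw [sweep_append, voters_append, voters_append, voters_choices, voters_test, List.append_nil]
    refine ⟨?_, fun v => ?_, fun T hT k hk => ?_⟩
    · rw [hv, List.nodup_append']
      refine ⟨h₁, List.nodup_range.filter _, fun v hv₁ hv₂ => ?_⟩
      rw [List.mem_filter, hnew'] at hv₂
      obtain ⟨-, j, hj, hc⟩ := (h₂ v).1 hv₁
      rw [hv₂.2.2 j hj] at hc
      exact absurd hc (by simp)
    · rw [hv, List.mem_append, h₂, List.mem_filter, hnew', List.mem_range]
      constructor
      · rintro (⟨h, j, hj, hc⟩ | ⟨h, hc, -⟩)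
        · exact ⟨h, j, by simp [hj], hc⟩
        · exact ⟨h, i, by simp, hc⟩
      · rintro ⟨h, j, hj, hc⟩
        by_cases hex : ∃ j ∈ ps, D.cover v j = true
        · exact .inl ⟨h, hex⟩
        · push Not at hex
          refine .inr ⟨h, ?_, fun j hj => by simpa using hex j hj⟩
          rcases List.mem_append.1 hj with hj | hj
          · exact absurd hc (hex j hj)
          · rw [List.mem_singleton] at hj
            subst hj
            exact hc
    -- The bribed voters covering `i` split into those that entered earlier, all of whom still cover
    -- `i`, and those that enter at `i`.
    · have hcount : (T.filter fun v => ∃ j ∈ ps, D.cover v j = true).card +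
          (((List.range D.n).filter fun v => new i v).filter fun v => decide (v ∈ T)).length =
          (T.filter fun v => D.cover v i = true).card := by
        rw [List.filter_filter, length_filter_eq_card _ List.nodup_range,
          ← Finset.card_filter_add_card_filter_not (s := T.filter fun v => D.cover v i = true)
            (fun v => ∃ j ∈ ps, D.cover v j = true)]
        congr 2
        · ext v
          simp only [Finset.mem_filter]
          exact ⟨fun ⟨h, j, hj, hc⟩ => ⟨⟨h, hmono' j hj v (hT v h) hc⟩, j, hj, hc⟩,
            fun ⟨⟨h, _⟩, h'⟩ => ⟨h, h'⟩⟩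
        · ext v
          simp only [Finset.mem_filter, List.mem_toFinset, List.mem_range, Bool.and_eq_true,
            decide_eq_true_eq, hnew' v]
          constructor
          · rintro ⟨-, h, hc, hn⟩
            refine ⟨⟨h, hc⟩, fun ⟨j, hj, hc'⟩ => ?_⟩
            rw [hn j hj] at hc'
            exact absurd hc' (by simp)
          · rintro ⟨⟨h, hc⟩, hn⟩
            push Not at hn
            exact ⟨hT v h, h, hc, fun j hj => by simpa using hn j hj⟩
      have hex : (T.filter fun v => ∃ j ∈ ps ++ [i], D.cover v j = true) =
          T.filter fun v => D.cover v i = true := by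
        refine Finset.filter_congr fun v hv => ⟨?_, fun h => ⟨i, by simp, h⟩⟩
        rintro ⟨j, hj, hc⟩
        rcases List.mem_append.1 hj with hj | hj
        · exact hmono' j hj v (hT v hv) hc
        · rw [List.mem_singleton] at hj
          subst hj
          exact hc
      rw [sweep_append, runKey_append, h₃ T hT k hk, runKey_append, runKey_choices, hex, ← hcount]
      generalize (List.length _ : ℕ) = c at hcount ⊢
      have hb : decide (D.beats T i) = true ↔ ¬ D.score i +
          ((T.filter fun v => ∃ j ∈ ps, D.cover v j = true).card + c) ≤
            D.score D.pos + T.card := by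
        rw [hcount, decide_eq_true_eq, beats, not_le]
      generalize (T.filter fun v => ∃ j ∈ ps, D.cover v j = true).card = x at hb ⊢
      rw [List.filter_append, List.length_append]
      generalize (ps.filter fun i => decide (D.beats T i)).length = y
      by_cases hi : D.beats T i
      · have hle := hb.1 (by simpa using hi)
        cases side
        · simp only [Bool.false_eq_true, if_false] at hk
          simp [runKey, stepKey, addSide, hk, hi, hle, add_assoc]
        · simp only [if_true] at hk
          simp [runKey, stepKey, addSide, hk, hi, hle, add_assoc]
      · have hle := not_not.1 (mt hb.2 (by simpa using hi))
        cases side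
        · simp only [Bool.false_eq_true, if_false] at hk
          simp [runKey, stepKey, addSide, hk, hi, hle]
        · simp only [if_true] at hk
          simp [runKey, stepKey, addSide, hk, hi, hle]

end Raw

end StackProg

/-! ### The meaning of the decision by dynamic programming -/

namespace StackProg

open Raw

namespace Raw

variable {D : Raw} {T : Finset ℕ}

/-- The preferred candidate is on the axis, and all ballots are intervals. -/
structure WF (D : Raw) : Prop where
  pos_lt : D.pos < D.m
  interval : ∀ v < D.n, ∀ i j l, i ≤ j → j ≤ l → l < D.m → (D.entry v i).1 = true →
    (D.entry v l).1 = true → (D.entry v j).1 = true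

theorem cover_iff {v i : ℕ} : D.cover v i = true ↔ (D.entry v D.pos).1 = false ∧
    (D.entry v i).1 = false ∧ (i = D.pos ∨ (i < D.pos ∧ ∃ j < i, (D.entry v j).1 = true) ∨
      (D.pos < i ∧ ∃ j < D.m, i < j ∧ (D.entry v j).1 = true)) := by
  simp only [cover, Bool.and_eq_true, Bool.not_eq_true', Bool.or_eq_true, Nat.beq_eq, Nat.ble_eq,
    List.any_eq_true, List.mem_range, Nat.succ_le_iff]

theorem cover_pos_of_cover {v i : ℕ} (h : D.cover v i = true) : D.cover v D.pos = true := by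
  rw [cover_iff] at h ⊢
  exact ⟨h.1, h.1, .inl rfl⟩

/-- The ballot has an approval to the left of `j`. If `i` were approved too, the interval property
would put `j` on the ballot. -/
theorem cover_left_mono (h : D.WF) {v i j : ℕ} (hv : v < D.n) (hji : j < i) (hi : i < D.pos)
    (hc : D.cover v j = true) : D.cover v i = true := by
  rw [cover_iff] at hc ⊢
  obtain ⟨h₁, h₂, h₃ | ⟨_, l, hl, h₃⟩ | ⟨h₃, _⟩⟩ := hc
  · omega
  · refine ⟨h₁, ?_, .inr (.inl ⟨hi, l, by omega, h₃⟩)⟩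
    rw [← Bool.not_eq_true]
    intro h₄
    have := h.interval v hv l j i (by omega) hji.le (by have := h.pos_lt; omega) h₃ h₄
    rw [h₂] at this
    exact absurd this (by simp)
  · omega

theorem cover_right_mono (h : D.WF) {v i j : ℕ} (hv : v < D.n) (hij : i < j) (hi : D.pos < i)
    (hc : D.cover v j = true) : D.cover v i = true := by
  rw [cover_iff] at hc ⊢
  obtain ⟨h₁, h₂, h₃ | ⟨h₃, _⟩ | ⟨_, l, hl, hjl, h₃⟩⟩ := hc
  · omega
  · omega
  · refine ⟨h₁, ?_, .inr (.inr ⟨hi, l, hl, by omega, h₃⟩)⟩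
    rw [← Bool.not_eq_true]
    intro h₄
    have := h.interval v hv i j l hij.le hjl.le hl h₄ h₃
    rw [h₂] at this
    exact absurd this (by simp)

/-- Approvals on both sides of the preferred candidate would force its approval, and then nothing is
covered. -/
theorem not_cover_left_right (h : D.WF) {v i j : ℕ} (hv : v < D.n) (hi : i < D.pos)
    (hj : D.pos < j) (hc : D.cover v i = true) (hc' : D.cover v j = true) : False := by
  rw [cover_iff] at hc hc'
  obtain ⟨h₁, -, h₃ | ⟨_, l, hl, h₃⟩ | ⟨h₃, _⟩⟩ := hc
  · omega
  · obtain ⟨-, -, h₄ | ⟨h₄, _⟩ | ⟨_, l', hl', hjl', h₄⟩⟩ := hc'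
    · omega
    · omega
    · have := h.interval v hv l D.pos l' (by omega) (by omega) hl' h₃ h₄
      rw [h₁] at this
      exact absurd this (by simp)
  · omega

theorem leftEvents_eq : D.leftEvents = D.sweep false (List.range D.pos)
    fun i v => D.cover v i && !(List.range i).any fun j => D.cover v j := rfl

theorem rightEvents_eq : D.rightEvents =
    D.sweep true ((List.range D.m).filter fun i => Nat.ble (D.pos + 1) i).reverse
      fun i v => D.cover v i && !(List.range D.m).any fun j => Nat.ble (i + 1) j && D.cover v j :=
  rfl

theorem mem_rightPositions {i : ℕ} :
    i ∈ ((List.range D.m).filter fun i => Nat.ble (D.pos + 1) i).reverse ↔ i < D.m ∧ D.pos < i := by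
  rw [List.mem_reverse, List.mem_filter, List.mem_range, Nat.ble_eq, Nat.succ_le_iff]

theorem leftEvents_spec (h : D.WF) : D.SweepSpec false (List.range D.pos)
    fun i v => D.cover v i && !(List.range i).any fun j => D.cover v j := by
  refine sweep_spec (D := D) (r := (· < ·)) (fun a b h => Nat.lt_asymm h) false
    (fun i v => D.cover v i && !(List.range i).any fun j => D.cover v j) (List.range D.pos)
    List.pairwise_lt_range ?_ ?_
  · intro i hi v
    rw [List.mem_range] at hi
    simp only [Bool.and_eq_true, Bool.not_eq_true', List.any_eq_false, List.mem_range,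
      Bool.not_eq_true]
    exact and_congr_right fun _ => ⟨fun H j _ hji => H j hji, fun H j hji => H j (by omega) hji⟩
  · intro i hi j _ hji v hv
    exact cover_left_mono h hv hji (List.mem_range.1 hi)

theorem rightEvents_spec (h : D.WF) :
    D.SweepSpec true ((List.range D.m).filter fun i => Nat.ble (D.pos + 1) i).reverse
      fun i v => D.cover v i && !(List.range D.m).any fun j =>
        Nat.ble (i + 1) j && D.cover v j := by
  refine sweep_spec (D := D) (r := (· > ·)) (fun a b h => Nat.lt_asymm h) true
    (fun i v => D.cover v i && !(List.range D.m).any fun j => Nat.ble (i + 1) j && D.cover v j)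
    ((List.range D.m).filter fun i => Nat.ble (D.pos + 1) i).reverse
    (List.pairwise_reverse.2 (List.pairwise_lt_range.filter _)) ?_ ?_
  · intro i hi v
    rw [mem_rightPositions] at hi
    simp only [Bool.and_eq_true, Bool.not_eq_true', List.any_eq_false, List.mem_range,
      Bool.not_eq_true, mem_rightPositions, Nat.ble_eq, not_and, Nat.succ_le_iff]
    exact and_congr_right fun _ => ⟨fun H j hj hji => H j hj.1 hji,
      fun H j hj hji => H j ⟨hj, by omega⟩ hji⟩
  · intro i hi j _ hji v hv
    exact cover_right_mono h hv hji (mem_rightPositions.1 hi).2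

theorem voters_centerEvents : voters D.centerEvents = (List.range D.n).filter fun v =>
    D.cover v D.pos && !(List.range D.m).any fun j => !(Nat.beq j D.pos) && D.cover v j :=
  voters_choices _ _

theorem mem_voters_centerEvents {v : ℕ} : v ∈ voters D.centerEvents ↔ v < D.n ∧
    D.cover v D.pos = true ∧ ∀ j < D.m, j ≠ D.pos → D.cover v j = false := by
  rw [voters_centerEvents, List.mem_filter, List.mem_range, Bool.and_eq_true, Bool.not_eq_true',
    List.any_eq_false]
  simp only [List.mem_range, Bool.and_eq_true, Bool.not_eq_true', not_and, Bool.not_eq_true,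
    ← Nat.beq_eq, ne_eq]

theorem nodup_voters_events (h : D.WF) : (voters D.events).Nodup := by
  obtain ⟨hl₁, hl₂, -⟩ := leftEvents_spec h
  obtain ⟨hr₁, hr₂, -⟩ := rightEvents_spec h
  rw [← leftEvents_eq] at hl₁ hl₂
  rw [← rightEvents_eq] at hr₁ hr₂
  rw [events, voters_append, voters_append, List.nodup_append', List.nodup_append']
  refine ⟨hl₁, ⟨hr₁, ?_, fun v hv hv' => ?_⟩, fun v hv hv' => ?_⟩
  · rw [voters_centerEvents]
    exact List.nodup_range.filter _
  · obtain ⟨-, j, hj, hc⟩ := (hr₂ v).1 hv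
    rw [mem_rightPositions] at hj
    rw [(mem_voters_centerEvents.1 hv').2.2 j hj.1 (by omega)] at hc
    exact absurd hc (by simp)
  · obtain ⟨hn, j, hj, hc⟩ := (hl₂ v).1 hv
    rw [List.mem_range] at hj
    rcases List.mem_append.1 hv' with hv' | hv'
    · obtain ⟨-, i, hi, hc'⟩ := (hr₂ v).1 hv'
      exact not_cover_left_right h hn hj (mem_rightPositions.1 hi).2 hc hc'
    · rw [(mem_voters_centerEvents.1 hv').2.2 j (by have := h.pos_lt; omega) (by omega)] at hc
      exact absurd hc (by simp)

/-- The voters who do not approve the preferred candidate are sorted by whether their extension adds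
a position on the left, one on the right, or none besides the preferred candidate. -/
theorem mem_voters_events (h : D.WF) {v : ℕ} :
    v ∈ voters D.events ↔ v < D.n ∧ D.cover v D.pos = true := by
  obtain ⟨-, hl₂, -⟩ := leftEvents_spec h
  obtain ⟨-, hr₂, -⟩ := rightEvents_spec h
  rw [← leftEvents_eq] at hl₂
  rw [← rightEvents_eq] at hr₂
  rw [events, voters_append, voters_append, List.mem_append, List.mem_append, hl₂, hr₂,
    mem_voters_centerEvents]
  constructor
  · rintro (⟨hv, j, -, hc⟩ | ⟨hv, j, -, hc⟩ | ⟨hv, hc, -⟩)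
    · exact ⟨hv, cover_pos_of_cover hc⟩
    · exact ⟨hv, cover_pos_of_cover hc⟩
    · exact ⟨hv, hc⟩
  · rintro ⟨hv, hc⟩
    by_cases h₁ : ∃ j < D.m, j ≠ D.pos ∧ D.cover v j = true
    · obtain ⟨j, hj, hne, hc'⟩ := h₁
      rcases Nat.lt_or_gt_of_ne hne with hlt | hlt
      · exact .inl ⟨hv, j, List.mem_range.2 hlt, hc'⟩
      · exact .inr (.inl ⟨hv, j, mem_rightPositions.2 ⟨hj, hlt⟩, hc'⟩)
    · push Not at h₁
      exact .inr (.inr ⟨hv, hc, fun j hj hne => by simpa using h₁ j hj hne⟩)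

theorem runKey_events (h : D.WF) (hT : ∀ v ∈ T, v < D.n ∧ D.cover v D.pos = true) :
    (D.runKey T.card T (0, 0, 0) D.events).1 + (D.runKey T.card T (0, 0, 0) D.events).2.1 =
      T.card ∧
    (D.runKey T.card T (0, 0, 0) D.events).2.2 =
      ((Finset.range D.m).filter fun i => D.beats T i).card := by
  constructor
  · rw [runKey_sum, length_filter_eq_card _ (nodup_voters_events h)]
    simp only [zero_add]
    congr 1
    ext v
    simp only [Finset.mem_filter, List.mem_toFinset, mem_voters_events h, decide_eq_true_eq]
    exact ⟨fun h => h.2, fun h => ⟨hT v h, h⟩⟩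
  · obtain ⟨-, -, hl⟩ := leftEvents_spec h
    obtain ⟨-, -, hr⟩ := rightEvents_spec h
    have hl := hl T (fun v hv => (hT v hv).1) (0, 0, 0) rfl
    rw [← leftEvents_eq] at hl
    rw [events, runKey_append, hl, runKey_append]
    rw [← rightEvents_eq] at hr
    -- The left sweep leaves the counter of the right side at zero.
    rw [hr T (fun v hv => (hT v hv).1) _ rfl]
    -- The central events contain no tests; they also add to the left counter, but only after its
    -- last test.
    have hc : ∀ k : Key, (D.runKey T.card T k D.centerEvents).2.2 = k.2.2 := fun k => by
      rw [centerEvents, runKey_choices]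
      rfl
    rw [hc]
    simp only [addSide, Bool.false_eq_true, if_false, if_true, zero_add]
    rw [length_filter_eq_card _ List.nodup_range,
      length_filter_eq_card _ (List.nodup_reverse.2 (List.nodup_range.filter _)),
      ← Finset.card_union_of_disjoint]
    · congr 1
      ext i
      -- All voters in `T` cover the preferred candidate, so it gains exactly `T.card` points and
      -- need not be tested.
      have hp : ¬ D.beats T D.pos := by
        rw [beats, Finset.filter_true_of_mem fun v hv => (hT v hv).2]
        exact lt_irrefl _
      simp only [Finset.mem_union, Finset.mem_filter, List.mem_toFinset, mem_rightPositions,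
        List.mem_range, Finset.mem_range, decide_eq_true_eq]
      have := h.pos_lt
      constructor
      · rintro (⟨h₁, h₂⟩ | ⟨h₁, h₂⟩)
        · exact ⟨by omega, h₂⟩
        · exact ⟨h₁.1, h₂⟩
      · rintro ⟨h₁, h₂⟩
        rcases lt_trichotomy i D.pos with hi | rfl | hi
        · exact .inl ⟨hi, h₂⟩
        · exact absurd h₂ hp
        · exact .inr ⟨⟨h₁, hi⟩, h₂⟩
    · rw [Finset.disjoint_left]
      intro i hi hi'
      simp only [Finset.mem_filter, List.mem_toFinset, mem_rightPositions, List.mem_range] at hi hi'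
      omega

theorem cost_events (h : D.WF) (hT : ∀ v ∈ T, v ∈ voters D.events) :
    D.cost T D.events = ∑ v ∈ T, D.weight v := by
  rw [cost, ← List.sum_toFinset _ ((nodup_voters_events h).filter _)]
  refine Finset.sum_congr ?_ fun _ _ => rfl
  ext v
  simp only [List.mem_toFinset, List.mem_filter, decide_eq_true_eq]
  exact ⟨fun h => h.2, fun h => ⟨hT v h, h⟩⟩

/-- All tests are made with a guessed `t`. Every bribed voter is counted once, so the final check
that the two counters add up to `t` confirms the guess. -/
theorem yes_iff (h : D.WF) : D.yes = true ↔ ∃ T : Finset ℕ,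
    (∀ v ∈ T, v < D.n ∧ D.cover v D.pos = true) ∧ ∑ v ∈ T, D.weight v ≤ val D.budget ∧
      ((Finset.range D.m).filter fun i => D.beats T i).card + 1 ≤ D.size := by
  simp only [yes, List.any_eq_true, List.mem_range, Bool.and_eq_true, Nat.beq_eq, Nat.ble_eq]
  constructor
  · rintro ⟨t, -, s, hs, h₁, h₂⟩
    obtain ⟨T, hT, hk, hc⟩ := exists_of_mem_table D.events (nodup_voters_events h) hs
    have hT' : ∀ v ∈ T, v < D.n ∧ D.cover v D.pos = true :=
      fun v hv => (mem_voters_events h).1 (hT v hv)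
    have ht : t = T.card := by
      rw [← h₁, ← hk, runKey_sum, length_filter_eq_card _ (nodup_voters_events h)]
      simp only [zero_add]
      congr 1
      ext v
      simp only [Finset.mem_filter, List.mem_toFinset, decide_eq_true_eq]
      exact ⟨fun h => h.2, fun h => ⟨hT v h, h⟩⟩
    subst ht
    refine ⟨T, hT', ?_, ?_⟩
    · rw [← cost_events h hT, ← hc]
      exact le_self_add
    · rw [← (runKey_events h hT').2, hk]
      exact h₂
  · rintro ⟨T, hT, hc, hb⟩
    rw [← cost_events h fun v hv => (mem_voters_events h).2 (hT v hv)] at hc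
    obtain ⟨s, hs, hk, -⟩ := exists_mem_table (t := T.card) D.events le_rfl hc
    obtain ⟨h₁, h₂⟩ := runKey_events h hT
    refine ⟨T.card, ?_, s, hs, ?_, ?_⟩
    -- At most all `D.n` voters are bribed, so the guesses below `D.n + 1` suffice.
    · have := Finset.card_le_card (s := T) (t := Finset.range D.n)
        fun v hv => Finset.mem_range.2 (hT v hv).1
      rw [Finset.card_range] at this
      omega
    · rw [hk]; exact h₁
    · rw [hk, h₂]; exact hb

end Raw

end StackProg

/-! ### Instances and their raw data -/

namespace StackProg

open Computability (Γ' encodeNat)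
open AVBribery Finset

/-- The data of a price. -/
def priceEntry : ℕ∞ → Bool × Bits
  | none => (false, [])
  | some x => (true, encodeNat x)

/-- The data of an instance. -/
def rawOf (I : Instance) : Raw where
  p := encodeNat I.p
  k := encodeNat I.k
  budget := encodeNat I.budget
  axis := (List.finRange I.m).map fun i => encodeNat (I.axis i)
  rows := (List.finRange I.n).map fun v => (List.finRange I.m).map fun c =>
    (decide (c ∈ I.ballot v), priceEntry (I.price v c))

theorem word_rawOf (I : Instance) : (rawOf I).word = I.encode := by
  have h₁ : ∀ x : ℕ, numWord (encodeNat x) = encodeNumber x := fun _ => rfl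
  have h₂ : ∀ (b : Bool) (x : ℕ∞), entryWord (b, priceEntry x) = Γ'.bit b :: encodePrice x := by
    rintro b (_ | x) <;> rfl
  simp only [Raw.word, rawOf, Instance.encode, h₁, List.flatMap_map]
  congr 2
  funext v
  simp only [rowWord, Instance.encodeVoter, List.flatMap_map, h₂]

theorem normal_rawOf (I : Instance) : (rawOf I).Normal := by
  intro r hr e he hf
  simp only [rawOf, List.mem_map] at hr
  obtain ⟨v, -, rfl⟩ := hr
  obtain ⟨c, -, rfl⟩ := List.mem_map.1 he
  dsimp only at hf ⊢
  cases h : I.price v c with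
  | top => rfl
  | coe x => rw [h] at hf; exact absurd hf (by simp [priceEntry])

/-! ### Reading off an instance from its raw data -/

section

variable (I : Instance)

@[simp] theorem m_rawOf : (rawOf I).m = I.m := by simp [Raw.m, rawOf]

@[simp] theorem n_rawOf : (rawOf I).n = I.n := by simp [Raw.n, rawOf]

@[simp] theorem val_budget_rawOf : val (rawOf I).budget = I.budget := val_encodeNat _

theorem ax_rawOf (i : Fin I.m) : (rawOf I).ax i = I.axis i := by
  have : (rawOf I).axis.getD i [] = encodeNat (I.axis i) := by
    simp [rawOf]
  rw [Raw.ax, this, capVal_eq, val_encodeNat, m_rawOf]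
  have := (I.axis i).2
  omega

theorem entry_rawOf (v : Fin I.n) (i : Fin I.m) : (rawOf I).entry v i =
    (decide (I.axis i ∈ I.ballot v), priceEntry (I.price v (I.axis i))) := by
  rw [Raw.entry, ax_rawOf]
  simp [rawOf]

theorem appr_rawOf (v : Fin I.n) (i : Fin I.m) :
    ((rawOf I).entry v i).1 = true ↔ I.axis i ∈ I.ballot v := by
  rw [entry_rawOf]
  simp

theorem price_rawOf (v : Fin I.n) (i : Fin I.m) :
    (rawOf I).price v i = I.price v (I.axis i) := by
  rw [Raw.price, entry_rawOf]
  dsimp only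
  cases h : I.price v (I.axis i) with
  | top => rfl
  | coe x => simp [priceEntry, val_encodeNat]

@[simp] theorem size_rawOf : (rawOf I).size = I.k := by
  have := I.k_le_m
  rw [Raw.size, capVal_eq, m_rawOf]
  simp only [rawOf, val_encodeNat]
  omega

@[simp] theorem pos_rawOf : (rawOf I).pos = I.axis.symm I.p := by
  have h₁ : capVal ((rawOf I).m + 1) (rawOf I).p = I.p := by
    rw [capVal_eq, m_rawOf]
    simp only [rawOf, val_encodeNat]
    have := I.p.2
    omega
  rw [Raw.pos, h₁]
  set l := (List.range (rawOf I).m).filter fun i => Nat.beq ((rawOf I).ax i) I.p with hl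
  -- The axis is a bijection, so the position search has a single hit and the default of `headD` is
  -- never used.
  have h₂ : ∀ i, i ∈ l ↔ i = I.axis.symm I.p := by
    intro i
    rw [hl, List.mem_filter, List.mem_range, Nat.beq_eq, m_rawOf]
    constructor
    · rintro ⟨hi, h⟩
      have h₃ := ax_rawOf I ⟨i, hi⟩
      dsimp only at h₃
      rw [h] at h₃
      have h₄ : I.p = I.axis ⟨i, hi⟩ := Fin.ext h₃
      rw [h₄, Equiv.symm_apply_apply]
    · rintro rfl
      refine ⟨Fin.is_lt _, ?_⟩
      rw [ax_rawOf, Equiv.apply_symm_apply]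
  cases hl' : l with
  | nil => rw [hl'] at h₂; exact absurd ((h₂ _).2 rfl) (by simp)
  | cons i l' => exact (h₂ i).1 (by rw [hl']; simp)

theorem wf_rawOf : (rawOf I).WF where
  pos_lt := by
    rw [pos_rawOf, m_rawOf]
    exact Fin.is_lt _
  interval := by
    intro v hv i j l hij hjl hl h₁ h₂
    rw [n_rawOf] at hv
    rw [m_rawOf] at hl
    have hj : j < I.m := by omega
    have hi : i < I.m := by omega
    have h₁ := (appr_rawOf I ⟨v, hv⟩ ⟨i, hi⟩).1 h₁
    have h₂ := (appr_rawOf I ⟨v, hv⟩ ⟨l, hl⟩).1 h₂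
    refine (appr_rawOf I ⟨v, hv⟩ ⟨j, hj⟩).2 ?_
    exact (I.isCI ⟨v, hv⟩).out h₁ h₂ ⟨hij, hjl⟩

theorem valid_rawOf : (rawOf I).valid = true := by
  have hsize := size_rawOf I
  have hwf := wf_rawOf I
  have hp : capVal (I.m + 1) (rawOf I).p = I.p := by
    rw [capVal_eq]
    simp only [rawOf, val_encodeNat]
    have := I.p.2
    omega
  simp only [Raw.valid, Bool.and_eq_true, hp, hsize, m_rawOf, Nat.ble_eq]
  refine ⟨canonical_encodeNat _, canonical_encodeNat _, canonical_encodeNat _, ?_, ?_, I.p.2,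
    I.one_le_k, I.k_le_m, ?_, ?_, ?_, ?_⟩
  · rw [List.all_eq_true]
    intro l hl
    simp only [rawOf, List.mem_map] at hl
    obtain ⟨i, -, rfl⟩ := hl
    exact canonical_encodeNat _
  · rw [List.all_eq_true]
    intro r hr
    simp only [rawOf, List.mem_map] at hr
    obtain ⟨v, -, rfl⟩ := hr
    rw [List.all_eq_true]
    intro e he
    obtain ⟨c, -, rfl⟩ := List.mem_map.1 he
    dsimp only
    cases I.price v c with
    | top => rfl
    | coe x => exact canonical_encodeNat _
  · rw [List.all_eq_true]
    intro i hi
    rw [List.mem_range] at hi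
    rw [Nat.ble_eq, ax_rawOf I ⟨i, hi⟩]
    exact Fin.is_lt _
  · simp only [List.all_eq_true, List.mem_range, Bool.or_eq_true, Nat.beq_eq, Bool.not_eq_true',
      ← Bool.not_eq_true]
    intro i hi j hj
    rw [ax_rawOf I ⟨i, hi⟩, ax_rawOf I ⟨j, hj⟩]
    by_cases h : i = j
    · exact .inl h
    · refine .inr fun h' => h ?_
      have := I.axis.injective (Fin.ext h')
      simpa using this
  · rw [List.all_eq_true]
    intro r hr
    simp only [rawOf, List.mem_map] at hr
    obtain ⟨v, -, rfl⟩ := hr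
    simp
  · simp only [List.all_eq_true, List.mem_range, Bool.or_eq_true, Bool.not_eq_true',
      ← Bool.not_eq_true, Bool.and_eq_true, Nat.ble_eq]
    intro v hv i _ j _ l hl
    by_cases h : i ≤ j ∧ j ≤ l ∧ ((rawOf I).entry v i).1 = true ∧ ((rawOf I).entry v l).1 = true
    · exact .inr (hwf.interval v hv i j l h.1 h.2.1 (by rwa [m_rawOf]) h.2.2.1 h.2.2.2)
    · exact .inl h

end

/-- The price that is given by its data. -/
def entryPrice (e : Bool × Bits) : ℕ∞ := if e.1 then val e.2 else ⊤

/-- Without these conditions on the digits, different data would describe the same price. -/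
theorem priceEntry_entryPrice {e : Bool × Bits}
    (he : (bif e.1 then canonical e.2 else e.2.isEmpty) = true) :
    priceEntry (entryPrice e) = e := by
  obtain ⟨f, l⟩ := e
  cases f
  · rw [cond_false, List.isEmpty_iff] at he
    dsimp only at he
    subst he
    rfl
  · rw [cond_true] at he
    change (true, encodeNat (val l)) = _
    rw [encodeNat_val he]

/-- The tests in `valid` supply the fields of an instance, and canonical digits make the
representation unique, so that exactly `D` is recovered. -/
theorem exists_rawOf_eq {D : Raw} (h : D.valid = true) : ∃ I : Instance, rawOf I = D := by
  simp only [Raw.valid, Bool.and_eq_true, List.all_eq_true, List.mem_range, Nat.ble_eq,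
    Nat.beq_eq, Bool.or_eq_true, Bool.not_eq_true', ← Bool.not_eq_true] at h
  obtain ⟨hp, hk, hb, hax, hrows, hpm, hk₁, hkm, haxm, hinj, hlen, hci⟩ := h
  -- The cap lies just above `D.m`, so a value that passes the range test was not cut off.
  have hval : ∀ l : Bits, capVal (D.m + 1) l ≤ D.m → capVal (D.m + 1) l = val l := by
    intro l hl
    rw [capVal_eq] at hl ⊢
    omega
  have haxv : ∀ i < D.m, D.ax i = val (D.axis.getD i []) := fun i hi =>
    hval _ ((Nat.le_succ _).trans (haxm i hi))
  have hpv := hval D.p (by omega)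
  have hkv : D.size = val D.k := hval D.k hkm
  let f : Fin D.m → Fin D.m := fun i => ⟨D.ax i, haxm i i.2⟩
  have hf : Function.Injective f := by
    intro i j hij
    have := hinj i i.2 j j.2
    rcases this with h | h
    · exact Fin.ext h
    · exact absurd (congrArg Fin.val hij) h
  let axis : Equiv.Perm (Fin D.m) := Equiv.ofBijective f (Finite.injective_iff_bijective.1 hf)
  have hlen' : ∀ v < D.n, (D.rows.getD v []).length = D.m := by
    intro v hv
    rw [List.getD_eq_getElem _ _ hv]
    exact hlen _ (List.getElem_mem _)
  -- Rows are listed by candidate, whereas `Raw.entry` is indexed by position on the axis.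
  let ent : ℕ → ℕ → Entry := fun v c => (D.rows.getD v []).getD c (false, false, [])
  let I : Instance :=
    { m := D.m
      n := D.n
      axis := axis
      ballot := fun v => univ.filter fun c => (ent v c).1 = true
      price := fun v c => entryPrice (ent v c).2
      p := ⟨val D.p, by omega⟩
      k := val D.k
      budget := val D.budget
      one_le_k := by omega
      k_le_m := by omega
      isCI := by
        intro v
        refine ⟨fun i hi l hl j hj => ?_⟩
        simp only [Set.mem_ofPred_eq, mem_filter, mem_univ, true_and] at hi hl ⊢
        rcases hci v v.2 i i.2 j j.2 l l.2 with h | h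
        · exact absurd ⟨hj.1, hj.2, hi, hl⟩ h
        · exact h }
  refine ⟨I, ?_⟩
  obtain ⟨p, k, budget, axisL, rows⟩ := D
  simp only [rawOf, Raw.mk.injEq]
  refine ⟨encodeNat_val hp, encodeNat_val hk, encodeNat_val hb, ?_, ?_⟩
  · refine List.ext_getElem (by simp [I, Raw.m]) fun i hi hi' => ?_
    simp only [List.getElem_map, List.getElem_finRange]
    change encodeNat (Raw.ax _ i) = _
    rw [haxv i hi', List.getD_eq_getElem _ _ hi']
    exact encodeNat_val (hax _ (List.getElem_mem _))
  · refine List.ext_getElem (by simp [I, Raw.n]) fun v hv hv' => ?_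
    have hl := hlen' v hv'
    rw [List.getD_eq_getElem _ _ hv'] at hl
    refine List.ext_getElem (by simp [I, hl]) fun c hc hc' => ?_
    simp only [List.getElem_map, List.getElem_finRange, I, mem_filter, mem_univ, true_and, ent]
    have e : (rows.getD v []).getD c (false, false, []) = rows[v][c] := by
      rw [List.getD_eq_getElem _ _ hv', List.getD_eq_getElem _ _ hc']
    have hr := priceEntry_entryPrice (e := rows[v][c].2)
      (hrows _ (List.getElem_mem hv') _ (List.getElem_mem hc'))
    simp only [Fin.val_cast, e, hr]
    simp

end StackProg

/-! ### Bribery as the choice of a set of voters -/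

namespace StackProg

open AVBribery Finset

/-! ### Membership in a winning committee -/

section Winning

variable {C V : Type} [DecidableEq C] [Fintype C] [Fintype V]

/-- Exchange argument: a winning committee containing `p` contains every strictly better candidate;
conversely, in a winning committee without `p`, `p` can replace any member that is not strictly
better. -/
theorem exists_isWinningCommittee_iff (E : V → Finset C) {k : ℕ} (hk : k ≤ Fintype.card C) (p : C) :
    (∃ S, IsWinningCommittee E k S ∧ p ∈ S) ↔
      (univ.filter fun c => score E p < score E c).card < k := by
  constructor
  · rintro ⟨S, ⟨hS, hmax⟩, hp⟩
    have hsub : (univ.filter fun c => score E p < score E c) ⊆ S.erase p := by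
      intro c hc
      rw [mem_filter] at hc
      have hne : c ≠ p := by
        rintro rfl
        exact lt_irrefl _ hc.2
      refine mem_erase.2 ⟨hne, ?_⟩
      by_contra hcS
      have hc' : c ∉ S.erase p := fun h => hcS (mem_of_mem_erase h)
      -- Exchanging `p` for the better candidate `c` would raise the committee score.
      have h₁ := hmax (insert c (S.erase p)) (by
        rw [card_insert_of_notMem hc', card_erase_of_mem hp]
        have := card_pos.2 ⟨p, hp⟩
        omega)
      rw [committeeScore, committeeScore, sum_insert hc', ← add_sum_erase S _ hp] at h₁
      omega
    have h₁ := card_le_card hsub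
    rw [card_erase_of_mem hp] at h₁
    have := card_pos.2 ⟨p, hp⟩
    omega
  · intro h
    obtain ⟨S, hS, hmax⟩ := exists_max_image (powersetCard k (univ : Finset C)) (committeeScore E)
      (powersetCard_nonempty.2 (by simpa using hk))
    have hcard : S.card = k := (mem_powersetCard.1 hS).2
    have hmax' : ∀ T : Finset C, T.card = k → committeeScore E T ≤ committeeScore E S :=
      fun T hT => hmax T (mem_powersetCard.2 ⟨subset_univ _, hT⟩)
    by_cases hp : p ∈ S
    · exact ⟨S, ⟨hcard, hmax'⟩, hp⟩
    -- `S` has `k` members, but fewer than `k` candidates are strictly better than `p`.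
    · obtain ⟨c, hc, hle⟩ : ∃ c ∈ S, ¬ score E p < score E c := by
        by_contra! hcon
        have := card_le_card (s := S) (t := univ.filter fun c => score E p < score E c)
          fun c hc => mem_filter.2 ⟨mem_univ _, hcon c hc⟩
        omega
      have hp' : p ∉ S.erase c := fun h => hp (mem_of_mem_erase h)
      refine ⟨insert p (S.erase c), ⟨?_, fun T hT => (hmax' T hT).trans ?_⟩, mem_insert_self _ _⟩
      · rw [card_insert_of_notMem hp', card_erase_of_mem hc]
        have := card_pos.2 ⟨c, hc⟩
        omega
      · rw [committeeScore, committeeScore, sum_insert hp', ← add_sum_erase S _ hc]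
        omega

end Winning

theorem card_filter_range_eq (n : ℕ) (P : ℕ → Prop) [DecidablePred P] :
    ((range n).filter P).card = (univ.filter fun i : Fin n => P i).card := by
  rw [card_filter, card_filter, sum_range]

theorem card_filter_eq_of_lt {n : ℕ} {T : Finset ℕ} (hT : ∀ v ∈ T, v < n) (P : ℕ → Prop)
    [DecidablePred P] :
    (T.filter P).card = (univ.filter fun v : Fin n => (v : ℕ) ∈ T ∧ P v).card := by
  rw [← card_filter_range_eq n fun v => v ∈ T ∧ P v]
  congr 1
  ext v
  simp only [mem_filter, mem_range]
  exact ⟨fun ⟨h, h'⟩ => ⟨hT v h, h, h'⟩, fun ⟨_, h, h'⟩ => ⟨h, h'⟩⟩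

/-! ### From briberies to sets of voters and back -/

section

variable (I : Instance)

/-- The bribery of the voter `v` adds the candidate `c`. -/
def adds (v : Fin I.n) (c : Fin I.m) : Prop :=
  (rawOf I).cover v (I.axis.symm c) = true

instance (v : Fin I.n) : DecidablePred (adds I v) := fun _ => inferInstanceAs (Decidable (_ = _))

theorem adds_iff {v : Fin I.n} {c : Fin I.m} : adds I v c ↔ I.p ∉ I.ballot v ∧
    c ∉ I.ballot v ∧ (c = I.p ∨
      (I.axis.symm c < I.axis.symm I.p ∧ ∃ d ∈ I.ballot v, I.axis.symm d < I.axis.symm c) ∨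
      (I.axis.symm I.p < I.axis.symm c ∧ ∃ d ∈ I.ballot v, I.axis.symm c < I.axis.symm d)) := by
  rw [adds, Raw.cover_iff, pos_rawOf, ← Bool.not_eq_true, ← Bool.not_eq_true, appr_rawOf,
    appr_rawOf, Equiv.apply_symm_apply, Equiv.apply_symm_apply, m_rawOf]
  refine and_congr_right fun _ => and_congr_right fun _ => or_congr ?_ (or_congr ?_ ?_)
  · rw [Fin.val_inj, Equiv.apply_eq_iff_eq]
  · refine and_congr_right fun _ => ⟨?_, ?_⟩
    · rintro ⟨j, hj, h⟩
      have hjm : j < I.m := hj.trans (Fin.is_lt _)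
      have h := (appr_rawOf I v ⟨j, hjm⟩).1 h
      exact ⟨_, h, by rw [Equiv.symm_apply_apply]; exact hj⟩
    · rintro ⟨d, hd, h⟩
      exact ⟨I.axis.symm d, h, (appr_rawOf I v _).2 (by rwa [Equiv.apply_symm_apply])⟩
  · refine and_congr_right fun _ => ⟨?_, ?_⟩
    · rintro ⟨j, hjm, hj, h⟩
      have h := (appr_rawOf I v ⟨j, hjm⟩).1 h
      exact ⟨_, h, by rw [Equiv.symm_apply_apply]; exact hj⟩
    · rintro ⟨d, hd, h⟩
      exact ⟨I.axis.symm d, Fin.is_lt _, h, (appr_rawOf I v _).2 (by rwa [Equiv.apply_symm_apply])⟩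

theorem score_rawOf (i : Fin I.m) : (rawOf I).score i = score I.ballot (I.axis i) := by
  rw [Raw.score, Raw.length_filter_eq_card _ List.nodup_range, n_rawOf, List.toFinset_range,
    card_filter_range_eq, score]
  congr 1
  ext v
  simp only [mem_filter, mem_univ, true_and, appr_rawOf]

theorem weight_rawOf (v : Fin I.n) :
    (rawOf I).weight v = ∑ c ∈ univ.filter (adds I v), I.price v c := by
  rw [Raw.weight, ← List.sum_toFinset _ (List.nodup_range.filter _), List.toFinset_filter,
    List.toFinset_range, m_rawOf, sum_filter, sum_range, sum_filter]
  conv_rhs => rw [← Equiv.sum_comp I.axis]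
  refine sum_congr rfl fun i _ => ?_
  simp only [price_rawOf, adds, Equiv.symm_apply_apply]

/-- The voters in `T`. -/
def chosen (T : Finset ℕ) : Finset (Fin I.n) := univ.filter fun v => (v : ℕ) ∈ T

theorem sum_weight_rawOf {T : Finset ℕ} (hT : ∀ v ∈ T, v < I.n) :
    ∑ v ∈ T, (rawOf I).weight v =
      ∑ v ∈ chosen I T, ∑ c ∈ univ.filter (adds I v), I.price v c := by
  have h₁ : T = (range I.n).filter fun v => v ∈ T := by
    ext v
    simp only [mem_filter, mem_range]
    exact ⟨fun h => ⟨hT v h, h⟩, fun h => h.2⟩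
  rw [chosen, sum_filter]
  conv_lhs => rw [h₁, sum_filter, sum_range]
  simp only [weight_rawOf]

theorem beats_rawOf {T : Finset ℕ} (hT : ∀ v ∈ T, v < I.n) (i : Fin I.m) :
    (rawOf I).beats T i ↔ score I.ballot I.p + (chosen I T).card <
      score I.ballot (I.axis i) + ((chosen I T).filter fun v => adds I v (I.axis i)).card := by
  rw [Raw.beats, score_rawOf, pos_rawOf, score_rawOf, Equiv.apply_symm_apply,
    card_filter_eq_of_lt hT, chosen, filter_filter]
  have : T.card = (univ.filter fun v : Fin I.n => (v : ℕ) ∈ T).card := by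
    have := card_filter_eq_of_lt hT fun _ => True
    simpa using this
  rw [this]
  simp only [adds, Equiv.symm_apply_apply]

theorem card_beats_rawOf {T : Finset ℕ} (hT : ∀ v ∈ T, v < I.n) :
    ((range (rawOf I).m).filter fun i => (rawOf I).beats T i).card =
      (univ.filter fun c => score I.ballot I.p + (chosen I T).card <
        score I.ballot c + ((chosen I T).filter fun v => adds I v c).card).card := by
  rw [m_rawOf, card_filter_range_eq, card_filter, card_filter]
  conv_rhs => rw [← Equiv.sum_comp I.axis]
  simp only [beats_rawOf I hT]

/-- The decision procedure in terms of sets of voters. -/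
theorem yes_rawOf_iff : (rawOf I).yes = true ↔ ∃ T : Finset (Fin I.n),
    (∀ v ∈ T, I.p ∉ I.ballot v) ∧
    ∑ v ∈ T, ∑ c ∈ univ.filter (adds I v), I.price v c ≤ (I.budget : ℕ∞) ∧
    (univ.filter fun c => score I.ballot I.p + T.card <
      score I.ballot c + (T.filter fun v => adds I v c).card).card < I.k := by
  have hcov : ∀ v : Fin I.n, (rawOf I).cover v (rawOf I).pos = true ↔ I.p ∉ I.ballot v := by
    intro v
    rw [pos_rawOf]
    refine (adds_iff I (v := v) (c := I.p)).trans ?_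
    simp
  rw [Raw.yes_iff (wf_rawOf I), n_rawOf, size_rawOf, val_budget_rawOf]
  constructor
  · rintro ⟨T, hT, h₁, h₂⟩
    have hT' : ∀ v ∈ T, v < I.n := fun v hv => (hT v hv).1
    rw [sum_weight_rawOf I hT'] at h₁
    rw [card_beats_rawOf I hT'] at h₂
    exact ⟨chosen I T, fun v hv => (hcov v).1 (hT v (mem_filter.1 hv).2).2, h₁, h₂⟩
  · rintro ⟨T, hT, h₁, h₂⟩
    have hc : chosen I (T.map Fin.valEmbedding) = T := by
      ext v
      simp [chosen, Fin.val_inj]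
    have hT' : ∀ v ∈ T.map Fin.valEmbedding, v < I.n := by
      intro v hv
      obtain ⟨w, -, rfl⟩ := mem_map.1 hv
      exact w.2
    refine ⟨T.map Fin.valEmbedding, fun v hv => ⟨hT' v hv, ?_⟩, ?_, ?_⟩
    · obtain ⟨w, hw, rfl⟩ := mem_map.1 hv
      exact (hcov w).2 (hT w hw)
    · rwa [sum_weight_rawOf I hT', hc]
    · rw [card_beats_rawOf I hT', hc]
      exact h₂

/-- The ballots after the bribery of the voters in `T`. -/
def bribed (T : Finset (Fin I.n)) (v : Fin I.n) : Finset (Fin I.m) :=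
  I.ballot v ∪ univ.filter fun c => v ∈ T ∧ adds I v c

theorem score_bribed (T : Finset (Fin I.n)) (c : Fin I.m) :
    score (bribed I T) c = score I.ballot c + (T.filter fun v => adds I v c).card := by
  rw [score, score, ← card_union_of_disjoint]
  · congr 1
    ext v
    simp [bribed]
  · rw [disjoint_left]
    intro v hv hv'
    rw [mem_filter] at hv hv'
    exact ((adds_iff I).1 hv'.2).2.1 hv.2

/-- For a voter in `T` the new ballot consists of `p` and everything between `p` and some old
approval, which is an interval around `p`. -/
theorem isCI_bribed {T : Finset (Fin I.n)} (hT : ∀ v ∈ T, I.p ∉ I.ballot v) :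
    IsCI I.axis (bribed I T) := by
  intro v
  by_cases hv : v ∈ T
  · have hp := hT v hv
    -- The weak inequalities absorb the old approvals, which `adds` leaves out.
    have key : ∀ i : Fin I.m, I.axis i ∈ bribed I T v ↔ i = I.axis.symm I.p ∨
        (i < I.axis.symm I.p ∧ ∃ d ∈ I.ballot v, I.axis.symm d ≤ i) ∨
        (I.axis.symm I.p < i ∧ ∃ d ∈ I.ballot v, i ≤ I.axis.symm d) := by
      intro i
      simp only [bribed, mem_union, mem_filter, mem_univ, true_and, hv, adds_iff, hp,
        not_false_eq_true, Equiv.symm_apply_apply]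
      constructor
      · rintro (h | ⟨-, h | ⟨h₁, d, hd, h₂⟩ | ⟨h₁, d, hd, h₂⟩⟩)
        · rcases lt_trichotomy i (I.axis.symm I.p) with hi | hi | hi
          · exact .inr (.inl ⟨hi, _, h, by simp⟩)
          · exact .inl hi
          · exact .inr (.inr ⟨hi, _, h, by simp⟩)
        · exact .inl (by rw [← h, Equiv.symm_apply_apply])
        · exact .inr (.inl ⟨h₁, d, hd, h₂.le⟩)
        · exact .inr (.inr ⟨h₁, d, hd, h₂.le⟩)
      · intro h
        by_cases hi : I.axis i ∈ I.ballot v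
        · exact .inl hi
        · refine .inr ⟨hi, ?_⟩
          rcases h with h | ⟨h₁, d, hd, h₂⟩ | ⟨h₁, d, hd, h₂⟩
          · exact .inl (by rw [h, Equiv.apply_symm_apply])
          · refine .inr (.inl ⟨h₁, d, hd, lt_of_le_of_ne h₂ ?_⟩)
            rintro rfl
            rw [Equiv.apply_symm_apply] at hi
            exact hi hd
          · refine .inr (.inr ⟨h₁, d, hd, lt_of_le_of_ne h₂ ?_⟩)
            rintro rfl
            rw [Equiv.apply_symm_apply] at hi
            exact hi hd
    refine ⟨fun i hi l hl j hj => ?_⟩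
    simp only [Set.mem_ofPred_eq, key] at hi hl ⊢
    obtain ⟨hij, hjl⟩ := hj
    rcases lt_trichotomy j (I.axis.symm I.p) with h | h | h
    · rcases hi with rfl | ⟨_, d, hd, hdi⟩ | ⟨hi, _⟩
      · exact absurd hij (not_le.2 h)
      · exact .inr (.inl ⟨h, d, hd, hdi.trans hij⟩)
      · exact absurd (hi.trans_le hij) (not_lt.2 h.le)
    · exact .inl h
    · rcases hl with rfl | ⟨hl, _⟩ | ⟨_, d, hd, hdl⟩
      · exact absurd hjl (not_le.2 h)
      · exact absurd (hjl.trans_lt hl) (not_lt.2 h.le)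
      · exact .inr (.inr ⟨h, d, hd, hjl.trans hdl⟩)
  · have : bribed I T v = I.ballot v := by
      ext c
      simp [bribed, hv]
    rw [this]
    exact I.isCI v

theorem addCost_bribed (T : Finset (Fin I.n)) : addCost I.price I.ballot (bribed I T) =
    ∑ v ∈ T, ∑ c ∈ univ.filter (adds I v), I.price v c := by
  rw [addCost, ← sum_filter_add_sum_filter_not univ (fun v => v ∈ T)]
  have h₁ : ∀ v ∈ univ.filter (fun v => v ∈ T),
      ∑ c ∈ bribed I T v \ I.ballot v, I.price v c =
        ∑ c ∈ univ.filter (adds I v), I.price v c := by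
    intro v hv
    refine sum_congr ?_ fun _ _ => rfl
    ext c
    simp only [bribed, mem_sdiff, mem_union, mem_filter, mem_univ, true_and] at hv ⊢
    constructor
    · rintro ⟨h | h, h'⟩
      · exact absurd h h'
      · exact h.2
    · exact fun h => ⟨.inr ⟨hv, h⟩, ((adds_iff I).1 h).2.1⟩
  have h₂ : ∀ v ∈ univ.filter (fun v => v ∉ T),
      ∑ c ∈ bribed I T v \ I.ballot v, I.price v c = 0 := by
    intro v hv
    have : bribed I T v \ I.ballot v = ∅ := by
      ext c
      simp only [bribed, mem_sdiff, mem_union, mem_filter, mem_univ, true_and] at hv ⊢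
      simp [hv]
    rw [this, sum_empty]
  rw [sum_congr rfl h₁, sum_congr rfl h₂, sum_const_zero, add_zero, filter_univ_mem]

/-- Minimality of the extension: an added candidate is `p` or lies between `p` and an old approval,
so every interval containing the old ballot and `p` contains it. -/
theorem mem_of_adds {E : Finset (Fin I.m)} {v : Fin I.n} {c : Fin I.m} (hE : I.ballot v ⊆ E)
    (hci : {i : Fin I.m | I.axis i ∈ E}.OrdConnected) (hp : I.p ∈ E) (h : adds I v c) : c ∈ E := by
  have key : ∀ {a b : Fin I.m}, a ∈ E → b ∈ E → I.axis.symm a ≤ I.axis.symm c →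
      I.axis.symm c ≤ I.axis.symm b → c ∈ E := by
    intro a b ha hb hac hcb
    have := hci.out (x := I.axis.symm a) (y := I.axis.symm b)
      (by simpa using ha) (by simpa using hb) ⟨hac, hcb⟩
    simpa using this
  rw [adds_iff] at h
  obtain ⟨-, -, rfl | ⟨h₁, d, hd, h₂⟩ | ⟨h₁, d, hd, h₂⟩⟩ := h
  · exact hp
  · exact key (hE hd) hp h₂.le h₁.le
  · exact key hp (hE hd) h₁.le h₂.le

/-- The decision by dynamic programming is correct. -/
theorem yes_rawOf : (rawOf I).yes = true ↔ I.IsYes := by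
  have hk : I.k ≤ Fintype.card (Fin I.m) := by simpa using I.k_le_m
  have hpadd : ∀ v, adds I v I.p ↔ I.p ∉ I.ballot v := fun v => by
    rw [adds_iff]
    simp
  rw [yes_rawOf_iff]
  constructor
  · rintro ⟨T, hT, hcost, hcard⟩
    refine ⟨bribed I T, fun v => subset_union_left, isCI_bribed I hT, ?_, ?_⟩
    · rwa [addCost_bribed]
    · rw [exists_isWinningCommittee_iff _ hk]
      have : (T.filter fun v => adds I v I.p) = T :=
        filter_true_of_mem fun v hv => (hpadd v).2 (hT v hv)
      simp only [score_bribed, this]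
      exact hcard
  · rintro ⟨E, hE, hci, hcost, hwin⟩
    rw [exists_isWinningCommittee_iff _ hk] at hwin
    -- Keep only the voters to whom `E` adds `p`, each with the minimal extension.
    let T : Finset (Fin I.n) := univ.filter fun v => I.p ∈ E v ∧ I.p ∉ I.ballot v
    have hT : ∀ v ∈ T, I.p ∈ E v ∧ I.p ∉ I.ballot v := fun v hv => (mem_filter.1 hv).2
    have hsub : ∀ v, bribed I T v ⊆ E v := by
      intro v c hc
      simp only [bribed, mem_union, mem_filter, mem_univ, true_and] at hc
      rcases hc with hc | ⟨hv, hc⟩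
      · exact hE v hc
      · exact mem_of_adds I (hE v) (hci v) (hT v hv).1 hc
    refine ⟨T, fun v hv => (hT v hv).2, ?_, ?_⟩
    · rw [← addCost_bribed]
      refine le_trans ?_ hcost
      exact sum_le_sum fun v _ => sum_le_sum_of_subset (sdiff_subset_sdiff (hsub v) le_rfl)
    · refine lt_of_le_of_lt (card_le_card ?_) hwin
      -- The score of `p` is the same as under `E`, and all other scores are at most those under
      -- `E`, so no new candidate beats `p`.
      have hp : score E I.p = score I.ballot I.p + T.card := by
        rw [score, score, ← card_union_of_disjoint]
        · congr 1
          ext v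
          simp only [T, mem_union, mem_filter, mem_univ, true_and]
          have := @hE v I.p
          tauto
        · rw [disjoint_left]
          exact fun v hv hv' => (hT v hv').2 (mem_filter.1 hv).2
      intro c hc
      rw [mem_filter] at hc ⊢
      refine ⟨hc.1, ?_⟩
      rw [hp]
      refine hc.2.trans_le ?_
      rw [← score_bribed]
      exact card_le_card fun v hv => by
        rw [mem_filter] at hv ⊢
        exact ⟨hv.1, hsub v hv.2⟩

/-- The parser returns some data for every word. Comparing the word of these data with `w`, together
with `valid`, rejects all words that are not encodings. -/
theorem decideWord_iff (w : List Computability.Γ') :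
    decideWord w = true ↔ w ∈ addApprovalsCIBribery := by
  rw [decideWord, Bool.and_eq_true, Bool.and_eq_true, wordBeq_iff]
  constructor
  · rintro ⟨h₁, h₂, h₃⟩
    obtain ⟨I, hI⟩ := exists_rawOf_eq h₂
    rw [← hI] at h₁ h₃
    exact ⟨I, by rw [← word_rawOf, h₁], (yes_rawOf I).1 h₃⟩
  · rintro ⟨I, rfl, hI⟩
    rw [← word_rawOf, parse_word (normal_rawOf I)]
    exact ⟨rfl, valid_rawOf I, (yes_rawOf I).2 hI⟩

end

end StackProg

theorem mainTheorem5 : AVBribery.InP AVBribery.addApprovalsCIBribery :=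
  StackProg.inP_of_poly StackProg.poly_decideWord StackProg.decideWord_iff
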